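/- **Definitions.** Fix an integer $n\ge 1$. A *tableau* is a standard Young tableau of shape $3\times n$: a filling of three rows (numbered $1,2,3$ from bottom to top) of length $n$ by the numbers $1,\dots,3n$, each used once, increasing along the rows from left to right and along the columns from bottom to top. The *Schützenberger involution* rotates a tableau by $180^\circ$ and replaces each entry $i$ by $3n+1-i$. A *PC prograph* of size $n$ is a connected oriented planar graph without directed cycles, drawn in the plane up to deformation, whose vertices are $n$ coproducts (one input, two outputs) and $n$ products (two inputs, one output). Exactly one coproduct has its input unconnected (the input of the prograph), exactly one product has its output unconnected (the output of the prograph), and both of these dangling half-edges lie in the exterior face. A *rooted bipolar-oriented triangulation of the sphere* with $2n$ triangles is a connected planar map on the sphere (multiple edges allowed), up to orientation-preserving homeomorphism, with $2n$ faces, all of degree $3$, together with an orientation of its edges without directed cycles that has exactly one source and exactly one sink (the poles), and a distinguished root edge from the source to the sink. *From tableaux to prographs.* Given a tableau, start with one wire, the input of the prograph, and read $1,2,\dots,3n$ in this order; each number labels the leftmost wire not yet labelled. If the number is in row $1$, its wire becomes the input of a new coproduct, and the left and right outputs of this coproduct take its place among the unlabelled wires. If it is in row $2$, its wire is put aside to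 the left, to become the left input of a later product. If it is in row $3$, its wire becomes the right input of a new product, whose left input is the rightmost wire that was put aside and not yet used, and the output of this product becomes the leftmost unlabelled wire. The one wire left at the end is the output of the prograph. *Graph duality.* Given a PC prograph, embed it on the sphere, connect its output to its input by an edge through the exterior, and take the dual map; each dual edge is directed so that it crosses the corresponding directed edge of the prograph from left to right, and the root edge is the one dual to the added edge. **Theorem.** For every $n\ge 1$: 1. The first construction is a bijection from the $3\times n$ standard Young tableaux onto the PC prographs of size $n$, and graph duality is a bijection from the PC prographs of size $n$ onto the rooted bipolar-oriented triangulations of the sphere with $2n$ triangles. Hence their composition $\Phi$ is an explicit bijection from the $3\times n$ standard Young tableaux onto the rooted bipolar-oriented triangulations of the sphere with $2n$ triangles. 2. $\Phi$ commutes with the Schützenberger involution: if $T'$ is the image of a tableau $T$ under it, then $\Phi(T')$ is obtained from $\Phi(T)$ by rotating the sphere by $180^\circ$ so that the poles are swapped (the root edge being kept) and reversing the direction of every edge. -/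

import Mathlib

namespace PC

open Equiv

/-! ## Three-row rectangular standard Young tableaux -/

/-- A standard Young tableau of shape `3 × n`. Row `0` is the row that contains the smallest
entry (the bottom row in French notation), and entries increase along rows and along columns.
The value `i : Fin (3 * n)` stands for the entry `i + 1 ∈ {1, …, 3n}`. -/
structure Tableau (n : ℕ) where
  entry : Fin 3 × Fin n ≃ Fin (3 * n)
  row_lt : ∀ r : Fin 3, StrictMono fun k : Fin n => entry (r, k)
  col_lt : ∀ k : Fin n, StrictMono fun r : Fin 3 => entry (r, k)

/-- The Schützenberger involution on rectangular tableaux: rotate the tableau by 180 degrees and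
replace every entry `i ∈ {1, …, 3n}` by `3n + 1 - i`. -/
def Tableau.schutzenberger {n : ℕ} (T : Tableau n) : Tableau n where
  entry := ((Fin.revPerm.prodCongr Fin.revPerm).trans T.entry).trans Fin.revPerm
  row_lt := fun r a b h => by
    have := T.row_lt r.rev (Fin.rev_lt_rev.mpr h)
    simpa [Fin.rev_lt_rev] using this
  col_lt := fun k a b h => by
    have := T.col_lt k.rev (Fin.rev_lt_rev.mpr h)
    simpa [Fin.rev_lt_rev] using this

/-! ## Oriented graphs drawn on surfaces -/

/-- Raw data of an oriented graph drawn on an oriented surface, up to homeomorphism.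
`D` is the finite set of half-edges, `σ` sends a half-edge to the next one counterclockwise around
its vertex (so vertices are the cycles of `σ`), `α` exchanges the two halves of every edge (a
fixed point of `α` is a dangling, unconnected half-edge), and `out d` says that the edge containing
`d` is directed away from the vertex of `d`. -/
structure OMap where
  D : Type
  [finite : Finite D]
  [decEq : DecidableEq D]
  σ : Perm D
  α : Perm D
  out : D → Bool

attribute [instance] OMap.finite OMap.decEq

namespace OMap

/-- `α` is an involution, and the two halves of an edge carry opposite directions. -/
def WellFormed (M : OMap) : Prop :=
  (∀ d, M.α (M.α d) = d) ∧ ∀ d, M.α d ≠ d → M.out (M.α d) = !(M.out d)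

def Connected (M : OMap) : Prop :=
  ∀ x y : M.D, Relation.EqvGen (fun a b => b = M.σ a ∨ b = M.α a) x y

/-- The face permutation: walk along the half-edge `d` and then turn to the next edge of the
boundary of the face lying to the left of `d`. Its cycles are the faces. -/
def φ (M : OMap) : Perm M.D := M.σ⁻¹ * M.α

noncomputable def numVertices (M : OMap) : ℕ := Nat.card (Quotient (Perm.SameCycle.setoid M.σ))

noncomputable def numEdges (M : OMap) : ℕ := Nat.card (Quotient (Perm.SameCycle.setoid M.α))

noncomputable def numFaces (M : OMap) : ℕ := Nat.card (Quotient (Perm.SameCycle.setoid M.φ))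

/-- A connected map without dangling half-edges lies on the sphere iff `V - E + F = 2`. -/
def Spherical (M : OMap) : Prop := M.numVertices + M.numFaces = M.numEdges + 2

/-- There is an edge directed from the vertex of `x` to the vertex of `y`. -/
def Arc (M : OMap) (x y : M.D) : Prop :=
  ∃ d, M.out d = true ∧ M.α d ≠ d ∧ M.σ.SameCycle x d ∧ M.σ.SameCycle (M.α d) y

/-- There is no directed cycle. -/
def Acyclic (M : OMap) : Prop := ∀ x, ¬ Relation.TransGen M.Arc x x

/-- The vertex of `d` is a source: all its edges leave it. -/
def IsSource (M : OMap) (d : M.D) : Prop := ∀ e, M.σ.SameCycle d e → M.out e = true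

/-- The vertex of `d` is a sink: all its edges enter it. -/
def IsSink (M : OMap) (d : M.D) : Prop := ∀ e, M.σ.SameCycle d e → M.out e = false

/-- `d` is the input of a coproduct: its vertex has exactly one other pair of half-edges, both
outputs. Drawn with the input at the bottom, `σ d` is the right output and `σ (σ d)` is the left
output. -/
def IsCoproduct (M : OMap) (d : M.D) : Prop :=
  M.σ (M.σ (M.σ d)) = d ∧ M.out d = false ∧ M.out (M.σ d) = true ∧ M.out (M.σ (M.σ d)) = true ∧
    M.σ (M.σ d) ≠ M.σ d

/-- `d` is the output of a product: its vertex has exactly one other pair of half-edges, both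
inputs. Drawn with the output at the top, `σ d` is the left input and `σ (σ d)` is the right
input. -/
def IsProduct (M : OMap) (d : M.D) : Prop :=
  M.σ (M.σ (M.σ d)) = d ∧ M.out d = true ∧ M.out (M.σ d) = false ∧ M.out (M.σ (M.σ d)) = false ∧
    M.σ (M.σ d) ≠ M.σ d

/-- The dual map, for a map without dangling half-edges. Vertices and faces are exchanged; the
half-edge `d` becomes the half, issued from the face to the left of `d`, of the dual edge that
crosses the edge of `d`. Dual edges are directed so that they cross the original directed edges
from left to right. -/
def dual (M : OMap) : OMap where
  D := M.D
  σ := M.φ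
  α := M.α
  out := M.out

/-- Reversing the direction of all edges, without changing the drawing. -/
def reverse (M : OMap) : OMap where
  D := M.D
  σ := M.σ
  α := M.α
  out := fun d => !(M.out d)

end OMap

/-! ## Product-coproduct prographs -/

/-- Raw data of a prograph: an oriented map with a marked half-edge, the global input, and a
marked half-edge, the global output. -/
structure PrographData extends OMap where
  inLeg : D
  outLeg : D

/-- Connect the global output to the global input by an edge through the exterior. -/
def PrographData.close (M : PrographData) : OMap where
  D := M.D
  σ := M.σ
  α := M.α * swap M.inLeg M.outLeg
  out := M.out

/-- PC prographs of size `n`, that is, with `n` products and `n` coproducts: connected oriented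
graphs without directed cycles, all of whose vertices are products or coproducts, with a unique
unconnected input, belonging to a coproduct, and a unique unconnected output, belonging to a
product, drawn in the plane with the unconnected input and output in the exterior (so that
the graph stays planar when they are joined through the exterior). -/
structure PrographData.IsPCPrograph (n : ℕ) (M : PrographData) : Prop where
  wellFormed : M.WellFormed
  operators : ∀ d, ∃ e, M.σ.SameCycle d e ∧ (M.IsCoproduct e ∨ M.IsProduct e)
  inLeg_iff : ∀ d, (M.α d = d ∧ M.out d = false) ↔ d = M.inLeg
  outLeg_iff : ∀ d, (M.α d = d ∧ M.out d = true) ↔ d = M.outLeg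
  inLeg_coproduct : M.IsCoproduct M.inLeg
  outLeg_product : M.IsProduct M.outLeg
  connected : M.Connected
  acyclic : M.Acyclic
  planar : M.close.Spherical
  size : M.numVertices = 2 * n

/-- Isomorphism of prographs: a bijection between the half-edges that respects all the data,
i.e. equality up to a deformation of the plane. -/
def PrographData.Iso (M N : PrographData) : Prop :=
  ∃ f : M.D ≃ N.D, (∀ d, f (M.σ d) = N.σ (f d)) ∧ (∀ d, f (M.α d) = N.α (f d)) ∧
    (∀ d, N.out (f d) = M.out d) ∧ f M.inLeg = N.inLeg ∧ f M.outLeg = N.outLeg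

instance PrographData.isoSetoid : Setoid PrographData where
  r := PrographData.Iso
  iseqv :=
    { refl := fun M => ⟨Equiv.refl _, by simp⟩
      symm := by
        rintro M N ⟨f, h1, h2, h3, h4, h5⟩
        refine ⟨f.symm, fun d => ?_, fun d => ?_, fun d => ?_, ?_, ?_⟩
        · rw [symm_apply_eq, h1, apply_symm_apply]
        · rw [symm_apply_eq, h2, apply_symm_apply]
        · rw [← h3, apply_symm_apply]
        · rw [symm_apply_eq, h4]
        · rw [symm_apply_eq, h5]
      trans := by
        rintro M N K ⟨f, h1, h2, h3, h4, h5⟩ ⟨g, k1, k2, k3, k4, k5⟩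
        exact ⟨f.trans g, by simp [h1, k1], by simp [h2, k2], by simp [h3, k3],
          by simp [h4, k4], by simp [h5, k5]⟩ }

/-- Prographs up to isomorphism. -/
def PrographClass : Type 1 := Quotient PrographData.isoSetoid

/-- The set of PC prographs of size `n`, up to isomorphism. -/
def pcPrographs (n : ℕ) : Set PrographClass := {c | ∃ M, M.IsPCPrograph n ∧ c = Quotient.mk _ M}

/-! ## Rooted bipolar-oriented triangulations of the sphere -/

/-- Raw data of an oriented map with a root half-edge. -/
structure RootedData extends OMap where
  root : D

/-- Rooted bipolar-oriented triangulations of the sphere with `2n` triangles: connected maps on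
the sphere (multiple edges are allowed) all of whose faces have degree three, with an orientation
of the edges without directed cycles that has a unique source and a unique sink (the two poles),
and with a distinguished (root) edge from the source to the sink. -/
structure RootedData.IsBipolarTriangulation (n : ℕ) (M : RootedData) : Prop where
  wellFormed : M.WellFormed
  no_dangling : ∀ d, M.α d ≠ d
  connected : M.Connected
  spherical : M.Spherical
  triangles : ∀ d, M.φ d ≠ d ∧ M.φ (M.φ (M.φ d)) = d
  acyclic : M.Acyclic
  source : ∀ d, M.IsSource d ↔ M.σ.SameCycle M.root d
  sink : ∀ d, M.IsSink d ↔ M.σ.SameCycle (M.α M.root) d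
  size : M.numFaces = 2 * n

/-- Isomorphism of rooted oriented maps: a bijection between the half-edges that respects all the
data, i.e. equality up to a deformation of the sphere. -/
def RootedData.Iso (M N : RootedData) : Prop :=
  ∃ f : M.D ≃ N.D, (∀ d, f (M.σ d) = N.σ (f d)) ∧ (∀ d, f (M.α d) = N.α (f d)) ∧
    (∀ d, N.out (f d) = M.out d) ∧ f M.root = N.root

instance RootedData.isoSetoid : Setoid RootedData where
  r := RootedData.Iso
  iseqv :=
    { refl := fun M => ⟨Equiv.refl _, by simp⟩
      symm := by
        rintro M N ⟨f, h1, h2, h3, h4⟩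
        refine ⟨f.symm, fun d => ?_, fun d => ?_, fun d => ?_, ?_⟩
        · rw [symm_apply_eq, h1, apply_symm_apply]
        · rw [symm_apply_eq, h2, apply_symm_apply]
        · rw [← h3, apply_symm_apply]
        · rw [symm_apply_eq, h4]
      trans := by
        rintro M N K ⟨f, h1, h2, h3, h4⟩ ⟨g, k1, k2, k3, k4⟩
        exact ⟨f.trans g, by simp [h1, k1], by simp [h2, k2], by simp [h3, k3],
          by simp [h4, k4]⟩ }

/-- Rooted oriented maps up to isomorphism. -/
def RootedClass : Type 1 := Quotient RootedData.isoSetoid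

/-- The set of rooted bipolar-oriented triangulations of the sphere with `2n` triangles, up to
isomorphism. -/
def bipolarTriangulations (n : ℕ) : Set RootedClass :=
  {c | ∃ M, M.IsBipolarTriangulation n ∧ c = Quotient.mk _ M}

/-- The 180 degree rotation of the sphere that swaps the poles, together with the reversal of the
direction of all edges. The rotation does not change the cyclic orders around vertices; the root
edge, which joins the poles, is now read from the other end. -/
def RootedData.rotate (M : RootedData) : RootedData where
  toOMap := M.toOMap.reverse
  root := M.α M.root

/-- `RootedData.rotate` on isomorphism classes. -/
def RootedClass.rotate : RootedClass → RootedClass :=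
  Quotient.map RootedData.rotate (by
    rintro M N ⟨f, h1, h2, h3, h4⟩
    refine ⟨f, h1, h2, fun d => ?_, ?_⟩
    · exact congrArg (fun b => !b) (h3 d)
    · exact (h2 _).trans (congrArg N.α h4))

/-! ## Graph duality -/

/-- Graph duality: draw the prograph on the sphere, connect its global output to its global input
through the exterior, and take the dual map. The root edge is the one dual to the new edge. -/
def PrographData.dual (M : PrographData) : RootedData where
  toOMap := M.close.dual
  root := M.outLeg

/-- Graph duality on isomorphism classes. -/
def PrographClass.dual : PrographClass → RootedClass :=
  Quotient.map PrographData.dual (by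
    rintro M N ⟨f, h1, h2, h3, h4, h5⟩
    have hα : ∀ d : M.D, f (M.α (swap M.inLeg M.outLeg d)) =
        N.α (swap N.inLeg N.outLeg (f d)) := fun d => by
      rw [h2, ← h4, ← h5, Function.Injective.swap_apply f.injective]
    have hσ : ∀ d : M.D, f (M.σ⁻¹ d) = N.σ⁻¹ (f d) := fun d => by
      rw [Perm.eq_inv_iff_eq, ← h1]; exact congrArg f (M.σ.apply_symm_apply d)
    exact ⟨f, fun d => (hσ _).trans (congrArg (fun x => N.σ⁻¹ x) (hα d)), hα, h3, h5⟩)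

/-! ## From tableaux to prographs -/

/-- The half-edges of `n` coproducts `Sum.inl k` and `n` products `Sum.inr k`, numbered
counterclockwise around each operator. -/
abbrev Half (n : ℕ) : Type := (Fin n ⊕ Fin n) × Fin 3

section Halves

variable {n : ℕ}

def copIn (k : Fin n) : Half n := (Sum.inl k, 0)

def copRight (k : Fin n) : Half n := (Sum.inl k, 1)

def copLeft (k : Fin n) : Half n := (Sum.inl k, 2)

def prodOut (k : Fin n) : Half n := (Sum.inr k, 0)

def prodLeft (k : Fin n) : Half n := (Sum.inr k, 1)

def prodRight (k : Fin n) : Half n := (Sum.inr k, 2)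

end Halves

/-- State of the assembling of a prograph from bottom to top: the wires that have not been read
yet, from left to right; the wires that wait to become the left input of a product (the rightmost
one first); and the matching of half-edges made so far. A wire is given by the half-edge it comes
from. -/
structure Assembly (n : ℕ) where
  pending : List (Half n)
  waiting : List (Half n)
  glue : Perm (Half n)

/-- Read the next entry of the tableau. It labels the leftmost pending wire.
If it lies in the first row, the wire becomes the input of a new coproduct.
If it lies in the second row, the wire becomes the left input of a product to be determined later.
If it lies in the third row, the wire becomes the right input of a new product, the left input of
which is the closest waiting wire. The index of an operator is the column of the entry read. -/
def Assembly.step {n : ℕ} (T : Tableau n) (s : Assembly n) (i : Fin (3 * n)) : Assembly n :=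
  match T.entry.symm i, s.pending, s.waiting with
  | (0, k), o :: P, W => ⟨copLeft k :: copRight k :: P, W, s.glue * swap o (copIn k)⟩
  | (1, _), o :: P, W => ⟨P, o :: W, s.glue⟩
  | (2, k), o :: P, w :: W =>
      ⟨prodOut k :: P, W, s.glue * swap w (prodLeft k) * swap o (prodRight k)⟩
  | _, _, _ => s

/-- The prograph of a tableau: start with a single wire, the global input (formally the input of
the first coproduct, so that this half-edge stays unconnected), and read the entries of the tableau
in increasing order. -/
def Tableau.prograph {n : ℕ} [NeZero n] (T : Tableau n) : PrographData where
  D := Half n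
  σ := (Equiv.refl _).prodCongr (Equiv.addRight 1)
  α := ((List.finRange (3 * n)).foldl (Assembly.step T) ⟨[copIn 0], [], 1⟩).glue
  out := fun d => match d with
    | (Sum.inl _, s) => s != 0
    | (Sum.inr _, s) => s == 0
  inLeg := copIn 0
  outLeg := prodOut (Fin.rev 0)

/-- The class of the prograph of a tableau. -/
def Tableau.toPrograph {n : ℕ} [NeZero n] (T : Tableau n) : PrographClass :=
  Quotient.mk _ T.prograph

/-- The class of the dual of the prograph of a tableau. -/
def Tableau.toTriangulation {n : ℕ} [NeZero n] (T : Tableau n) : RootedClass :=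
  T.toPrograph.dual

end PC

namespace PC

open Equiv

/-! ## Cycles of permutations -/

section Perm

variable {D : Type*} [Finite D]

/-! Joining the output of a prograph to its input gives a cubic map rooted at that output. Its dual
lives on the same half-edges, with `σ` replaced by `φ = σ⁻¹α`. Everything rests on the notion of a
reading (`RootedData.IsReading`): a sweep by horizontal cuts, each made of a current wire, the wires
put aside on its left and the pending wires on its right, in which every wire is current exactly
once. A step carries the letter 0, 1 or 2 according to whether the current wire ends at a coproduct,
at the left input or at the right input of a product.

A reading amounts to its word. Steps are deterministic, so the map determines the word
(`IsReading.word_eq_of_iso`); matching wires of equal time shows that the word determines the map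
(`IsReading.iso`). The lengths of the two lists make the word a ballot word with `n` letters of each
kind, that is, a tableau (`IsReading.exists_tableau`), and the assembling of a tableau is a reading
whose word lists the rows of the entries (`Tableau.isReading`). It remains to relate readings to PC
prographs and triangulations.

A reading exists by counting. A face away from the root edge has boundary edges of both directions,
hence a lowest corner at a coproduct and a highest corner at a product. By Euler's formula there are
`n` such faces, and there are `2n` operators, so each such face has exactly one corner of each kind
and the two faces at the root edge have none (`IsCubic.faceCorners`). Consequently the sweep never
gets stuck; it can be traced backwards, so it returns to its start, and connectedness makes it meet
every wire (`IsCubic.exists_reading`).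

Conversely, a reading gives a height on operators that increases along wires, whence acyclicity and
connectedness, and a label on faces that increases from left to right across wires. The labels force
the number of faces to be `n + 2`, which is planarity, and they make the dual acyclic. A
triangulation has a cubic predual because a triangle is not a directed cycle, and its faces have
both directions because only the poles are sources or sinks; the same counting then yields a
reading.

Rotating a map reverses its reading and exchanges the letters 0 and 2 (`IsReading.rotate`), which is
what the Schützenberger involution does to the word. -/

theorem card_eq_mul_card_cycles (f : Perm D) (m : ℕ) (hm : f ^ m = 1) (hm0 : 0 < m)
    (hfree : ∀ k, 0 < k → k < m → ∀ d, (f ^ k) d ≠ d) :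
    Nat.card D = m * Nat.card (Quotient (Perm.SameCycle.setoid f)) := by
  -- A representative of each cycle and an exponent below `m` parametrise `D`: freeness separates
  -- the powers, and `f ^ m = 1` makes them exhaust the cycle.
  have hb : Function.Bijective
      (fun p : Fin m × Quotient (Perm.SameCycle.setoid f) => (f ^ (p.1 : ℕ)) p.2.out) := by
    constructor
    · have key : ∀ (k l : Fin m) (q : Quotient (Perm.SameCycle.setoid f)), k ≤ l →
          (f ^ (k : ℕ)) q.out = (f ^ (l : ℕ)) q.out → k = l := by
        intro k l q hkl h
        by_contra hne
        have hlt : (k : ℕ) < l := lt_of_le_of_ne hkl fun h => hne (Fin.ext h)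
        refine hfree (l - k) (by omega) (by omega) q.out ?_
        have : (f ^ (l : ℕ)) = f ^ (k : ℕ) * f ^ ((l : ℕ) - k) := by
          rw [← pow_add]; congr 1; omega
        rw [this, Perm.mul_apply] at h
        exact ((f ^ (k : ℕ)).injective h).symm
      rintro ⟨k, q⟩ ⟨l, q'⟩ h
      have hq : q = q' := by
        rw [← Quotient.out_eq q, ← Quotient.out_eq q']
        apply Quotient.sound
        change f.SameCycle _ _
        have h1 : f.SameCycle q.out ((f ^ (k : ℕ)) q.out) := ⟨k, by simp⟩
        have h2 : f.SameCycle q'.out ((f ^ (l : ℕ)) q'.out) := ⟨l, by simp⟩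
        exact h1.trans ((show (f ^ (k : ℕ)) q.out = (f ^ (l : ℕ)) q'.out from h) ▸ h2.symm)
      subst hq
      rcases le_total k l with hkl | hkl
      · rw [key k l q hkl h]
      · rw [key l k q hkl h.symm]
    · intro d
      have h : f.SameCycle (Quotient.mk (Perm.SameCycle.setoid f) d).out d :=
        Quotient.mk_out (s := Perm.SameCycle.setoid f) d
      obtain ⟨i, hi⟩ := h.exists_nat_pow_eq
      refine ⟨(⟨i % m, Nat.mod_lt _ hm0⟩, Quotient.mk _ d), ?_⟩
      change (f ^ (i % m)) _ = d
      rw [← pow_eq_pow_mod i hm, hi]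
  rw [← Nat.card_congr (Equiv.ofBijective _ hb), Nat.card_prod, Nat.card_eq_fintype_card,
    Fintype.card_fin]

theorem card_eq_two_mul (f : Perm D) (h2 : ∀ d, f (f d) = d) (h1 : ∀ d, f d ≠ d) :
    Nat.card D = 2 * Nat.card (Quotient (Perm.SameCycle.setoid f)) := by
  refine card_eq_mul_card_cycles f 2 (Perm.ext fun d => by simp [pow_two, h2]) two_pos ?_
  intro k hk hk' d
  obtain rfl : k = 1 := by omega
  simpa using h1 d

theorem card_eq_three_mul (f : Perm D) (h3 : ∀ d, f (f (f d)) = d) (h1 : ∀ d, f d ≠ d) :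
    Nat.card D = 3 * Nat.card (Quotient (Perm.SameCycle.setoid f)) := by
  refine card_eq_mul_card_cycles f 3 (Perm.ext fun d => by simp [pow_succ, h3]) three_pos ?_
  intro k hk hk' d
  obtain rfl | rfl : k = 1 ∨ k = 2 := by omega
  · simpa using h1 d
  · intro h
    have h' : f (f d) = d := by simpa [pow_two] using h
    have := h3 d
    rw [h'] at this
    exact h1 d this

theorem exists_sameCycle_transition (f : Perm D) (b : D → Bool) {x y : D}
    (h : f.SameCycle x y) (hx : b x = true) (hy : b y = false) :
    ∃ z, f.SameCycle x z ∧ b z = true ∧ b (f z) = false := by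
  obtain ⟨i, rfl⟩ := h.exists_nat_pow_eq
  clear h
  induction i with
  | zero => simp [hx] at hy
  | succ i ih =>
    by_cases hb : b ((f ^ i) x) = false
    · exact ih hb
    · refine ⟨(f ^ i) x, ⟨i, by simp⟩, by simpa using hb, ?_⟩
      rwa [pow_succ', Perm.mul_apply] at hy

/-- The second change of colour occurs on the way back from `y` to `x` along the cycle. -/
theorem exists_sameCycle_both_transitions (f : Perm D) (b : D → Bool) {x y : D}
    (h : f.SameCycle x y) (hx : b x = true) (hy : b y = false) :
    (∃ z, f.SameCycle x z ∧ b z = true ∧ b (f z) = false) ∧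
      ∃ z, f.SameCycle x z ∧ b z = false ∧ b (f z) = true := by
  refine ⟨exists_sameCycle_transition f b h hx hy, ?_⟩
  obtain ⟨z, hz, h1, h2⟩ := exists_sameCycle_transition f (fun d => !b d) h.symm
    (by simp [hy]) (by simp [hx])
  exact ⟨z, h.trans hz, by simpa using h1, by simpa using h2⟩

theorem sameCycle_three {f : Perm D} (h3 : ∀ d, f (f (f d)) = d) {x y : D}
    (h : f.SameCycle x y) : y = x ∨ y = f x ∨ y = f (f x) := by
  obtain ⟨i, rfl⟩ := h.exists_nat_pow_eq
  have hf : f ^ 3 = 1 := Perm.ext fun d => by simp [pow_succ, h3]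
  rw [pow_eq_pow_mod i hf]
  have : i % 3 < 3 := Nat.mod_lt _ three_pos
  interval_cases i % 3
  · simp
  · simp
  · simp [pow_two]

end Perm

theorem sameCycle_apply {D : Type*} (f : Perm D) (x : D) : f.SameCycle x (f x) := ⟨1, by simp⟩

/-! ## Cubic maps -/

namespace RootedData

/-- A prograph whose output is connected to its input; the root is the output. -/
structure IsCubic (K : RootedData) : Prop where
  α_α : ∀ d, K.α (K.α d) = d
  out_α : ∀ d, K.out (K.α d) = !(K.out d)
  operators : ∀ d, ∃ e, K.σ.SameCycle d e ∧ (K.IsCoproduct e ∨ K.IsProduct e)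
  root_product : K.IsProduct K.root
  root_coproduct : K.IsCoproduct (K.α K.root)

namespace IsCubic

variable {K : RootedData} (hK : K.IsCubic)
include hK

theorem α_ne (d : K.D) : K.α d ≠ d := fun h => by
  have := hK.out_α d
  rw [h] at this
  cases hd : K.out d <;> simp [hd] at this

theorem α_eq_iff {x y : K.D} : K.α x = y ↔ x = K.α y :=
  ⟨fun h => by rw [← h, hK.α_α], fun h => by rw [h, hK.α_α]⟩

theorem σ_σ_σ (d : K.D) : K.σ (K.σ (K.σ d)) = d := by
  obtain ⟨e, ⟨z, hz⟩, he⟩ := hK.operators d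
  have h3 : (K.σ ^ (3 : ℤ)) e = e := by
    rcases he with h | h
    · exact h.1
    · exact h.1
  rw [← hz, ← Perm.mul_apply, ← zpow_add, add_comm, zpow_add, Perm.mul_apply] at h3
  exact (K.σ ^ z).injective h3

theorem σ_inv (d : K.D) : K.σ⁻¹ d = K.σ (K.σ d) := by
  rw [Perm.inv_eq_iff_eq, hK.σ_σ_σ]

theorem φ_apply (d : K.D) : K.φ d = K.σ (K.σ (K.α d)) := by
  rw [← hK.σ_inv]; rfl

/-- These two half-edges follow each other around a corner. Applied at the three corners of an
operator, this tracks the faces on both sides of a cut when the cut moves past the operator. -/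
theorem face_α (d : K.D) : K.φ.SameCycle (K.α d) (K.σ (K.σ d)) := by
  have := sameCycle_apply K.φ (K.α d)
  rwa [hK.φ_apply, hK.α_α] at this

theorem cases (d : K.D) : (∃ c, K.IsCoproduct c ∧ (d = c ∨ d = K.σ c ∨ d = K.σ (K.σ c))) ∨
    ∃ p, K.IsProduct p ∧ (d = p ∨ d = K.σ p ∨ d = K.σ (K.σ p)) := by
  obtain ⟨e, h, he | he⟩ := hK.operators d
  · exact .inl ⟨e, he, sameCycle_three hK.σ_σ_σ h.symm⟩
  · exact .inr ⟨e, he, sameCycle_three hK.σ_σ_σ h.symm⟩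

theorem cases_in {d : K.D} (hd : K.out d = false) :
    K.IsCoproduct d ∨ ∃ p, K.IsProduct p ∧ (d = K.σ p ∨ d = K.σ (K.σ p)) := by
  rcases hK.cases d with ⟨c, ⟨h1, h2, h3, h4, h5⟩, rfl | rfl | rfl⟩ | ⟨p, hp, rfl | h⟩
  · exact .inl ⟨h1, h2, h3, h4, h5⟩
  · simp [h3] at hd
  · simp [h4] at hd
  · simp [hp.2.1] at hd
  · exact .inr ⟨p, hp, h⟩

theorem cases_out {d : K.D} (hd : K.out d = true) :
    K.IsProduct d ∨ ∃ c, K.IsCoproduct c ∧ (d = K.σ c ∨ d = K.σ (K.σ c)) := by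
  rcases hK.cases d with ⟨c, hc, rfl | h⟩ | ⟨p, ⟨h1, h2, h3, h4, h5⟩, rfl | rfl | rfl⟩
  · simp [hc.2.1] at hd
  · exact .inr ⟨c, hc, h⟩
  · exact .inl ⟨h1, h2, h3, h4, h5⟩
  · simp [h3] at hd
  · simp [h4] at hd

theorem σ_ne (d : K.D) : K.σ d ≠ d := by
  intro h
  obtain ⟨e, hde, he⟩ := hK.operators d
  have h' : K.σ e = e := (hde.apply_eq_self_iff).1 h
  rcases he with he | he <;> exact he.2.2.2.2 (by rw [h', h'])

theorem card_eq (n : ℕ) (hn : K.numVertices = 2 * n) : Nat.card K.D = 6 * n := by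
  rw [card_eq_three_mul K.σ hK.σ_σ_σ hK.σ_ne]
  change 3 * K.numVertices = _
  omega

theorem numVertices_eq (n : ℕ) (hn : Nat.card K.D = 6 * n) : K.numVertices = 2 * n := by
  rw [card_eq_three_mul K.σ hK.σ_σ_σ hK.σ_ne] at hn
  change 3 * K.numVertices = _ at hn
  omega

theorem numEdges_eq (n : ℕ) (hn : Nat.card K.D = 6 * n) : K.numEdges = 3 * n := by
  rw [card_eq_two_mul K.α hK.α_α hK.α_ne] at hn
  change 2 * K.numEdges = _ at hn
  omega

end IsCubic

end RootedData

namespace OMap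

variable {K : OMap}

/-- The directions around an operator tell its half-edges apart. This lemma and the following ones
discard the mixed cases whenever two steps are compared. -/
theorem IsCoproduct.ne_σ {c p : K.D} (hc : K.IsCoproduct c) (hp : K.IsProduct p) :
    c ≠ K.σ p := by
  rintro rfl
  have := hc.2.2.1
  rw [hp.2.2.2.1] at this
  cases this

theorem IsCoproduct.ne_σ_σ {c p : K.D} (hc : K.IsCoproduct c) (hp : K.IsProduct p) :
    c ≠ K.σ (K.σ p) := by
  rintro rfl
  have := hc.2.2.2.1
  rw [hp.1, hp.2.2.1] at this
  cases this

theorem IsProduct.ne_σ {c p : K.D} (hc : K.IsCoproduct c) (hp : K.IsProduct p) :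
    p ≠ K.σ c := by
  rintro rfl
  have := hp.2.2.1
  rw [hc.2.2.2.1] at this
  cases this

theorem IsProduct.ne_σ_σ {c p : K.D} (hc : K.IsCoproduct c) (hp : K.IsProduct p) :
    p ≠ K.σ (K.σ c) := by
  rintro rfl
  have := hp.2.2.2.1
  rw [hc.1, hc.2.2.1] at this
  cases this

theorem IsCoproduct.σ_ne_σ_σ {c c' : K.D} (hc : K.IsCoproduct c) (hc' : K.IsCoproduct c') :
    K.σ c ≠ K.σ (K.σ c') := by
  intro h
  have := hc.2.1
  rw [K.σ.injective h, hc'.2.2.1] at this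
  cases this

theorem IsProduct.σ_ne_σ_σ {p p' : K.D} (hp : K.IsProduct p) (hp' : K.IsProduct p') :
    K.σ p ≠ K.σ (K.σ p') := by
  intro h
  have := hp.2.1
  rw [K.σ.injective h, hp'.2.2.1] at this
  cases this

end OMap

namespace RootedData

/-! ## Scanning a cubic map -/

/-- A horizontal cut through a prograph: the wires crossed, each given by its lower half-edge. The
lists to the left and to the right start with the wire next to the current one. -/
structure Scan (K : RootedData) where
  cur : K.D
  left : List K.D
  right : List K.D

/-- The cut moves upwards at the current wire, the upper end of which has the type `r`. -/
def Step (K : RootedData) (r : Fin 3) (s t : Scan K) : Prop :=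
  (r = 0 ∧ K.IsCoproduct (K.α s.cur) ∧ t.cur = K.σ (K.σ (K.α s.cur)) ∧ t.left = s.left ∧
    t.right = K.σ (K.α s.cur) :: s.right) ∨
  (r = 1 ∧ (∃ p, K.IsProduct p ∧ K.α s.cur = K.σ p) ∧ t.left = s.cur :: s.left ∧
    s.right = t.cur :: t.right) ∨
  (r = 2 ∧ K.IsProduct t.cur ∧ K.α s.cur = K.σ (K.σ t.cur) ∧
    (∃ x, K.α x = K.σ t.cur ∧ s.left = x :: t.left) ∧ t.right = s.right)

/-- The cuts `s 0, …, s N` sweep the map from the input to the output, every wire being current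
once. -/
structure IsReading (K : RootedData) (N : ℕ) (w : ℕ → Fin 3) (s : ℕ → Scan K) : Prop where
  start : s 0 = ⟨K.root, [], []⟩
  finish : s N = ⟨K.root, [], []⟩
  step : ∀ i < N, K.Step (w i) (s i) (s (i + 1))
  surj : ∀ d, K.out d = true → ∃ i < N, (s i).cur = d
  inj : ∀ i < N, ∀ j < N, (s i).cur = (s j).cur → i = j

section Sweep

variable {K : RootedData} {N : ℕ} {w : ℕ → Fin 3} {s : ℕ → Scan K}
  (step : ∀ i < N, K.Step (w i) (s i) (s (i + 1)))
include step

/-- A wire enters the right list only when a coproduct is read, as its right output, while the left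
output becomes current. -/
theorem mem_right_past (h0 : (s 0).right = []) {i : ℕ} (hi : i ≤ N) {r : K.D}
    (hr : r ∈ (s i).right) : ∃ j < i, K.IsCoproduct (K.α (s j).cur) ∧ r = K.σ (K.α (s j).cur) ∧
      (s (j + 1)).cur = K.σ r := by
  induction i with
  | zero => simp [h0] at hr
  | succ i ih =>
    have lift : r ∈ (s i).right → ∃ j < i + 1, K.IsCoproduct (K.α (s j).cur) ∧
        r = K.σ (K.α (s j).cur) ∧ (s (j + 1)).cur = K.σ r := fun h => by
      obtain ⟨j, hj, h⟩ := ih (by omega) h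
      exact ⟨j, by omega, h⟩
    rcases step i hi with ⟨-, hc, h1, -, h2⟩ | ⟨-, -, -, h2⟩ | ⟨-, -, -, -, h2⟩
    · rw [h2, List.mem_cons] at hr
      rcases hr with rfl | hr
      · exact ⟨i, by omega, hc, rfl, h1⟩
      · exact lift hr
    · exact lift (by rw [h2]; exact List.mem_cons_of_mem _ hr)
    · exact lift (h2 ▸ hr)

theorem mem_left_past (h0 : (s 0).left = []) {i : ℕ} (hi : i ≤ N) {x : K.D}
    (hx : x ∈ (s i).left) : ∃ j < i, x = (s j).cur ∧ (s j).right = (s (j + 1)).cur ::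
      (s (j + 1)).right ∧ ∃ p, K.IsProduct p ∧ K.α x = K.σ p := by
  induction i with
  | zero => simp [h0] at hx
  | succ i ih =>
    have lift : x ∈ (s i).left → ∃ j < i + 1, x = (s j).cur ∧ (s j).right = (s (j + 1)).cur ::
        (s (j + 1)).right ∧ ∃ p, K.IsProduct p ∧ K.α x = K.σ p := fun h => by
      obtain ⟨j, hj, h⟩ := ih (by omega) h
      exact ⟨j, by omega, h⟩
    rcases step i hi with ⟨-, -, -, h2, -⟩ | ⟨-, hp, h2, h3⟩ | ⟨-, -, -, ⟨y, -, h2⟩, -⟩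
    · exact lift (h2 ▸ hx)
    · rw [h2, List.mem_cons] at hx
      rcases hx with rfl | hx
      · exact ⟨i, by omega, rfl, h3, hp⟩
      · exact lift hx
    · exact lift (by rw [h2]; exact List.mem_cons_of_mem _ hx)

/-- Backward induction from the last cut: a pending wire leaves the right list only by becoming
current, just after its left neighbour has been put aside. -/
theorem mem_right_future (hN : (s N).right = []) {i : ℕ} (hi : i ≤ N) {r : K.D}
    (hr : r ∈ (s i).right) : ∃ j, i ≤ j ∧ j < N ∧ (s (j + 1)).cur = r ∧
      (s (j + 1)).left = (s j).cur :: (s j).left := by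
  induction hi using Nat.decreasingInduction with
  | self => simp [hN] at hr
  | of_succ i hi ih =>
    have lift : r ∈ (s (i + 1)).right → ∃ j, i ≤ j ∧ j < N ∧ (s (j + 1)).cur = r ∧
        (s (j + 1)).left = (s j).cur :: (s j).left := fun h => by
      obtain ⟨j, hj, h⟩ := ih h
      exact ⟨j, by omega, h⟩
    rcases step i hi with ⟨-, -, -, -, h2⟩ | ⟨-, -, h1, h2⟩ | ⟨-, -, -, -, h2⟩
    · exact lift (by rw [h2]; exact List.mem_cons_of_mem _ hr)
    · rw [h2, List.mem_cons] at hr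
      rcases hr with rfl | hr
      · exact ⟨i, le_rfl, hi, rfl, h1⟩
      · exact lift hr
    · exact lift (h2 ▸ hr)

/-- The left list is empty at the end, and a wire leaves it only as the left input of a product
entered by the current wire. -/
theorem mem_left_future (hN : (s N).left = []) {i : ℕ} (hi : i ≤ N) {x : K.D}
    (hx : x ∈ (s i).left) : ∃ j, i ≤ j ∧ j < N ∧ K.IsProduct (s (j + 1)).cur ∧
      K.α x = K.σ (s (j + 1)).cur ∧ K.α (s j).cur = K.σ (K.σ (s (j + 1)).cur) := by
  induction hi using Nat.decreasingInduction with
  | self => simp [hN] at hx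
  | of_succ i hi ih =>
    have lift : x ∈ (s (i + 1)).left → ∃ j, i ≤ j ∧ j < N ∧ K.IsProduct (s (j + 1)).cur ∧
        K.α x = K.σ (s (j + 1)).cur ∧ K.α (s j).cur = K.σ (K.σ (s (j + 1)).cur) := fun h => by
      obtain ⟨j, hj, h⟩ := ih h
      exact ⟨j, by omega, h⟩
    rcases step i hi with ⟨-, -, -, h2, -⟩ | ⟨-, -, h2, -⟩ | ⟨-, hp, h3, ⟨y, hy, h2⟩, -⟩
    · exact lift (h2 ▸ hx)
    · exact lift (by rw [h2]; exact List.mem_cons_of_mem _ hx)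
    · rw [h2, List.mem_cons] at hx
      rcases hx with rfl | hx
      · exact ⟨i, le_rfl, hi, hp, hy, h3⟩
      · exact lift hx

/-- Wires to the right are met again with the same wires to the right of them. -/
theorem right_of_suffix (hN : (s N).right = []) {i : ℕ} (hi : i ≤ N) {r : K.D} {Q : List K.D}
    (hr : r :: Q <:+ (s i).right) : ∃ j, i < j ∧ j ≤ N ∧ (s j).cur = r ∧ (s j).right = Q := by
  induction hi using Nat.decreasingInduction with
  | self => simp [hN] at hr
  | of_succ i hi ih =>
    have lift : r :: Q <:+ (s (i + 1)).right → ∃ j, i < j ∧ j ≤ N ∧ (s j).cur = r ∧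
        (s j).right = Q := fun h => by
      obtain ⟨j, hj, h⟩ := ih h
      exact ⟨j, by omega, h⟩
    rcases step i hi with ⟨-, -, -, -, h2⟩ | ⟨-, -, h1, h2⟩ | ⟨-, -, -, -, h2⟩
    · exact lift (by rw [h2]; exact hr.trans (List.suffix_cons _ _))
    · rw [h2, List.suffix_cons_iff] at hr
      rcases hr with hr | hr
      · rw [List.cons.injEq] at hr
        exact ⟨i + 1, by omega, hi, hr.1.symm, hr.2.symm⟩
      · exact lift hr
    · exact lift (h2 ▸ hr)

/-- Wires to the left have been met with the same wires to the left of them. -/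
theorem left_of_suffix (h0 : (s 0).left = []) {i : ℕ} (hi : i ≤ N) {x : K.D} {Q : List K.D}
    (hx : x :: Q <:+ (s i).left) : ∃ j < i, (s j).cur = x ∧ (s j).left = Q := by
  induction i with
  | zero => simp [h0] at hx
  | succ i ih =>
    have lift : x :: Q <:+ (s i).left → ∃ j < i + 1, (s j).cur = x ∧ (s j).left = Q := fun h => by
      obtain ⟨j, hj, h⟩ := ih (by omega) h
      exact ⟨j, by omega, h⟩
    rcases step i hi with ⟨-, -, -, h2, -⟩ | ⟨-, -, h2, -⟩ | ⟨-, -, -, ⟨y, -, h2⟩, -⟩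
    · exact lift (h2 ▸ hx)
    · rw [h2, List.suffix_cons_iff] at hx
      rcases hx with hx | hx
      · rw [List.cons.injEq] at hx
        exact ⟨i, by omega, hx.1.symm, hx.2.symm⟩
      · exact lift hx
    · exact lift (by rw [h2]; exact hx.trans (List.suffix_cons _ _))

end Sweep

namespace IsReading

variable {K : RootedData} {N : ℕ} {w : ℕ → Fin 3} {s : ℕ → Scan K}

theorem cur_zero (h : K.IsReading N w s) : (s 0).cur = K.root := by rw [h.start]
theorem left_zero (h : K.IsReading N w s) : (s 0).left = [] := by rw [h.start]
theorem right_zero (h : K.IsReading N w s) : (s 0).right = [] := by rw [h.start]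
theorem cur_last (h : K.IsReading N w s) : (s N).cur = K.root := by rw [h.finish]
theorem left_last (h : K.IsReading N w s) : (s N).left = [] := by rw [h.finish]
theorem right_last (h : K.IsReading N w s) : (s N).right = [] := by rw [h.finish]

theorem pos (h : K.IsReading N w s) (hK : K.IsCubic) : 0 < N := by
  obtain ⟨i, hi, -⟩ := h.surj K.root hK.root_product.2.1
  omega

theorem out_cur (h : K.IsReading N w s) (hK : K.IsCubic) {i : ℕ} (hi : i ≤ N) :
    K.out (s i).cur = true := by
  rcases i with _ | i
  · rw [h.cur_zero]; exact hK.root_product.2.1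
  rcases h.step i hi with ⟨-, hc, h2, -⟩ | ⟨-, -, -, h2⟩ | ⟨-, h2, -⟩
  · rw [h2]; exact hc.2.2.2.1
  · obtain ⟨j, -, hc, h3, -⟩ := mem_right_past h.step h.right_zero (le_of_lt hi)
      (r := (s (i + 1)).cur) (by rw [h2]; simp)
    rw [h3]; exact hc.2.2.1
  · exact h2.2.1

theorem out_α_cur (h : K.IsReading N w s) (hK : K.IsCubic) {i : ℕ} (hi : i ≤ N) :
    K.out (K.α (s i).cur) = false := by
  rw [hK.out_α, h.out_cur hK hi]; rfl

theorem exists_cur (h : K.IsReading N w s) (hK : K.IsCubic) (d : K.D) :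
    ∃ i < N, (s i).cur = d ∨ K.α (s i).cur = d := by
  cases hd : K.out d
  · obtain ⟨i, hi, hc⟩ := h.surj (K.α d) (by rw [hK.out_α, hd]; rfl)
    exact ⟨i, hi, .inr (by rw [hc, hK.α_α])⟩
  · obtain ⟨i, hi, hc⟩ := h.surj d hd
    exact ⟨i, hi, .inl hc⟩

/-- Every coproduct is entered. -/
theorem step_coproduct (h : K.IsReading N w s) (hK : K.IsCubic) {c : K.D}
    (hc : K.IsCoproduct c) : ∃ i < N, K.α (s i).cur = c ∧ w i = 0 ∧
      (s (i + 1)).cur = K.σ (K.σ c) ∧ (s (i + 1)).left = (s i).left ∧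
        (s (i + 1)).right = K.σ c :: (s i).right := by
  obtain ⟨i, hi, h1⟩ := h.surj (K.α c) (by rw [hK.out_α, hc.2.1]; rfl)
  have h1 : K.α (s i).cur = c := by rw [h1, hK.α_α]
  refine ⟨i, hi, h1, ?_⟩
  rcases h.step i hi with ⟨h0, -, h2, h3, h4⟩ | ⟨-, ⟨p, hp, h2⟩, -⟩ | ⟨-, hp, h2, -⟩
  · rw [h1] at h2 h4; exact ⟨h0, h2, h3, h4⟩
  · exact absurd (h1.symm.trans h2) (hc.ne_σ hp)
  · exact absurd (h1.symm.trans h2) (hc.ne_σ_σ hp)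

/-- Every product is entered from the right. -/
theorem step_product (h : K.IsReading N w s) (hK : K.IsCubic) {p : K.D}
    (hp : K.IsProduct p) : ∃ i < N, K.α (s i).cur = K.σ (K.σ p) ∧ w i = 2 ∧ (s (i + 1)).cur = p ∧
      (s (i + 1)).right = (s i).right ∧ (s i).left = K.α (K.σ p) :: (s (i + 1)).left := by
  obtain ⟨i, hi, h1⟩ := h.surj (K.α (K.σ (K.σ p))) (by rw [hK.out_α, hp.2.2.2.1]; rfl)
  have h1 : K.α (s i).cur = K.σ (K.σ p) := by rw [h1, hK.α_α]
  refine ⟨i, hi, h1, ?_⟩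
  rcases h.step i hi with ⟨-, hc, -⟩ | ⟨-, ⟨q, hq, h2⟩, -⟩ | ⟨h0, -, h2, ⟨x, h4, h5⟩, h6⟩
  · rw [h1] at hc
    exact absurd rfl (hc.ne_σ_σ hp)
  · exact absurd (h2.symm.trans h1) (hq.σ_ne_σ_σ hp)
  · have : (s (i + 1)).cur = p := K.σ.injective (K.σ.injective (h2.symm.trans h1))
    rw [this] at h4
    rw [← h4, hK.α_α]
    exact ⟨h0, this, h6, h5⟩

/-- The left input of a product is met before. -/
theorem step_product_left (h : K.IsReading N w s) {i : ℕ} (hi : i ≤ N) {x : K.D}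
    {Q : List K.D} (hx : (s i).left = x :: Q) : ∃ j < i, (s j).cur = x ∧ (s j).left = Q ∧
      (s j).right = (s (j + 1)).cur :: (s (j + 1)).right := by
  obtain ⟨j, hj, h1, h2⟩ := left_of_suffix h.step h.left_zero hi (x := x) (Q := Q) (by rw [hx])
  obtain ⟨k, hk, h3, h4, -⟩ := mem_left_past h.step h.left_zero hi (x := x) (by rw [hx]; simp)
  obtain rfl := h.inj j (by omega) k (by omega) (h1.trans h3)
  exact ⟨j, hj, h1, h2, h4⟩

end IsReading
end RootedData

/-! ### Counting the corners of faces -/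

theorem card_le_of_surjective_off_pair {A B : Type*} [Finite A] (f : A → B) (x y : B)
    (h : ∀ b, b ≠ x → b ≠ y → ∃ a, f a = b) : Nat.card B ≤ Nat.card A + 2 ∧
      (Nat.card A + 2 ≤ Nat.card B → f.Injective ∧ ∀ a, f a ≠ x ∧ f a ≠ y) := by
  -- Two extra points sent to `x` and `y` make the map onto; if the cardinalities agree it is then
  -- injective, which also keeps `f` away from `x` and `y`.
  let g : A ⊕ Bool → B := Sum.elim f fun b => if b then x else y
  have hg : g.Surjective := fun b => by
    by_cases hx : b = x
    · exact ⟨.inr true, by simp [g, hx]⟩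
    by_cases hy : b = y
    · exact ⟨.inr false, by simp [g, hy]⟩
    obtain ⟨a, ha⟩ := h b hx hy
    exact ⟨.inl a, ha⟩
  have hc : Nat.card (A ⊕ Bool) = Nat.card A + 2 := by simp [Nat.card_sum]
  refine ⟨hc ▸ Nat.card_le_card_of_surjective g hg, fun hle => ?_⟩
  have hi := (hg.bijective_of_nat_card_le (hc ▸ hle)).1
  refine ⟨fun a b hab => Sum.inl_injective (hi (a₁ := .inl a) (a₂ := .inl b) hab),
    fun a => ⟨fun hx => ?_, fun hy => ?_⟩⟩
  · exact absurd (hi (a₁ := .inl a) (a₂ := .inr true) (by simpa [g] using hx)) (by simp)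
  · exact absurd (hi (a₁ := .inl a) (a₂ := .inr false) (by simpa [g] using hy)) (by simp)

namespace RootedData

/-- Every face away from the root edge has edges of both directions on its boundary. -/
def BothDirections (K : RootedData) : Prop :=
  ∀ d, ¬ K.φ.SameCycle d K.root → ¬ K.φ.SameCycle d (K.α K.root) →
    (∃ e, K.φ.SameCycle d e ∧ K.out e = true) ∧ ∃ e, K.φ.SameCycle d e ∧ K.out e = false

/-- A face has at most one highest corner; the two faces at the root edge have none, and the
face to the right of it has no lowest corner. -/
structure FaceCorners (K : RootedData) : Prop where
  top_unique : ∀ p p', K.IsProduct p → K.IsProduct p' →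
    K.φ.SameCycle (K.σ p) (K.σ p') → p = p'
  bottom_right : ∀ c, K.IsCoproduct c → ¬ K.φ.SameCycle (K.α K.root) (K.σ c)
  top_left : ∀ p, K.IsProduct p → ¬ K.φ.SameCycle K.root (K.σ p)
  top_right : ∀ p, K.IsProduct p → ¬ K.φ.SameCycle (K.α K.root) (K.σ p)

variable {K : RootedData}

/-- Around the face the direction changes both ways. A change from incoming to outgoing happens
between the two outputs of a coproduct, a change from outgoing to incoming between the two inputs of
a product. -/
theorem IsCubic.exists_corners (hK : K.IsCubic) (hb : K.BothDirections) {d : K.D}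
    (h1 : ¬ K.φ.SameCycle d K.root) (h2 : ¬ K.φ.SameCycle d (K.α K.root)) :
    (∃ c, K.IsCoproduct c ∧ K.φ.SameCycle d (K.σ c)) ∧
      ∃ p, K.IsProduct p ∧ K.φ.SameCycle d (K.σ p) := by
  obtain ⟨⟨e, he, heo⟩, ⟨e', he', heo'⟩⟩ := hb d h1 h2
  obtain ⟨⟨z, hz, hz1, hz2⟩, ⟨y, hy, hy1, hy2⟩⟩ :=
    exists_sameCycle_both_transitions K.φ K.out (he.symm.trans he') heo heo'
  have hz3 := (he.trans hz).trans (sameCycle_apply K.φ z)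
  have hy3 := (he.trans hy).trans (sameCycle_apply K.φ y)
  rw [hK.φ_apply] at hz2 hy2 hz3 hy3
  constructor
  · have hy4 : K.out (K.α y) = true := by rw [hK.out_α, hy1]; rfl
    rcases hK.cases_out hy4 with hp | ⟨c, hc, h | h⟩
    · simp [hp.2.2.2.1] at hy2
    · simp [h, hc.1, hc.2.1] at hy2
    · rw [h, hc.1] at hy3
      exact ⟨c, hc, hy3⟩
  · have hz4 : K.out (K.α z) = false := by rw [hK.out_α, hz1]; rfl
    rcases hK.cases_in hz4 with hp | ⟨p, hp, h | h⟩
    · simp [hp.2.2.2.1] at hz2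
    · simp [h, hp.1, hp.2.1] at hz2
    · rw [h, hp.1] at hz3
      exact ⟨p, hp, hz3⟩

/-- Each vertex has exactly one half-edge that is the input of a coproduct or the output of a
product. -/
theorem IsCubic.card_operators (hK : K.IsCubic) :
    Nat.card {c // K.IsCoproduct c} + Nat.card {p // K.IsProduct p} = K.numVertices := by
  rw [← Nat.card_sum]
  refine Nat.card_eq_of_bijective (fun x => Quotient.mk (Perm.SameCycle.setoid K.σ)
    (Sum.elim Subtype.val Subtype.val x)) ⟨?_, fun b => Quotient.inductionOn b fun d => by
      obtain ⟨e, h, he | he⟩ := hK.operators d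
      · exact ⟨.inl ⟨e, he⟩, Quotient.sound h.symm⟩
      · exact ⟨.inr ⟨e, he⟩, Quotient.sound h.symm⟩⟩
  have key : ∀ x y, Quotient.mk (Perm.SameCycle.setoid K.σ) x = Quotient.mk _ y →
      y = x ∨ y = K.σ x ∨ y = K.σ (K.σ x) := fun x y h =>
    sameCycle_three hK.σ_σ_σ (Quotient.exact h)
  rintro (⟨c, hc⟩ | ⟨p, hp⟩) (⟨c', hc'⟩ | ⟨p', hp'⟩) h
  · rcases key _ _ h with h | h | h
    · exact congrArg Sum.inl (Subtype.ext h.symm)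
    · have := hc'.2.1
      simp only [Sum.elim_inl] at h
      rw [h, hc.2.2.1] at this
      cases this
    · have := hc'.2.1
      simp only [Sum.elim_inl] at h
      rw [h, hc.2.2.2.1] at this
      cases this
  · rcases key _ _ h with h | h | h
    · have := hp'.2.1
      simp only [Sum.elim_inl, Sum.elim_inr] at h
      rw [h, hc.2.1] at this
      cases this
    · exact absurd h (OMap.IsProduct.ne_σ hc hp')
    · exact absurd h (OMap.IsProduct.ne_σ_σ hc hp')
  · rcases key _ _ h with h | h | h
    · have := hp.2.1
      simp only [Sum.elim_inl, Sum.elim_inr] at h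
      rw [← h, hc'.2.1] at this
      cases this
    · exact absurd h (hc'.ne_σ hp)
    · exact absurd h (hc'.ne_σ_σ hp)
  · rcases key _ _ h with h | h | h
    · exact congrArg Sum.inr (Subtype.ext h.symm)
    · have := hp'.2.1
      simp only [Sum.elim_inr] at h
      rw [h, hp.2.2.1] at this
      cases this
    · have := hp'.2.1
      simp only [Sum.elim_inr] at h
      rw [h, hp.2.2.2.1] at this
      cases this

/-- The `n + 2` faces force at least `n` coproducts and at least `n` products. There are `2n`
operators in all, so both bounds are attained, and the equality case of
`card_le_of_surjective_off_pair` gives uniqueness of corners and their absence at the root edge. -/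
theorem IsCubic.faceCorners (hK : K.IsCubic) (hb : K.BothDirections) {n : ℕ}
    (hV : K.numVertices = 2 * n) (hF : K.numFaces = n + 2) : K.FaceCorners := by
  let m : K.D → Quotient (Perm.SameCycle.setoid K.φ) := Quotient.mk _
  have hm : ∀ x y, m x = m y ↔ K.φ.SameCycle x y := fun x y => Quotient.eq
  obtain ⟨c1, c2⟩ := card_le_of_surjective_off_pair (fun c : {c // K.IsCoproduct c} => m (K.σ c))
    (m K.root) (m (K.α K.root)) (fun b => Quotient.inductionOn b fun d h1 h2 => by
      obtain ⟨c, hc, h⟩ := (hK.exists_corners hb (mt (hm _ _).2 h1) (mt (hm _ _).2 h2)).1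
      exact ⟨⟨c, hc⟩, (hm _ _).2 h.symm⟩)
  obtain ⟨p1, p2⟩ := card_le_of_surjective_off_pair (fun p : {p // K.IsProduct p} => m (K.σ p))
    (m K.root) (m (K.α K.root)) (fun b => Quotient.inductionOn b fun d h1 h2 => by
      obtain ⟨p, hp, h⟩ := (hK.exists_corners hb (mt (hm _ _).2 h1) (mt (hm _ _).2 h2)).2
      exact ⟨⟨p, hp⟩, (hm _ _).2 h.symm⟩)
  have hle := hK.card_operators
  change K.numFaces ≤ _ at c1 p1
  obtain ⟨-, c4⟩ := c2 (by change _ ≤ K.numFaces; omega)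
  obtain ⟨p3, p4⟩ := p2 (by change _ ≤ K.numFaces; omega)
  exact ⟨fun p p' hp hp' h =>
      congrArg Subtype.val (p3 (a₁ := ⟨p, hp⟩) (a₂ := ⟨p', hp'⟩) ((hm _ _).2 h)),
    fun c hc h => (c4 ⟨c, hc⟩).2 ((hm _ _).2 h.symm),
    fun p hp h => (p4 ⟨p, hp⟩).1 ((hm _ _).2 h.symm),
    fun p hp h => (p4 ⟨p, hp⟩).2 ((hm _ _).2 h.symm)⟩

/-! ## Existence of a reading -/

/-- Consecutive wires, starting to the right of the face of `x`, are separated by one face. -/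
def RightChain (K : RootedData) : K.D → List K.D → Prop
  | x, [] => K.φ.SameCycle x (K.α K.root)
  | x, r :: Q => K.φ.SameCycle x r ∧ (∃ c, K.IsCoproduct c ∧ r = K.σ c) ∧ RightChain K (K.α r) Q

/-- Consecutive wires, starting to the left of the face of `x`, are separated by one face. -/
def LeftChain (K : RootedData) : K.D → List K.D → Prop
  | x, [] => K.φ.SameCycle x K.root
  | x, y :: Q => K.φ.SameCycle x (K.α y) ∧ (∃ p, K.IsProduct p ∧ K.α y = K.σ p) ∧ LeftChain K y Q

theorem RightChain.congr {x y : K.D} (h : K.φ.SameCycle x y) {Q : List K.D}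
    (hx : K.RightChain x Q) : K.RightChain y Q := by
  cases Q with
  | nil => exact h.symm.trans hx
  | cons r Q => exact ⟨h.symm.trans hx.1, hx.2⟩

theorem LeftChain.congr {x y : K.D} (h : K.φ.SameCycle x y) {Q : List K.D}
    (hx : K.LeftChain x Q) : K.LeftChain y Q := by
  cases Q with
  | nil => exact h.symm.trans hx
  | cons r Q => exact ⟨h.symm.trans hx.1, hx.2⟩

/-- A cut whose consecutive wires are separated by one face. -/
structure IsCut (K : RootedData) (s : Scan K) : Prop where
  out_cur : K.out s.cur = true
  right : K.RightChain (K.α s.cur) s.right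
  left : K.LeftChain s.cur s.left

/-- At a left input of a product, the face to the right has a highest corner, so it is not a face at
the root edge and a wire is pending. At a right input, the face to the left has its highest corner
there; the nearest waiting wire enters the highest corner of the same face, so by uniqueness it
enters the same product. -/
theorem IsCut.exists_step (hK : K.IsCubic) (hF : K.FaceCorners) {s : Scan K} (hs : K.IsCut s) :
    ∃ r t, K.Step r s t ∧ K.IsCut t := by
  obtain ⟨o, L, R⟩ := s
  obtain ⟨ho, hR, hL⟩ := hs
  have hin : K.out (K.α o) = false := by rw [hK.out_α, ho]; rfl
  rcases hK.cases_in hin with hc | ⟨p, hp, h | h⟩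
  · refine ⟨0, ⟨K.σ (K.σ (K.α o)), L, K.σ (K.α o) :: R⟩, .inl ⟨rfl, hc, rfl, rfl, rfl⟩,
      hc.2.2.2.1, ⟨?_, ⟨_, hc, rfl⟩, ?_⟩, ?_⟩
    · have := hK.face_α (K.σ (K.σ (K.α o)))
      rwa [hc.1] at this
    · refine hR.congr ?_
      have := hK.face_α (K.σ (K.α o))
      rw [hc.1] at this
      exact this.symm
    · refine hL.congr ?_
      have := hK.face_α (K.α o)
      rwa [hK.α_α] at this
  · cases R with
    | nil =>
      refine absurd ?_ (hF.top_right p hp)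
      have := hR.symm
      rwa [h] at this
    | cons r R =>
      obtain ⟨h1, ⟨c, hc, rfl⟩, h2⟩ := hR
      exact ⟨1, ⟨K.σ c, o :: L, R⟩, .inr (.inl ⟨rfl, ⟨p, hp, h⟩, rfl, rfl⟩), hc.2.2.1, h2,
        h1.symm, ⟨p, hp, h⟩, hL⟩
  · have hface : K.φ.SameCycle o (K.σ p) := by
      have := hK.face_α (K.σ (K.σ p))
      rwa [← h, hK.α_α, h, hp.1] at this
    cases L with
    | nil => exact absurd (LeftChain.congr hface hL).symm (hF.top_left p hp)
    | cons x L =>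
      obtain ⟨h1, ⟨q, hq, h2⟩, h3⟩ := hL
      obtain rfl := hF.top_unique p q hp hq (hface.symm.trans (h2 ▸ h1))
      refine ⟨2, ⟨p, L, R⟩, .inr (.inr ⟨rfl, hp, h, ⟨x, h2, rfl⟩, rfl⟩), hp.2.1, hR.congr ?_,
        h3.congr ?_⟩
      · have := hK.face_α p
        rw [← h] at this
        exact this.symm
      · have := hK.face_α (K.σ p)
        rwa [hp.1, ← h2, hK.α_α] at this

/-- The new current wire reveals the step: it is the left output of a coproduct, the right output of
a coproduct, or the output of a product. In the second case the previous wire is the left input at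
the highest corner of the face between the two wires, which is unique. -/
theorem IsCut.cur_injective (hF : K.FaceCorners) {r r' : Fin 3}
    {s t s' t' : Scan K} (hs : K.IsCut s) (hs' : K.IsCut s') (h : K.Step r s t)
    (h' : K.Step r' s' t') (heq : t.cur = t'.cur) : s.cur = s'.cur := by
  have left : ∀ {s t : Scan K}, K.IsCut s → s.right = t.cur :: t.right →
      K.φ.SameCycle (K.α s.cur) t.cur ∧ ∃ c, K.IsCoproduct c ∧ t.cur = K.σ c := by
    intro s t hs h
    have := hs.right
    rw [h] at this
    exact ⟨this.1, this.2.1⟩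
  apply K.α.injective
  rcases h with ⟨-, hc, h1, -⟩ | ⟨-, ⟨p, hp, h1⟩, -, h2⟩ | ⟨-, hp, h1, -⟩ <;>
  rcases h' with ⟨-, hc', h1', -⟩ | ⟨-, ⟨p', hp', h1'⟩, -, h2'⟩ | ⟨-, hp', h1', -⟩
  · rw [h1, h1'] at heq
    exact K.σ.injective (K.σ.injective heq)
  · obtain ⟨-, c, hc1, hc2⟩ := left hs' h2'
    exact absurd (hc2.symm.trans (heq.symm.trans h1)) (hc1.σ_ne_σ_σ hc)
  · exact absurd (heq.symm.trans h1) (OMap.IsProduct.ne_σ_σ hc hp')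
  · obtain ⟨-, c, hc1, hc2⟩ := left hs h2
    exact absurd (hc2.symm.trans (heq.trans h1')) (hc1.σ_ne_σ_σ hc')
  · have e1 := (left hs h2).1
    have e2 := (left hs' h2').1
    rw [← heq] at e2
    have e3 := e1.trans e2.symm
    rw [h1, h1'] at e3
    rw [h1, h1', hF.top_unique p p' hp hp' e3]
  · obtain ⟨-, c, hc1, hc2⟩ := left hs h2
    exact absurd (heq.symm.trans hc2) (OMap.IsProduct.ne_σ hc1 hp')
  · exact absurd (heq.trans h1') (OMap.IsProduct.ne_σ_σ hc' hp)
  · obtain ⟨-, c, hc1, hc2⟩ := left hs' h2'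
    exact absurd (heq.trans hc2) (OMap.IsProduct.ne_σ hc1 hp)
  · rw [h1, h1', heq]

/-- A neighbouring wire on the right would put a lowest corner on the face to the right of the root
edge, and one on the left a highest corner on the face to the left of it. -/
theorem IsCut.eq_of_cur_eq_root (hF : K.FaceCorners) {s : Scan K}
    (hs : K.IsCut s) (h : s.cur = K.root) : s = ⟨K.root, [], []⟩ := by
  obtain ⟨o, L, R⟩ := s
  obtain ⟨-, hR, hL⟩ := hs
  obtain rfl : o = K.root := h
  cases R with
  | cons r R =>
    obtain ⟨h1, ⟨c, hc, rfl⟩, -⟩ := hR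
    exact absurd h1 (hF.bottom_right c hc)
  | nil =>
    cases L with
    | cons x L =>
      obtain ⟨h1, ⟨p, hp, h2⟩, -⟩ := hL
      exact absurd (h2 ▸ h1) (hF.top_left p hp)
    | nil => rfl

/-- Wires met by a sweep form a set closed under the permutations of the map. -/
theorem surj_of_connected (hK : K.IsCubic) (hconn : K.Connected) {N : ℕ} {w : ℕ → Fin 3}
    {s : ℕ → Scan K} (hN : 0 < N) (start : s 0 = ⟨K.root, [], []⟩)
    (finish : s N = ⟨K.root, [], []⟩) (step : ∀ i < N, K.Step (w i) (s i) (s (i + 1)))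
    (d : K.D) (hd : K.out d = true) (hout : ∀ i, K.out (s i).cur = true) :
    ∃ i < N, (s i).cur = d := by
  have hl0 : (s 0).left = [] := by rw [start]
  have hr0 : (s 0).right = [] := by rw [start]
  have hlN : (s N).left = [] := by rw [finish]
  have hrN : (s N).right = [] := by rw [finish]
  let V : K.D → Prop := fun d => ∃ i < N, d = (s i).cur ∨ d = K.α (s i).cur
  have hle : ∀ i ≤ N, V (s i).cur := fun i hi => by
    rcases hi.lt_or_eq with h | rfl
    · exact ⟨i, h, .inl rfl⟩
    · exact ⟨0, hN, .inl (by rw [finish, start])⟩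
  have hα : ∀ d, V d → V (K.α d) := by
    rintro d ⟨i, hi, rfl | rfl⟩
    · exact ⟨i, hi, .inr rfl⟩
    · exact ⟨i, hi, .inl (hK.α_α _)⟩
  have hσ : ∀ d, V d → V (K.σ d) := by
    rintro d ⟨i, hi, h⟩
    have hcases : (∃ j < N, d = K.α (s j).cur) ∨ ∃ j < N, d = (s (j + 1)).cur := by
      rcases h with rfl | rfl
      · rcases i with _ | i
        -- The root is current at both times 0 and `N`; as the output of an operator it is produced
        -- by the last step.
        · refine .inr ⟨N - 1, by omega, ?_⟩
          rw [Nat.sub_add_cancel hN, start, finish]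
        · exact .inr ⟨i, by omega, rfl⟩
      · exact .inl ⟨i, hi, rfl⟩
    clear h hi i
    rcases hcases with ⟨i, hi, rfl⟩ | ⟨i, hi, rfl⟩
    · rcases step i hi with ⟨-, hc, -, -, h2⟩ | ⟨-, ⟨p, hp, h1⟩, h2, -⟩ | ⟨-, hp, h1, -⟩
      · obtain ⟨j, -, h3, h4, -⟩ := mem_right_future step hrN (i := i + 1) hi
          (r := K.σ (K.α (s i).cur)) (by rw [h2]; simp)
        rw [← h4]
        exact hle _ h3
      · obtain ⟨j, -, h3, -, h4, h5⟩ := mem_left_future step hlN (i := i + 1) hi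
          (x := (s i).cur) (by rw [h2]; simp)
        rw [h4, ← h5]
        exact hα _ (hle j h3.le)
      · rw [h1, hp.1]
        exact hle _ hi
    · rcases step i hi with ⟨-, hc, h1, -⟩ | ⟨-, -, -, h2⟩ | ⟨-, hp, h1, ⟨x, h2, h3⟩, -⟩
      · rw [h1, hc.1]
        exact hα _ (hle _ hi.le)
      · obtain ⟨j, hj, -, -, h5⟩ := mem_right_past step hr0 (i := i) hi.le
          (r := (s (i + 1)).cur) (by rw [h2]; simp)
        rw [← h5]
        exact hle _ (by omega)
      · rw [← h2]
        obtain ⟨j, hj, h4, -⟩ := mem_left_past step hl0 (i := i) hi.le (x := x) (by rw [h3]; simp)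
        rw [h4]
        exact hα _ (hle _ (by omega))
  have hiff : ∀ x y, Relation.EqvGen (fun a b => b = K.σ a ∨ b = K.α a) x y → (V x ↔ V y) := by
    intro x y h
    induction h with
    | rel x y h =>
      rcases h with rfl | rfl
      · exact ⟨hσ x, fun h => by simpa only [hK.σ_σ_σ] using hσ _ (hσ _ h)⟩
      · exact ⟨hα x, fun h => by simpa only [hK.α_α] using hα _ h⟩
    | refl x => exact Iff.rfl
    | symm x y _ ih => exact ih.symm
    | trans x y z _ _ ih1 ih2 => exact ih1.trans ih2
  obtain ⟨i, hi, h | h⟩ := (hiff _ _ (hconn (s 0).cur d)).1 (hle 0 hN.le)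
  · exact ⟨i, hi, h.symm⟩
  · have := hK.out_α (s i).cur
    rw [← h, hd, hout i] at this
    cases this

/-- Iterate the step from the cut at the root. By finiteness some current wire recurs, and tracing
both occurrences back (`IsCut.cur_injective`) shows that the root recurs. The sweep stops at the
first return, so that no wire is current twice. -/
theorem IsCubic.exists_reading (hK : K.IsCubic) (hF : K.FaceCorners) (hconn : K.Connected) :
    ∃ N w s, K.IsReading N w s := by
  choose f g hfg using fun s : {s // K.IsCut s} => IsCut.exists_step hK hF s.2
  have h0 : K.IsCut ⟨K.root, [], []⟩ := ⟨hK.root_product.2.1, Perm.SameCycle.refl _ _,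
    Perm.SameCycle.refl _ _⟩
  let next : {s // K.IsCut s} → {s // K.IsCut s} := fun s => ⟨g s, (hfg s).2⟩
  let S : ℕ → {s // K.IsCut s} := fun i => next^[i] ⟨_, h0⟩
  have hS : ∀ i, S (i + 1) = next (S i) := fun i => Function.iterate_succ_apply' _ _ _
  have hstep : ∀ i, K.Step (f (S i)) (S i).1 (S (i + 1)).1 := fun i => by
    rw [hS]; exact (hfg (S i)).1
  have hback : ∀ k i, (S i).1.cur = (S (i + k)).1.cur → (S 0).1.cur = (S k).1.cur := by
    intro k i
    induction i with
    | zero => simp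
    | succ i ih =>
      intro h
      rw [show i + 1 + k = i + k + 1 by omega] at h
      exact ih (IsCut.cur_injective hF (S i).2 (S (i + k)).2 (hstep _) (hstep _) h)
  have hex : ∃ N, 0 < N ∧ (S N).1.cur = K.root := by
    obtain ⟨i, j, hij, h⟩ := Finite.exists_ne_map_eq_of_infinite fun i => (S i).1.cur
    wlog hlt : i < j generalizing i j
    · exact this j i hij.symm h.symm (by omega)
    refine ⟨j - i, by omega, (hback (j - i) i ?_).symm⟩
    rw [Nat.add_sub_cancel' hlt.le]
    exact h
  classical
  obtain ⟨hN0, hN⟩ := Nat.find_spec hex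
  have hfin := IsCut.eq_of_cur_eq_root hF (S (Nat.find hex)).2 hN
  refine ⟨Nat.find hex, fun i => f (S i), fun i => (S i).1, rfl, hfin, fun i _ => hstep i,
    fun d hd => surj_of_connected hK hconn hN0 rfl hfin (fun i _ => hstep i) d hd
      fun i => (S i).2.out_cur, ?_⟩
  have key : ∀ i j, i < j → j < Nat.find hex → (S i).1.cur ≠ (S j).1.cur := by
    intro i j hij hj h
    refine Nat.find_min hex (m := j - i) (by omega) ⟨by omega, (hback (j - i) i ?_).symm⟩
    rw [Nat.add_sub_cancel' hij.le]
    exact h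
  intro i hi j hj h
  rcases lt_trichotomy i j with hij | hij | hij
  · exact absurd h (key i j hij hj)
  · exact hij
  · exact absurd h.symm (key j i hij hi)

end RootedData

namespace RootedData
namespace IsReading

variable {K : RootedData} {N : ℕ} {w : ℕ → Fin 3} {s : ℕ → Scan K}
  (h : K.IsReading N w s) (hK : K.IsCubic)

/-! ## Times and heights -/

/-- The time at which the wire of a half-edge is current. -/
noncomputable def time (d : K.D) : ℕ := (h.exists_cur hK d).choose

theorem time_lt (d : K.D) : h.time hK d < N := (h.exists_cur hK d).choose_spec.1

theorem time_spec (d : K.D) : (s (h.time hK d)).cur = d ∨ K.α (s (h.time hK d)).cur = d :=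
  (h.exists_cur hK d).choose_spec.2

theorem cur_time {d : K.D} (hd : K.out d = true) : (s (h.time hK d)).cur = d := by
  rcases h.time_spec hK d with h1 | h1
  · exact h1
  · have := h.out_α_cur hK (h.time_lt hK d).le
    rw [h1, hd] at this
    cases this

theorem time_cur {i : ℕ} (hi : i < N) : h.time hK (s i).cur = i :=
  h.inj _ (h.time_lt hK _) _ hi (h.cur_time hK (h.out_cur hK hi.le))

theorem time_α (d : K.D) : h.time hK (K.α d) = h.time hK d := by
  rcases h.time_spec hK d with h1 | h1
  · rcases h.time_spec hK (K.α d) with h2 | h2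
    · exfalso
      have e1 := h.out_cur hK (h.time_lt hK d).le
      have e2 := h.out_cur hK (h.time_lt hK (K.α d)).le
      rw [h1] at e1
      rw [h2, hK.out_α, e1] at e2
      cases e2
    · exact h.inj _ (h.time_lt hK _) _ (h.time_lt hK _) (K.α.injective h2 |>.trans h1.symm)
  · rw [← h1, hK.α_α, h.time_cur hK (h.time_lt hK d)]
    conv_rhs => rw [h1]

theorem time_α_cur {i : ℕ} (hi : i < N) : h.time hK (K.α (s i).cur) = i := by
  rw [h.time_α, h.time_cur hK hi]

theorem time_root : h.time hK K.root = 0 := by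
  rw [← h.cur_zero, h.time_cur hK (h.pos hK)]

/-- The time of an input half-edge. -/
noncomputable def inputTime (d : K.D) : ℕ := if K.out d = true then 0 else h.time hK d

/-- The last time at which an input of the vertex of `d` is current. -/
noncomputable def height (d : K.D) : ℕ :=
  max (h.inputTime hK d) (max (h.inputTime hK (K.σ d)) (h.inputTime hK (K.σ (K.σ d))))

theorem height_σ (d : K.D) : h.height hK (K.σ d) = h.height hK d := by
  unfold height
  rw [hK.σ_σ_σ]
  omega

theorem height_eq_of_sameCycle {x y : K.D} (hxy : K.σ.SameCycle x y) :
    h.height hK x = h.height hK y := by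
  rcases sameCycle_three hK.σ_σ_σ hxy with rfl | rfl | rfl
  · rfl
  · rw [height_σ]
  · rw [height_σ, height_σ]

theorem inputTime_of_out {d : K.D} (hd : K.out d = true) : h.inputTime hK d = 0 := by
  simp [inputTime, hd]

theorem inputTime_of_in {d : K.D} (hd : K.out d = false) :
    h.inputTime hK d = h.time hK d := by
  simp [inputTime, hd]

theorem time_le_height {d : K.D} (hd : K.out d = false) : h.time hK d ≤ h.height hK d := by
  rw [← h.inputTime_of_in hK hd]
  exact le_max_left _ _

theorem height_coproduct {c : K.D} (hc : K.IsCoproduct c) : h.height hK c = h.time hK c := by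
  unfold height
  rw [h.inputTime_of_in hK hc.2.1, h.inputTime_of_out hK hc.2.2.1,
    h.inputTime_of_out hK hc.2.2.2.1]
  omega

theorem height_product {p : K.D} (hp : K.IsProduct p) :
    h.height hK p = max (h.time hK (K.σ p)) (h.time hK (K.σ (K.σ p))) := by
  unfold height
  rw [h.inputTime_of_in hK hp.2.2.1, h.inputTime_of_in hK hp.2.2.2.1,
    h.inputTime_of_out hK hp.2.1]
  omega

/-- All inputs of the operator that a wire comes from have been read before that wire, whether it
was just produced or was pending. -/
theorem height_cur_lt {i : ℕ} (hi : i < N) : h.height hK (s (i + 1)).cur < i + 1 := by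
  rcases h.step i hi with ⟨-, hc, h1, -⟩ | ⟨-, -, -, h2⟩ | ⟨-, hp, h1, ⟨x, h2, h3⟩, -⟩
  · rw [h1, height_σ, height_σ, h.height_coproduct hK hc, h.time_α_cur hK hi]
    omega
  · obtain ⟨j, hj, hc, h5, -⟩ := mem_right_past h.step h.right_zero (i := i) hi.le
      (r := (s (i + 1)).cur) (by rw [h2]; simp)
    rw [h5, height_σ, h.height_coproduct hK hc, h.time_α_cur hK (by omega)]
    omega
  · obtain ⟨j, hj, h4, -⟩ := mem_left_past h.step h.left_zero (i := i) hi.le (x := x)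
      (by rw [h3]; simp)
    rw [h.height_product hK hp, ← h1, ← h2, h4, h.time_α_cur hK hi, h.time_α_cur hK (by omega)]
    omega

/-- The root edge is excluded because it closes the prograph and leads back to the first operator.
-/
theorem height_lt_height_α {d : K.D} (hd : K.out d = true) (hr : d ≠ K.root) :
    h.height hK d < h.height hK (K.α d) := by
  have h1 := h.cur_time hK hd
  have h2 := h.time_le_height hK (d := K.α d) (by rw [hK.out_α, hd]; rfl)
  rw [h.time_α] at h2
  refine lt_of_lt_of_le ?_ h2
  rcases hi : h.time hK d with _ | i
  · rw [hi, h.cur_zero] at h1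
    exact absurd h1.symm hr
  · have h3 := h.time_lt hK d
    rw [hi] at h1 h3
    rw [← h1]
    exact h.height_cur_lt hK (by omega)

/-! ## Labels of faces -/

/-- The label of the face to the left of the current wire. -/
noncomputable def leftLabel (i : ℕ) : ℕ :=
  ((s i).left.map fun x => h.time hK x + 1).headD 0

/-- The label of the face to the right of the current wire. -/
noncomputable def rightLabel (i : ℕ) : ℕ := ((s i).right.map (h.time hK)).headD (N + 1)

/-- The label of the face to the left of a half-edge. -/
noncomputable def label (d : K.D) : ℕ :=
  if K.out d = true then h.leftLabel hK (h.time hK d) else h.rightLabel hK (h.time hK d)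

/-- Waiting wires were current strictly earlier, which absorbs the `+ 1` in the label. -/
theorem leftLabel_le {i : ℕ} (hi : i ≤ N) : h.leftLabel hK i ≤ i := by
  unfold leftLabel
  rcases hl : (s i).left with _ | ⟨x, Q⟩
  · simp
  · obtain ⟨j, hj, h1, -⟩ := mem_left_past h.step h.left_zero hi (x := x) (by rw [hl]; simp)
    simp only [List.map_cons, List.headD_cons]
    rw [h1, h.time_cur hK (by omega)]
    omega

/-- Pending wires become current strictly later. The default value `N + 1`, rather than `N`, keeps
the inequality strict at `i = N`. -/
theorem lt_rightLabel {i : ℕ} (hi : i ≤ N) : i < h.rightLabel hK i := by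
  unfold rightLabel
  rcases hl : (s i).right with _ | ⟨x, Q⟩
  · simp only [List.map_nil, List.headD_nil]
    omega
  · obtain ⟨j, hj, h1, h2, h3⟩ := mem_right_future h.step h.right_last hi (r := x)
      (by rw [hl]; simp)
    simp only [List.map_cons, List.headD_cons]
    have : j + 1 ≠ N := fun e => by rw [e, h.left_last] at h3; cases h3
    rw [← h2, h.time_cur hK (by omega)]
    omega

theorem leftLabel_time_cur {i : ℕ} (hi : i ≤ N) :
    h.leftLabel hK (h.time hK (s i).cur) = h.leftLabel hK i := by
  rcases hi.lt_or_eq with hi | rfl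
  · rw [h.time_cur hK hi]
  · rw [h.cur_last, time_root, leftLabel, leftLabel, h.left_zero, h.left_last]

theorem rightLabel_time_cur {i : ℕ} (hi : i ≤ N) :
    h.rightLabel hK (h.time hK (s i).cur) = h.rightLabel hK i := by
  rcases hi.lt_or_eq with hi | rfl
  · rw [h.time_cur hK hi]
  · rw [h.cur_last, time_root, rightLabel, rightLabel, h.right_zero, h.right_last]

theorem label_cur {i : ℕ} (hi : i ≤ N) : h.label hK (s i).cur = h.leftLabel hK i := by
  rw [label, if_pos (h.out_cur hK hi), h.leftLabel_time_cur hK hi]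

theorem label_α_cur {i : ℕ} (hi : i ≤ N) : h.label hK (K.α (s i).cur) = h.rightLabel hK i := by
  rw [label, if_neg (by simp [h.out_α_cur hK hi]), h.time_α, h.rightLabel_time_cur hK hi]

theorem label_root : h.label hK K.root = 0 := by
  rw [← h.cur_zero, h.label_cur hK (Nat.zero_le _), leftLabel, h.left_zero]; rfl

theorem label_α_root : h.label hK (K.α K.root) = N + 1 := by
  rw [← h.cur_zero, h.label_α_cur hK (Nat.zero_le _), rightLabel, h.right_zero]; rfl

/-- Each equality says that the label does not change around one corner. For the corner between the
outputs: when `σ c` becomes current, the wire read just before has been put aside next to it, so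
`time + 1` of that wire is the time of `σ c`. For the other two corners, the relevant list is the
same at both cuts. -/
theorem label_coproduct {c : K.D} (hc : K.IsCoproduct c) :
    h.label hK (K.σ (K.σ c)) = h.label hK (K.α c) ∧
    h.label hK c = h.label hK (K.α (K.σ c)) ∧
    h.label hK (K.σ c) = h.label hK (K.α (K.σ (K.σ c))) ∧
    h.label hK (K.σ c) = h.time hK (K.σ c) ∧ 0 < h.time hK (K.σ c) := by
  obtain ⟨i, hi, h1, -, h2, h3, h4⟩ := h.step_coproduct hK hc
  obtain ⟨j, hj, hjN, h5, h6⟩ := right_of_suffix h.step h.right_last (i := i + 1) hi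
    (r := K.σ c) (Q := (s i).right) (by rw [h4])
  obtain ⟨k, hk, hkN, h7, h8⟩ := mem_right_future h.step h.right_last (i := i + 1) hi
    (r := K.σ c) (by rw [h4]; simp)
  have hk1 : k + 1 ≠ N := fun e => by rw [e, h.left_last] at h8; cases h8
  have h9 : h.time hK (K.σ c) = k + 1 := by rw [← h7, h.time_cur hK (by omega)]
  have h10 : h.label hK (K.σ c) = k + 1 := by
    rw [← h7, h.label_cur hK hkN, leftLabel, h8]
    simp only [List.map_cons, List.headD_cons]
    rw [h.time_cur hK hkN]
  refine ⟨?_, ?_, ?_, h10.trans h9.symm, by omega⟩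
  · rw [← h2, h.label_cur hK hi, ← h1, hK.α_α, h.label_cur hK hi.le, leftLabel, leftLabel, h3]
  · rw [← h5, h.label_α_cur hK hjN, ← h1, h.label_α_cur hK hi.le, rightLabel, rightLabel, h6]
  · rw [h10, ← h2, h.label_α_cur hK hi, rightLabel, h4]
    simp only [List.map_cons, List.headD_cons]
    rw [h9]

/-- At the highest corner, the left input was put aside at some time `j` and the wire to its right
was read at time `j + 1`. Both descriptions of the label of the face between the inputs give `j +
1`. -/
theorem label_product {p : K.D} (hp : K.IsProduct p) :
    h.label hK (K.σ (K.σ p)) = h.label hK (K.α p) ∧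
    h.label hK p = h.label hK (K.α (K.σ p)) ∧
    h.label hK (K.σ p) = h.label hK (K.α (K.σ (K.σ p))) ∧
    h.label hK (K.σ p) = h.time hK (K.σ p) + 1 := by
  obtain ⟨i, hi, h1, -, h2, h3, h4⟩ := h.step_product hK hp
  obtain ⟨j, hj, h5, h6, h7⟩ := h.step_product_left hi.le h4
  have h8 : K.σ p = K.α (s j).cur := by rw [h5, hK.α_α]
  have h9 : h.label hK (K.σ p) = j + 1 := by
    rw [h8, h.label_α_cur hK (by omega), rightLabel, h7]
    simp only [List.map_cons, List.headD_cons]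
    rw [h.time_cur hK (by omega)]
  refine ⟨?_, ?_, ?_, ?_⟩
  · rw [← h1, h.label_α_cur hK hi.le, ← h2, h.label_α_cur hK hi, rightLabel, rightLabel, h3]
  · rw [← h5, h.label_cur hK (by omega), ← h2, h.label_cur hK hi, leftLabel, leftLabel, h6]
  · rw [h9, ← h1, hK.α_α, h.label_cur hK hi.le, leftLabel, h4]
    simp only [List.map_cons, List.headD_cons]
    rw [← h5, h.time_cur hK (by omega)]
  · rw [h9, h8, h.time_α_cur hK (by omega)]

theorem label_σ_σ (d : K.D) : h.label hK (K.σ (K.σ d)) = h.label hK (K.α d) := by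
  rcases hK.cases d with ⟨c, hc, rfl | rfl | rfl⟩ | ⟨p, hp, rfl | rfl | rfl⟩
  · exact (h.label_coproduct hK hc).1
  · rw [hK.σ_σ_σ]; exact (h.label_coproduct hK hc).2.1
  · rw [hK.σ_σ_σ]; exact (h.label_coproduct hK hc).2.2.1
  · exact (h.label_product hK hp).1
  · rw [hK.σ_σ_σ]; exact (h.label_product hK hp).2.1
  · rw [hK.σ_σ_σ]; exact (h.label_product hK hp).2.2.1

theorem label_eq_of_sameCycle {x y : K.D} (hxy : K.φ.SameCycle x y) :
    h.label hK x = h.label hK y := by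
  obtain ⟨i, rfl⟩ := hxy.exists_nat_pow_eq
  clear hxy
  induction i with
  | zero => rfl
  | succ i ih =>
    rw [ih, pow_succ', Perm.mul_apply, hK.φ_apply, h.label_σ_σ hK, hK.α_α]

/-- Through duality this becomes the acyclicity of the triangulation. -/
theorem label_lt_label_α {d : K.D} (hd : K.out d = true) :
    h.label hK d < h.label hK (K.α d) := by
  rw [← h.cur_time hK hd, h.label_cur hK (h.time_lt hK d).le, h.label_α_cur hK (h.time_lt hK d).le]
  exact (h.leftLabel_le hK (h.time_lt hK d).le).trans_lt (h.lt_rightLabel hK (h.time_lt hK d).le)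

-- The face above a coproduct has the time of its right output as label. These labels are distinct
-- and lie strictly between 0 and `N + 1`, the labels of the two faces at the root edge. This lower
-- bound on the number of faces does not use planarity.
include h hK in
theorem card_coproducts_add_two_le :
    Nat.card {c // K.IsCoproduct c} + 2 ≤ K.numFaces := by
  have hc : Nat.card ({c // K.IsCoproduct c} ⊕ Bool) = Nat.card {c // K.IsCoproduct c} + 2 := by
    simp [Nat.card_sum]
  rw [← hc]
  refine Nat.card_le_card_of_injective (fun x => Quotient.mk (Perm.SameCycle.setoid K.φ)
    (Sum.elim (fun c => K.σ c.1) (fun b => if b then K.root else K.α K.root) x)) ?_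
  intro x y hxy
  have hl := h.label_eq_of_sameCycle hK (Quotient.exact hxy)
  have hlt := fun c : {c // K.IsCoproduct c} => h.time_lt hK (K.σ c)
  have hlab := fun c : {c // K.IsCoproduct c} => h.label_coproduct hK c.2
  have h0 := h.label_root hK
  have h1 := h.label_α_root hK
  rcases x with c | _ | _ <;> rcases y with c' | _ | _ <;>
    simp only [Sum.elim_inl, Sum.elim_inr, if_true, if_false, Bool.false_eq_true] at hl
  · have e : h.time hK (K.σ c) = h.time hK (K.σ c') := by
      rw [← (hlab c).2.2.2.1, hl, (hlab c').2.2.2.1]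
    have e1 := h.cur_time hK c.2.2.2.1
    have e2 := h.cur_time hK c'.2.2.2.1
    rw [e, e2] at e1
    rw [Subtype.ext (K.σ.injective e1)]
  · have := hlab c; have := hlt c; omega
  · have := hlab c; have := hlt c; omega
  · have := hlab c'; have := hlt c'; omega
  · rfl
  · omega
  · have := hlab c'; have := hlt c'; omega
  · omega
  · rfl

include h hK in
theorem card_products_add_two_le :
    Nat.card {p // K.IsProduct p} + 2 ≤ K.numFaces := by
  have hc : Nat.card ({p // K.IsProduct p} ⊕ Bool) = Nat.card {p // K.IsProduct p} + 2 := by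
    simp [Nat.card_sum]
  rw [← hc]
  refine Nat.card_le_card_of_injective (fun x => Quotient.mk (Perm.SameCycle.setoid K.φ)
    (Sum.elim (fun c => K.σ c.1) (fun b => if b then K.root else K.α K.root) x)) ?_
  intro x y hxy
  have hl := h.label_eq_of_sameCycle hK (Quotient.exact hxy)
  have hlt := fun p : {p // K.IsProduct p} => h.time_lt hK (K.σ p)
  have hlab := fun p : {p // K.IsProduct p} => (h.label_product hK p.2).2.2.2
  have h0 := h.label_root hK
  have h1 := h.label_α_root hK
  rcases x with p | _ | _ <;> rcases y with p' | _ | _ <;>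
    simp only [Sum.elim_inl, Sum.elim_inr, if_true, if_false, Bool.false_eq_true] at hl
  · have e : h.time hK (K.α (K.σ p)) = h.time hK (K.α (K.σ p')) := by
      rw [h.time_α, h.time_α]
      rw [hlab p, hlab p'] at hl
      omega
    have e1 := h.cur_time hK (d := K.α (K.σ p)) (by rw [hK.out_α, p.2.2.2.1]; rfl)
    have e2 := h.cur_time hK (d := K.α (K.σ p')) (by rw [hK.out_α, p'.2.2.2.1]; rfl)
    rw [e, e2] at e1
    rw [Subtype.ext (K.σ.injective (K.α.injective e1))]
  · have := hlab p; have := hlt p; omega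
  · have := hlab p; have := hlt p; omega
  · have := hlab p'; have := hlt p'; omega
  · rfl
  · omega
  · have := hlab p'; have := hlt p'; omega
  · omega
  · rfl

end IsReading
end RootedData

namespace RootedData

variable {K K' : RootedData} {N : ℕ} {w w' : ℕ → Fin 3} {s : ℕ → Scan K} {s' : ℕ → Scan K'}

/-! ## The word of a reading determines the map -/

/-- This fixes the length of a reading: a map with `6n` half-edges is read in `3n` steps. -/
theorem IsReading.card_eq (h : K.IsReading N w s) (hK : K.IsCubic) : Nat.card K.D = 2 * N := by
  have hb : Function.Bijective fun x : Fin N × Bool =>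
      if x.2 then (s x.1).cur else K.α (s x.1).cur := by
    constructor
    · rintro ⟨i, b⟩ ⟨j, c⟩ hij
      have hi := h.out_cur hK i.2.le
      have hj := h.out_cur hK j.2.le
      have hi' := h.out_α_cur hK i.2.le
      have hj' := h.out_α_cur hK j.2.le
      cases b <;> cases c <;> simp only [if_true, if_false, Bool.false_eq_true] at hij
      · rw [Fin.ext (h.inj i i.2 j j.2 (K.α.injective hij))]
      · rw [hij, hj] at hi'; cases hi'
      · rw [hij, hj'] at hi; cases hi
      · rw [Fin.ext (h.inj i i.2 j j.2 hij)]
    · intro d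
      obtain ⟨i, hi, hd | hd⟩ := h.exists_cur hK d
      · exact ⟨(⟨i, hi⟩, true), hd⟩
      · exact ⟨(⟨i, hi⟩, false), hd⟩
  rw [← Nat.card_congr (Equiv.ofBijective _ hb)]
  simp [mul_comm]

namespace IsReading

variable (h : K.IsReading N w s) (hK : K.IsCubic) (h' : K'.IsReading N w' s') (hK' : K'.IsCubic)

/-- Wires of the same time correspond to each other. -/
noncomputable def transfer (_ : K'.IsReading N w' s') (d : K.D) : K'.D :=
  if K.out d = true then (s' (h.time hK d)).cur else K'.α (s' (h.time hK d)).cur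

include hK' in
theorem transfer_α (d : K.D) :
    h.transfer hK h' (K.α d) = K'.α (h.transfer hK h' d) := by
  unfold transfer
  rw [h.time_α, hK.out_α]
  cases K.out d
  · simp [hK'.α_α]
  · simp

theorem transfer_cur {i : ℕ} (hi : i ≤ N) : h.transfer hK h' (s i).cur = (s' i).cur := by
  rw [transfer, if_pos (h.out_cur hK hi)]
  rcases hi.lt_or_eq with hi | rfl
  · rw [h.time_cur hK hi]
  · rw [h.cur_last, time_root, h'.cur_zero, h'.cur_last]

include hK' in
theorem out_transfer (d : K.D) : K'.out (h.transfer hK h' d) = K.out d := by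
  unfold transfer
  cases hd : K.out d
  · simpa using h'.out_α_cur hK' (h.time_lt hK d).le
  · simpa using h'.out_cur hK' (h.time_lt hK d).le

include hK' in
theorem transfer_transfer (d : K.D) :
    h'.transfer hK' h (h.transfer hK h' d) = d := by
  cases hd : K.out d
  · have h1 := h.cur_time hK (d := K.α d) (by rw [hK.out_α, hd]; rfl)
    have h2 : h.transfer hK h' d = K'.α (s' (h.time hK (K.α d))).cur := by
      simp [transfer, hd, h.time_α]
    rw [h2, h'.transfer_α hK' h hK, h'.transfer_cur hK' h (h.time_lt hK _).le, h1, hK.α_α]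
  · have h1 := h.cur_time hK hd
    rw [← h1, h.transfer_cur hK h' (h.time_lt hK d).le,
      h'.transfer_cur hK' h (h.time_lt hK d).le]

/-- Forward induction works because what is pushed on the left list is the current wire, whose image
is known. -/
theorem transfer_left (hw : ∀ i < N, w i = w' i) {i : ℕ} (hi : i ≤ N) :
    (s' i).left = (s i).left.map (h.transfer hK h') := by
  induction i with
  | zero => rw [h.left_zero, h'.left_zero]; rfl
  | succ i ih =>
    specialize ih (by omega)
    have hwi := hw i hi
    rcases h.step i hi with ⟨e, -, -, h1, -⟩ | ⟨e, -, h1, -⟩ | ⟨e, -, -, ⟨x, -, h1⟩, -⟩ <;>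
    rcases h'.step i hi with ⟨e', -, -, h2, -⟩ | ⟨e', -, h2, -⟩ | ⟨e', -, -, ⟨x', -, h2⟩, -⟩ <;>
    first
    | (exfalso; rw [e, e'] at hwi; revert hwi; decide)
    | skip
    · rw [h1, h2, ih]
    · rw [h1, h2, ih, List.map_cons, h.transfer_cur hK h' (by omega)]
    · rw [h1, h2, List.map_cons, List.cons.injEq] at ih
      exact ih.2

/-- The induction runs backwards: a wire pushed on the right list is identified only when it becomes
current, so in reversed time it is the current wire that is pushed. -/
theorem transfer_right (hw : ∀ i < N, w i = w' i) {i : ℕ} (hi : i ≤ N) :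
    (s' i).right = (s i).right.map (h.transfer hK h') := by
  induction hi using Nat.decreasingInduction with
  | self => rw [h.right_last, h'.right_last]; rfl
  | of_succ i hi ih =>
    have hwi := hw i hi
    rcases h.step i hi with ⟨e, -, -, -, h1⟩ | ⟨e, -, -, h1⟩ | ⟨e, -, -, -, h1⟩ <;>
    rcases h'.step i hi with ⟨e', -, -, -, h2⟩ | ⟨e', -, -, h2⟩ | ⟨e', -, -, -, h2⟩ <;>
    first
    | (exfalso; rw [e, e'] at hwi; revert hwi; decide)
    | skip
    · rw [h1, h2, List.map_cons, List.cons.injEq] at ih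
      exact ih.2
    · rw [h1, h2, ih, List.map_cons, h.transfer_cur hK h' (by omega)]
    · rw [h1] at ih
      rw [← h2, ih]

include hK' in
-- The step at an operator shows all its half-edges in the cuts before and after it, as current
-- wires or as heads of the lists, and these correspond under the transfer.
theorem transfer_σ (hw : ∀ i < N, w i = w' i) (d : K.D) :
    h.transfer hK h' (K.σ d) = K'.σ (h.transfer hK h' d) := by
  set f := h.transfer hK h' with hf
  have cop : ∀ c, K.IsCoproduct c → f (K.σ c) = K'.σ (f c) ∧
      f (K.σ (K.σ c)) = K'.σ (K'.σ (f c)) := by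
    intro c hc
    obtain ⟨i, hi, h1, hwi, h2, h3, h4⟩ := h.step_coproduct hK hc
    have hfc : K'.α (s' i).cur = f c := by
      rw [← h1, hf, h.transfer_α hK h' hK', h.transfer_cur hK h' hi.le]
    rcases h'.step i hi with ⟨-, -, h5, -, h7⟩ | ⟨e, -⟩ | ⟨e, -⟩
    · rw [hfc] at h5 h7
      refine ⟨?_, by rw [← h5, ← h2, hf, h.transfer_cur hK h' hi]⟩
      rw [h.transfer_right hK h' hw hi, h4, List.map_cons, List.cons.injEq] at h7
      exact h7.1
    · rw [← hw i hi, hwi] at e; cases e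
    · rw [← hw i hi, hwi] at e; cases e
  have prod : ∀ p, K.IsProduct p → f (K.σ p) = K'.σ (f p) ∧
      f (K.σ (K.σ p)) = K'.σ (K'.σ (f p)) := by
    intro p hp
    obtain ⟨i, hi, h1, hwi, h2, h3, h4⟩ := h.step_product hK hp
    have hfp : (s' (i + 1)).cur = f p := by
      rw [← h2, hf, h.transfer_cur hK h' hi]
    rcases h'.step i hi with ⟨e, -⟩ | ⟨e, -⟩ | ⟨-, -, h5, ⟨x, h6, h7⟩, -⟩
    · rw [← hw i hi, hwi] at e; cases e
    · rw [← hw i hi, hwi] at e; cases e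
    · rw [hfp] at h5 h6
      refine ⟨?_, by rw [← h5, ← h1, hf, h.transfer_α hK h' hK', h.transfer_cur hK h' hi.le]⟩
      rw [h.transfer_left hK h' hw hi.le, h4, List.map_cons, List.cons.injEq] at h7
      rw [← h6, ← h7.1, h.transfer_α hK h' hK', hK'.α_α]
  rcases hK.cases d with ⟨c, hc, rfl | rfl | rfl⟩ | ⟨p, hp, rfl | rfl | rfl⟩
  · exact (cop _ hc).1
  · rw [(cop _ hc).2, (cop _ hc).1]
  · rw [(cop _ hc).2, hK.σ_σ_σ, hK'.σ_σ_σ]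
  · exact (prod _ hp).1
  · rw [(prod _ hp).2, (prod _ hp).1]
  · rw [(prod _ hp).2, hK.σ_σ_σ, hK'.σ_σ_σ]

include h hK h' hK' in
theorem iso (hw : ∀ i < N, w i = w' i) : K.Iso K' :=
  ⟨⟨h.transfer hK h', h'.transfer hK' h, h.transfer_transfer hK h' hK',
      h'.transfer_transfer hK' h hK⟩, h.transfer_σ hK h' hK' hw, h.transfer_α hK h' hK',
    h.out_transfer hK h' hK', by
      change h.transfer hK h' _ = _
      rw [← h.cur_zero, h.transfer_cur hK h' (Nat.zero_le _), h'.cur_zero]⟩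

end IsReading

/-! ## The map determines the word of a reading -/

/-- The half-edge at the upper end of the current wire has only one of the three types, and the type
fixes the next cut. -/
theorem Step.deterministic {r r' : Fin 3} {s t t' : Scan K}
    (h : K.Step r s t) (h' : K.Step r' s t') : r = r' ∧ t = t' := by
  obtain ⟨o, L, R⟩ := s
  obtain ⟨a, l, r⟩ := t
  obtain ⟨a', l', r'⟩ := t'
  simp only [Step, Scan.mk.injEq] at h h' ⊢
  rcases h with ⟨rfl, hc, h1, h2, h3⟩ | ⟨rfl, ⟨p, hp, h1⟩, h2, h3⟩ |
    ⟨rfl, hp, h1, ⟨x, h2, h3⟩, h4⟩ <;>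
  rcases h' with ⟨rfl, hc', h1', h2', h3'⟩ | ⟨rfl, ⟨p', hp', h1'⟩, h2', h3'⟩ |
    ⟨rfl, hp', h1', ⟨x', h2', h3'⟩, h4'⟩
  · exact ⟨rfl, h1.trans h1'.symm, h2.trans h2'.symm, h3.trans h3'.symm⟩
  · exact absurd h1' (hc.ne_σ hp')
  · exact absurd h1' (hc.ne_σ_σ hp')
  · exact absurd h1 (hc'.ne_σ hp)
  · rw [h3, List.cons.injEq] at h3'
    exact ⟨rfl, h3'.1, h2.trans h2'.symm, h3'.2⟩
  · exact absurd (h1.symm.trans h1') (hp.σ_ne_σ_σ hp')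
  · exact absurd h1 (hc'.ne_σ_σ hp)
  · exact absurd (h1'.symm.trans h1) (hp'.σ_ne_σ_σ hp)
  · rw [h3, List.cons.injEq] at h3'
    exact ⟨rfl, K.σ.injective (K.σ.injective (h1.symm.trans h1')), h3'.2, h4.trans h4'.symm⟩

theorem IsReading.word_eq {s' : ℕ → Scan K} (h : K.IsReading N w s) (h' : K.IsReading N w' s') :
    ∀ i < N, w i = w' i := by
  have key : ∀ i ≤ N, s i = s' i := by
    intro i
    induction i with
    | zero => intro _; rw [h.start, h'.start]
    | succ i ih =>
      intro hi
      have h1 := h.step i hi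
      rw [ih (by omega)] at h1
      exact (h1.deterministic (h'.step i hi)).2
  intro i hi
  have h1 := h.step i hi
  rw [key i hi.le] at h1
  exact (h1.deterministic (h'.step i hi)).1

theorem IsReading.map (h : K.IsReading N w s) (f : K.D ≃ K'.D)
    (hσ : ∀ d, f (K.σ d) = K'.σ (f d)) (hα : ∀ d, f (K.α d) = K'.α (f d))
    (hout : ∀ d, K'.out (f d) = K.out d) (hroot : f K.root = K'.root) :
    K'.IsReading N w fun i => ⟨f (s i).cur, (s i).left.map f, (s i).right.map f⟩ := by
  have cop : ∀ c, K.IsCoproduct c → K'.IsCoproduct (f c) := by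
    rintro c ⟨h1, h2, h3, h4, h5⟩
    refine ⟨?_, ?_, ?_, ?_, ?_⟩ <;> simp only [← hσ, hout, h1, h2, h3, h4]
    exact fun e => h5 (f.injective e)
  have prod : ∀ c, K.IsProduct c → K'.IsProduct (f c) := by
    rintro c ⟨h1, h2, h3, h4, h5⟩
    refine ⟨?_, ?_, ?_, ?_, ?_⟩ <;> simp only [← hσ, hout, h1, h2, h3, h4]
    exact fun e => h5 (f.injective e)
  refine ⟨by simp [h.start, hroot], by simp [h.finish, hroot], fun i hi => ?_, fun d hd => ?_,
    fun i hi j hj e => h.inj i hi j hj (f.injective e)⟩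
  · rcases h.step i hi with ⟨e, hc, h1, h2, h3⟩ | ⟨e, ⟨p, hp, h1⟩, h2, h3⟩ |
      ⟨e, hp, h1, ⟨x, h2, h3⟩, h4⟩
    · refine .inl ⟨e, ?_, ?_, ?_, ?_⟩ <;> simp only [← hσ, ← hα]
      · exact cop _ hc
      · rw [h1]
      · rw [h2]
      · rw [h3, List.map_cons]
    · refine .inr (.inl ⟨e, ⟨f p, prod _ hp, ?_⟩, ?_, ?_⟩) <;> simp only [← hσ, ← hα]
      · rw [h1]
      · rw [h2, List.map_cons]
      · rw [h3, List.map_cons]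
    · refine .inr (.inr ⟨e, prod _ hp, ?_, ⟨f x, ?_, ?_⟩, ?_⟩) <;> simp only [← hσ, ← hα]
      · rw [h1]
      · rw [h2]
      · rw [h3, List.map_cons]
      · rw [h4]
  · obtain ⟨i, hi, e⟩ := h.surj (f.symm d) (by rw [← hout, f.apply_symm_apply, hd])
    exact ⟨i, hi, by simp [e]⟩

theorem IsReading.word_eq_of_iso (h : K.IsReading N w s) (h' : K'.IsReading N w' s')
    (hiso : K.Iso K') : ∀ i < N, w i = w' i := by
  obtain ⟨f, h1, h2, h3, h4⟩ := hiso
  exact (h.map f h1 h2 h3 h4).word_eq h'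

/-! ## Rotation -/

theorem rotate_isCoproduct {d : K.D} : K.rotate.IsCoproduct d ↔ K.IsProduct d := by
  change (_ ∧ (!K.out d) = _ ∧ (!K.out _) = _ ∧ (!K.out _) = _ ∧ _) ↔ _
  simp only [Bool.not_eq_false', Bool.not_eq_true']
  rfl

theorem rotate_isProduct {d : K.D} : K.rotate.IsProduct d ↔ K.IsCoproduct d := by
  change (_ ∧ (!K.out d) = _ ∧ (!K.out _) = _ ∧ (!K.out _) = _ ∧ _) ↔ _
  simp only [Bool.not_eq_false', Bool.not_eq_true']
  rfl

theorem IsCubic.rotate (hK : K.IsCubic) : K.rotate.IsCubic where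
  α_α := hK.α_α
  out_α d := congrArg (fun b => !b) (hK.out_α d)
  operators d := by
    obtain ⟨e, h1, h2 | h2⟩ := hK.operators d
    · exact ⟨e, h1, .inr (rotate_isProduct.2 h2)⟩
    · exact ⟨e, h1, .inl (rotate_isCoproduct.2 h2)⟩
  root_product := rotate_isProduct.2 hK.root_coproduct
  root_coproduct := rotate_isCoproduct.2 (by
    change K.IsProduct (K.α (K.α K.root))
    rw [hK.α_α]
    exact hK.root_product)

/-- The cut seen from the other side. -/
def Scan.rotate (s : Scan K) : Scan K.rotate :=
  ⟨K.α s.cur, s.right.map K.α, s.left.map K.α⟩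

/-- Upside down, coproducts become products and pending wires become waiting ones. A waiting wire
must lead to a left input, which is why pending wires are required to be right outputs of
coproducts. -/
theorem Step.rotate (hK : K.IsCubic) {r : Fin 3} {s t : Scan K} (h : K.Step r s t)
    (ht : ∀ x ∈ s.right, ∃ c, K.IsCoproduct c ∧ x = K.σ c) :
    K.rotate.Step r.rev t.rotate s.rotate := by
  rcases h with ⟨rfl, hc, h1, h2, h3⟩ | ⟨rfl, ⟨p, hp, h1⟩, h2, h3⟩ |
      ⟨rfl, hp, h1, ⟨x, h2, h3⟩, h4⟩
  · refine .inr (.inr ⟨rfl, rotate_isProduct.2 hc, ?_, ⟨K.α (K.σ (K.α s.cur)), hK.α_α _, ?_⟩, ?_⟩)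
    · change K.α (K.α t.cur) = K.σ (K.σ (K.α s.cur))
      rw [hK.α_α, h1]
    · change t.right.map K.α = _ :: s.right.map K.α
      rw [h3, List.map_cons]
    · change s.left.map K.α = t.left.map K.α
      rw [h2]
  · obtain ⟨c, hc, h4⟩ := ht t.cur (by rw [h3]; simp)
    refine .inr (.inl ⟨rfl, ⟨c, rotate_isProduct.2 hc, ?_⟩, ?_, ?_⟩)
    · change K.α (K.α t.cur) = K.σ c
      rw [hK.α_α, h4]
    · change s.right.map K.α = K.α t.cur :: t.right.map K.α
      rw [h3, List.map_cons]
    · change t.left.map K.α = K.α s.cur :: s.left.map K.α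
      rw [h2, List.map_cons]
  · have e : K.rotate.α t.rotate.cur = t.cur := hK.α_α _
    refine .inl ⟨rfl, ?_, ?_, ?_, ?_⟩
    · rw [e]
      exact rotate_isCoproduct.2 hp
    · rw [e]
      exact h1
    · change s.right.map K.α = t.right.map K.α
      rw [h4]
    · rw [e]
      change s.left.map K.α = K.σ t.cur :: t.left.map K.α
      rw [h3, List.map_cons, h2]

theorem IsReading.rotate (h : K.IsReading N w s) (hK : K.IsCubic) :
    K.rotate.IsReading N (fun i => (w (N - 1 - i)).rev) fun i => (s (N - i)).rotate where
  start := by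
    simp only [Nat.sub_zero, h.finish]
    rfl
  finish := by
    simp only [Nat.sub_self, h.start]
    rfl
  step i hi := by
    have hstep := h.step (N - 1 - i) (by omega)
    rw [show N - 1 - i + 1 = N - i by omega] at hstep
    rw [show N - (i + 1) = N - 1 - i by omega]
    refine hstep.rotate hK fun x hx => ?_
    obtain ⟨j, -, hc, hx, -⟩ := mem_right_past h.step h.right_zero (by omega) hx
    exact ⟨_, hc, hx⟩
  surj (d : K.D) hd := by
    obtain ⟨i, hi, e⟩ := h.surj (K.α d) ((hK.out_α d).trans hd)
    rcases i with _ | i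
    -- The wire of time 0 keeps time 0, because the root is also current in the last cut; a wire of
    -- time `i > 0` gets time `N - i`.
    · refine ⟨0, hi, ?_⟩
      change K.α (s N).cur = d
      rw [h.cur_last, ← h.cur_zero, e, hK.α_α]
    · refine ⟨N - (i + 1), by omega, ?_⟩
      change K.α (s (N - (N - (i + 1)))).cur = d
      rw [show N - (N - (i + 1)) = i + 1 by omega, e, hK.α_α]
  inj i hi j hj e := by
    have e : (s (N - i)).cur = (s (N - j)).cur := K.α.injective e
    rcases Nat.eq_zero_or_pos i with rfl | hi0 <;> rcases Nat.eq_zero_or_pos j with rfl | hj0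
    · rfl
    · rw [Nat.sub_zero, h.cur_last, ← h.cur_zero] at e
      have := h.inj _ (by omega) _ (by omega) e
      omega
    · rw [Nat.sub_zero, h.cur_last, ← h.cur_zero] at e
      have := h.inj _ (by omega) _ (by omega) e
      omega
    · have := h.inj _ (by omega) _ (by omega) e
      omega

end RootedData

namespace PrographData

/-- The prograph with its output connected to its input. -/
abbrev closed (M : PrographData) : RootedData where
  D := M.D
  σ := M.σ
  α := M.α * swap M.inLeg M.outLeg
  out := M.out
  root := M.outLeg

variable {M : PrographData}

theorem closed_α_apply (M : PrographData) (d : M.D) :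
    M.closed.α d = M.α (swap M.inLeg M.outLeg d) := rfl

theorem closed_α_of_ne {d : M.D} (h1 : d ≠ M.inLeg) (h2 : d ≠ M.outLeg) :
    M.closed.α d = M.α d := by
  rw [closed_α_apply, swap_apply_of_ne_of_ne h1 h2]

/-- The input and the output are unconnected. -/
structure HasLegs (M : PrographData) : Prop where
  inLeg : M.α M.inLeg = M.inLeg
  outLeg : M.α M.outLeg = M.outLeg

theorem HasLegs.closed_α_outLeg (hM : M.HasLegs) : M.closed.α M.outLeg = M.inLeg := by
  rw [closed_α_apply, swap_apply_right, hM.inLeg]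

theorem HasLegs.closed_α_inLeg (hM : M.HasLegs) : M.closed.α M.inLeg = M.outLeg := by
  rw [closed_α_apply, swap_apply_left, hM.outLeg]

theorem α_ne_of_isCubic (hK : M.closed.IsCubic) {d : M.D} (h1 : d ≠ M.inLeg)
    (h2 : d ≠ M.outLeg) : M.α d ≠ d := by
  rw [← closed_α_of_ne h1 h2]
  exact hK.α_ne d

theorem HasLegs.α_ne_iff (hM : M.HasLegs) (hK : M.closed.IsCubic) {d : M.D} :
    M.α d ≠ d ↔ d ≠ M.inLeg ∧ d ≠ M.outLeg := by
  refine ⟨fun h => ⟨?_, ?_⟩, fun h => α_ne_of_isCubic hK h.1 h.2⟩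
  · rintro rfl; exact h hM.inLeg
  · rintro rfl; exact h hM.outLeg

theorem HasLegs.α_α (hM : M.HasLegs) (hK : M.closed.IsCubic) (d : M.D) : M.α (M.α d) = d := by
  by_cases h1 : d = M.inLeg
  · rw [h1, hM.inLeg, hM.inLeg]
  by_cases h2 : d = M.outLeg
  · rw [h2, hM.outLeg, hM.outLeg]
  have h3 : M.α d ≠ M.inLeg := fun e => h1 (M.α.injective (e.trans hM.inLeg.symm))
  have h4 : M.α d ≠ M.outLeg := fun e => h2 (M.α.injective (e.trans hM.outLeg.symm))
  rw [← closed_α_of_ne h3 h4, ← closed_α_of_ne h1 h2]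
  exact hK.α_α d

/-- A face away from the root edge is bounded by genuine edges of the prograph. If they all had the
same direction, its boundary would be a directed cycle, followed forwards or backwards. -/
theorem HasLegs.bothDirections (hM : M.HasLegs) (hK : M.closed.IsCubic) (hacyc : M.Acyclic) :
    M.closed.BothDirections := by
  intro d h1 h2
  have hne : ∀ e : M.D, M.closed.φ.SameCycle d e → e ≠ M.inLeg ∧ e ≠ M.outLeg := fun e he =>
    ⟨fun e' => h2 (by
      change M.closed.φ.SameCycle d (M.closed.α M.outLeg)
      rwa [hM.closed_α_outLeg, ← e']), fun e' => h1 (by subst e'; exact he)⟩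
  have hcyc : ∀ i : ℕ, M.closed.φ.SameCycle d ((M.closed.φ ^ i) d) := fun i => ⟨i, by simp⟩
  have hφ : ∀ i : ℕ, (M.closed.φ ^ (i + 1)) d = M.closed.φ ((M.closed.φ ^ i) d) := fun i => by
    rw [pow_succ', Perm.mul_apply]
  have hσ : ∀ e : M.D, M.σ.SameCycle (M.closed.α e) (M.closed.φ e) := fun e => ⟨-1, by simp; rfl⟩
  obtain ⟨m, hm⟩ : ∃ m, orderOf M.closed.φ = m + 1 := ⟨orderOf M.closed.φ - 1, by
    have := orderOf_pos M.closed.φ; omega⟩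
  have hclose : (M.closed.φ ^ (m + 1)) d = d := by rw [← hm, pow_orderOf_eq_one]; rfl
  constructor
  · by_contra! hcon
    have key : ∀ i : ℕ, Relation.TransGen M.Arc ((M.closed.φ ^ (i + 1)) d) d := by
      have one : ∀ i : ℕ, M.Arc ((M.closed.φ ^ (i + 1)) d) ((M.closed.φ ^ i) d) := fun i => by
        have hin : M.closed.out ((M.closed.φ ^ i) d) = false := by simpa using hcon _ (hcyc i)
        obtain ⟨n1, n2⟩ := hne _ (hcyc i)
        rw [hφ]
        refine ⟨M.closed.α ((M.closed.φ ^ i) d), (hK.out_α _).trans (by rw [hin]; rfl), ?_,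
          (hσ _).symm, ?_⟩
        · rw [closed_α_of_ne n1 n2, hM.α_α hK]
          exact (α_ne_of_isCubic hK n1 n2).symm
        · rw [closed_α_of_ne n1 n2, hM.α_α hK]
      intro i
      induction i with
      | zero => exact .single (one 0)
      | succ i ih => exact .head (one (i + 1)) ih
    have := key m
    rw [hclose] at this
    exact hacyc d this
  · by_contra! hcon
    have key : ∀ i : ℕ, Relation.TransGen M.Arc d ((M.closed.φ ^ (i + 1)) d) := by
      have one : ∀ i : ℕ, M.Arc ((M.closed.φ ^ i) d) ((M.closed.φ ^ (i + 1)) d) := fun i => by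
        obtain ⟨n1, n2⟩ := hne _ (hcyc i)
        refine ⟨(M.closed.φ ^ i) d, by simpa using hcon _ (hcyc i), α_ne_of_isCubic hK n1 n2,
          Perm.SameCycle.refl _ _, ?_⟩
        rw [← closed_α_of_ne n1 n2, hφ]
        exact hσ _
      intro i
      induction i with
      | zero => exact .single (one 0)
      | succ i ih => exact .tail ih (one (i + 1))
    have := key m
    rw [hclose] at this
    exact hacyc d this

/-! ## PC prographs have a reading -/

namespace IsPCPrograph

variable {n : ℕ} (hM : M.IsPCPrograph n)
include hM

theorem hasLegs : M.HasLegs :=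
  ⟨((hM.inLeg_iff _).2 rfl).1, ((hM.outLeg_iff _).2 rfl).1⟩

theorem isCubic : M.closed.IsCubic where
  α_α d := by
    by_cases h1 : d = M.inLeg
    · rw [h1, hM.hasLegs.closed_α_inLeg, hM.hasLegs.closed_α_outLeg]
    by_cases h2 : d = M.outLeg
    · rw [h2, hM.hasLegs.closed_α_outLeg, hM.hasLegs.closed_α_inLeg]
    have h3 : M.α d ≠ M.inLeg := fun e => h1 (M.α.injective (e.trans hM.hasLegs.inLeg.symm))
    have h4 : M.α d ≠ M.outLeg := fun e => h2 (M.α.injective (e.trans hM.hasLegs.outLeg.symm))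
    rw [closed_α_of_ne h1 h2, closed_α_of_ne h3 h4]
    exact hM.wellFormed.1 d
  out_α d := by
    have e1 : M.out M.inLeg = false := ((hM.inLeg_iff _).2 rfl).2
    have e2 : M.out M.outLeg = true := ((hM.outLeg_iff _).2 rfl).2
    change M.out (M.closed.α d) = !(M.out d)
    by_cases h1 : d = M.inLeg
    · rw [h1, hM.hasLegs.closed_α_inLeg, e1, e2]; rfl
    by_cases h2 : d = M.outLeg
    · rw [h2, hM.hasLegs.closed_α_outLeg, e1, e2]; rfl
    rw [closed_α_of_ne h1 h2]
    refine hM.wellFormed.2 d fun e => ?_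
    cases hd : M.out d
    · exact h1 ((hM.inLeg_iff d).1 ⟨e, hd⟩)
    · exact h2 ((hM.outLeg_iff d).1 ⟨e, hd⟩)
  operators := hM.operators
  root_product := hM.outLeg_product
  root_coproduct := by
    change M.closed.IsCoproduct (M.closed.α M.outLeg)
    rw [hM.hasLegs.closed_α_outLeg]
    exact hM.inLeg_coproduct

theorem connected_closed : M.closed.Connected := by
  intro x y
  have h := hM.connected x y
  induction h with
  | rel x y h =>
    rcases h with rfl | rfl
    · exact .rel _ _ (.inl rfl)
    · by_cases h1 : x = M.inLeg
      · rw [h1, hM.hasLegs.inLeg]; exact .refl _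
      by_cases h2 : x = M.outLeg
      · rw [h2, hM.hasLegs.outLeg]; exact .refl _
      exact .rel _ _ (.inr (closed_α_of_ne h1 h2).symm)
  | refl x => exact .refl x
  | symm x y _ ih => exact .symm _ _ ih
  | trans x y z _ _ ih1 ih2 => exact .trans _ _ _ ih1 ih2

theorem card_eq : Nat.card M.D = 6 * n := hM.isCubic.card_eq n hM.size

theorem exists_reading : ∃ w s, M.closed.IsReading (3 * n) w s := by
  have hE := hM.isCubic.numEdges_eq n hM.card_eq
  have hF : M.closed.numFaces = n + 2 := by
    have h1 := hM.planar
    have h2 := hM.size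
    change M.numVertices + M.closed.numFaces = M.closed.numEdges + 2 at h1
    omega
  obtain ⟨N, w, s, h⟩ := hM.isCubic.exists_reading
    (hM.isCubic.faceCorners (hM.hasLegs.bothDirections hM.isCubic hM.acyclic) hM.size hF)
    hM.connected_closed
  have h1 := h.card_eq hM.isCubic
  have h2 := hM.card_eq
  change Nat.card M.D = _ at h1
  obtain rfl : N = 3 * n := by omega
  exact ⟨w, s, h⟩

end IsPCPrograph

/-! ## Maps with a reading -/

section Reading

variable {n N : ℕ} {w : ℕ → Fin 3} {s : ℕ → RootedData.Scan M.closed}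
  (hM : M.HasLegs) (hK : M.closed.IsCubic) (h : M.closed.IsReading N w s)
include hM hK h

theorem height_lt_of_arc {x y : M.D} (hxy : M.Arc x y) : h.height hK x < h.height hK y := by
  obtain ⟨d, h1, h2, h3, h4⟩ := hxy
  obtain ⟨n1, n2⟩ := (hM.α_ne_iff hK).1 h2
  rw [h.height_eq_of_sameCycle hK (show M.closed.σ.SameCycle x d from h3),
    ← h.height_eq_of_sameCycle hK (show M.closed.σ.SameCycle _ y from h4), ← closed_α_of_ne n1 n2]
  exact h.height_lt_height_α hK h1 n2

theorem acyclic_of_reading : M.Acyclic := by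
  have key : ∀ x y, Relation.TransGen M.Arc x y → h.height hK x < h.height hK y := by
    intro x y hxy
    induction hxy with
    | single hxy => exact height_lt_of_arc hM hK h hxy
    | tail _ hyz ih => exact ih.trans (height_lt_of_arc hM hK h hyz)
  exact fun x hx => (key x x hx).false

/-- Descend along inputs: every input half-edge other than the input leg is joined to an operator of
smaller height, so every descent ends at the leg without using the root edge. -/
theorem connected_of_reading : M.Connected := by
  have key : ∀ m, ∀ d : M.D, h.height hK d < m →
      Relation.EqvGen (fun a b => b = M.σ a ∨ b = M.α a) M.inLeg d := by
    intro m
    induction m with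
    | zero => intro d hd; omega
    | succ m ih =>
      intro d hd
      have input : ∀ x : M.D, M.out x = false → h.height hK x < m + 1 →
          Relation.EqvGen (fun a b => b = M.σ a ∨ b = M.α a) M.inLeg x := by
        intro x hx hlt
        by_cases h1 : x = M.inLeg
        · rw [h1]; exact .refl _
        have h2 : x ≠ M.outLeg := by
          rintro rfl
          have : M.out M.outLeg = true := hK.root_product.2.1
          rw [hx] at this
          cases this
        have h3 : M.α x ≠ M.outLeg := fun e => h2 (M.α.injective (e.trans hM.outLeg.symm))
        have h4 := h.height_lt_height_α hK (d := M.α x) (by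
          rw [← closed_α_of_ne h1 h2, hK.out_α]
          exact congrArg (fun b => !b) hx) h3
        rw [← closed_α_of_ne h1 h2, hK.α_α, closed_α_of_ne h1 h2] at h4
        exact .trans _ _ _ (ih (M.α x) (by omega)) (.rel _ _ (.inr (hM.α_α hK x).symm))
      have step : ∀ x : M.D, Relation.EqvGen (fun a b => b = M.σ a ∨ b = M.α a) x (M.σ x) :=
        fun x => .rel _ _ (.inl rfl)
      rcases hK.cases d with ⟨c, hc, hd'⟩ | ⟨p, hp, hd'⟩
      · have hlt : h.height hK c < m + 1 := by
          rcases hd' with rfl | rfl | rfl <;> simpa only [h.height_σ] using hd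
        have hc' := input c hc.2.1 hlt
        rcases hd' with rfl | rfl | rfl
        · exact hc'
        · exact hc'.trans _ _ _ (step _)
        · exact (hc'.trans _ _ _ (step _)).trans _ _ _ (step _)
      · have hlt : h.height hK (M.closed.σ p) < m + 1 := by
          rcases hd' with rfl | rfl | rfl <;> simpa only [h.height_σ] using hd
        have hp' := input (M.closed.σ p) hp.2.2.1 hlt
        rcases hd' with rfl | rfl | rfl
        · have := (hp'.trans _ _ _ (step _)).trans _ _ _ (step _)
          have e : M.σ (M.σ (M.closed.σ d)) = d := hp.1
          rwa [e] at this
        · exact hp'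
        · exact hp'.trans _ _ _ (step _)
  intro x y
  exact (Relation.EqvGen.symm _ _ (key _ x (Nat.lt_succ_self _))).trans _ _ _
    (key _ y (Nat.lt_succ_self _))

/-- Labels bound the number of faces from below and corners bound it from above, both by the number
of coproducts plus 2 and by the number of products plus 2. So there are equally many of each, namely
`n`. -/
theorem numFaces_of_reading (hn : Nat.card M.D = 6 * n) : M.closed.numFaces = n + 2 := by
  have h1 := h.card_coproducts_add_two_le hK
  have h2 := h.card_products_add_two_le hK
  have hb := hM.bothDirections hK (acyclic_of_reading hM hK h)
  let m : M.closed.D → Quotient (Perm.SameCycle.setoid M.closed.φ) := Quotient.mk _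
  have hm : ∀ x y, m x = m y ↔ M.closed.φ.SameCycle x y := fun x y => Quotient.eq
  have h3 := hK.card_operators
  rw [hK.numVertices_eq n hn] at h3
  have h4 := (card_le_of_surjective_off_pair
    (fun c : {c // M.closed.IsCoproduct c} => m (M.closed.σ c))
    (m M.closed.root) (m (M.closed.α M.closed.root))
    (fun b => Quotient.inductionOn b fun d h1 h2 => by
      obtain ⟨c, hc, h⟩ := (hK.exists_corners hb (mt (hm _ _).2 h1) (mt (hm _ _).2 h2)).1
      exact ⟨⟨c, hc⟩, (hm _ _).2 h.symm⟩)).1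
  have h5 := (card_le_of_surjective_off_pair
    (fun p : {p // M.closed.IsProduct p} => m (M.closed.σ p))
    (m M.closed.root) (m (M.closed.α M.closed.root))
    (fun b => Quotient.inductionOn b fun d h1 h2 => by
      obtain ⟨p, hp, h⟩ := (hK.exists_corners hb (mt (hm _ _).2 h1) (mt (hm _ _).2 h2)).2
      exact ⟨⟨p, hp⟩, (hm _ _).2 h.symm⟩)).1
  change M.closed.numFaces ≤ _ at h4 h5
  omega

theorem isPCPrograph_of_reading (hn : Nat.card M.D = 6 * n) : M.IsPCPrograph n where
  wellFormed := ⟨hM.α_α hK, fun d hd => by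
    obtain ⟨n1, n2⟩ := (hM.α_ne_iff hK).1 hd
    rw [← closed_α_of_ne n1 n2]
    exact hK.out_α d⟩
  operators := hK.operators
  inLeg_iff d := by
    have e1 : M.out M.inLeg = false := by
      rw [← hM.closed_α_outLeg]; exact hK.root_coproduct.2.1
    have e2 : M.out M.outLeg = true := hK.root_product.2.1
    refine ⟨fun ⟨h1, h2⟩ => ?_, ?_⟩
    · by_contra h3
      refine α_ne_of_isCubic hK h3 ?_ h1
      rintro rfl
      rw [e2] at h2; cases h2
    · rintro rfl
      exact ⟨hM.inLeg, e1⟩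
  outLeg_iff d := by
    have e1 : M.out M.inLeg = false := by
      rw [← hM.closed_α_outLeg]; exact hK.root_coproduct.2.1
    have e2 : M.out M.outLeg = true := hK.root_product.2.1
    refine ⟨fun ⟨h1, h2⟩ => ?_, ?_⟩
    · by_contra h3
      refine α_ne_of_isCubic hK ?_ h3 h1
      rintro rfl
      rw [e1] at h2; cases h2
    · rintro rfl
      exact ⟨hM.outLeg, e2⟩
  inLeg_coproduct := by
    rw [← hM.closed_α_outLeg]; exact hK.root_coproduct
  outLeg_product := hK.root_product
  connected := connected_of_reading hM hK h
  acyclic := acyclic_of_reading hM hK h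
  planar := by
    have h1 := numFaces_of_reading hM hK h hn
    have h2 := hK.numVertices_eq n hn
    have h3 := hK.numEdges_eq n hn
    change M.closed.numVertices + M.closed.numFaces = M.closed.numEdges + 2
    omega
  size := hK.numVertices_eq n hn

end Reading

/-! ## The dual of a PC prograph -/

theorem IsPCPrograph.dual_isBipolarTriangulation {n : ℕ} (hM : M.IsPCPrograph n) :
    M.dual.IsBipolarTriangulation n := by
  have hK := hM.isCubic
  obtain ⟨w, s, h⟩ := hM.exists_reading
  have hF := numFaces_of_reading hM.hasLegs hK h hM.card_eq
  have hb := hM.hasLegs.bothDirections hK hM.acyclic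
  -- The face permutation of the dual. It is conjugate to `σ` by `α`, so the dual faces are
  -- triangles because the operators have three half-edges.
  let f : Perm M.D := M.closed.φ⁻¹ * M.closed.α
  have hf : ∀ d, f d = M.closed.α (M.closed.σ (M.closed.α d)) := fun d => by
    change (M.closed.φ)⁻¹ (M.closed.α d) = _
    rw [Perm.inv_eq_iff_eq, hK.φ_apply, hK.α_α, hK.σ_σ_σ]
  have htri : ∀ d, f (f (f d)) = d := fun d => by
    rw [hf, hf, hf, hK.α_α, hK.α_α, hK.σ_σ_σ, hK.α_α]
  have hne : ∀ d, f d ≠ d := fun d e => by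
    rw [hf, hK.α_eq_iff] at e
    exact hK.σ_ne _ e
  have hsize : M.dual.numFaces = 2 * n := by
    have h1 := card_eq_three_mul f htri hne
    have h2 := hM.card_eq
    change Nat.card M.D = 3 * M.dual.numFaces at h1
    omega
  have hroot : ∀ d : M.D, M.dual.IsSource d → M.closed.φ.SameCycle M.outLeg d := by
    intro d hd
    by_contra h1
    by_cases h2 : M.closed.φ.SameCycle d (M.closed.α M.outLeg)
    · have e1 : M.closed.out (M.closed.α M.outLeg) = true := hd _ h2
      rw [hK.root_coproduct.2.1] at e1
      cases e1
    · obtain ⟨-, e, he, he'⟩ := hb d (fun e => h1 e.symm) h2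
      have e1 : M.closed.out e = true := hd e he
      rw [he'] at e1
      cases e1
  have hroot' : ∀ d : M.D, M.dual.IsSink d → M.closed.φ.SameCycle (M.closed.α M.outLeg) d := by
    intro d hd
    by_contra h1
    by_cases h2 : M.closed.φ.SameCycle d M.outLeg
    · have e1 : M.closed.out M.outLeg = false := hd _ h2
      rw [hK.root_product.2.1] at e1
      cases e1
    · obtain ⟨⟨e, he, he'⟩, -⟩ := hb d h2 (fun e => h1 e.symm)
      have e1 : M.closed.out e = false := hd e he
      rw [he'] at e1
      cases e1
  constructor
  · exact ⟨hK.α_α, fun d _ => hK.out_α d⟩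
  · exact hK.α_ne
  · have hα' : ∀ x : M.D, Relation.EqvGen (fun a b => b = M.dual.σ a ∨ b = M.dual.α a) x
        (M.closed.α x) := fun x => .rel _ _ (.inr rfl)
    have hσ' : ∀ x : M.D, Relation.EqvGen (fun a b => b = M.dual.σ a ∨ b = M.dual.α a) x
        (M.closed.σ x) := fun x => by
      have h1 : Relation.EqvGen (fun a b => b = M.dual.σ a ∨ b = M.dual.α a)
          (M.closed.α (M.closed.σ x)) (M.closed.φ (M.closed.α (M.closed.σ x))) :=
        .rel _ _ (.inl rfl)
      rw [hK.φ_apply, hK.α_α, hK.σ_σ_σ] at h1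
      exact ((hα' (M.closed.σ x)).trans _ _ _ h1).symm
    intro x y
    have h1 := hM.connected_closed x y
    induction h1 with
    | rel x y h =>
      rcases h with rfl | rfl
      · exact hσ' x
      · exact hα' x
    | refl x => exact .refl x
    | symm x y _ ih => exact .symm _ _ ih
    | trans x y z _ _ ih1 ih2 => exact .trans _ _ _ ih1 ih2
  · have h3 := hK.numEdges_eq n hM.card_eq
    change M.closed.numFaces + M.dual.numFaces = M.closed.numEdges + 2
    omega
  · exact fun d => ⟨hne d, htri d⟩
  · have one : ∀ x y : M.D, M.dual.Arc x y → h.label hK x < h.label hK y := by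
      rintro x y ⟨d, h1, -, h3, h4⟩
      rw [h.label_eq_of_sameCycle hK (show M.closed.φ.SameCycle x d from h3),
        ← h.label_eq_of_sameCycle hK (show M.closed.φ.SameCycle (M.closed.α d) y from h4)]
      exact h.label_lt_label_α hK h1
    have key : ∀ x y, Relation.TransGen M.dual.Arc x y → h.label hK x < h.label hK y := by
      intro x y hxy
      induction hxy with
      | single hxy => exact one _ _ hxy
      | tail _ hyz ih => exact ih.trans (one _ _ hyz)
    exact fun x hx => (key x x hx).false
  -- The face of the root has label 0, so no edge can arrive there from a smaller label.
  · refine fun (d : M.D) => ⟨hroot d, fun hd (e : M.D) he => ?_⟩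
    have h1 : h.label hK e = 0 := by
      rw [← h.label_root hK]
      exact h.label_eq_of_sameCycle hK (Perm.SameCycle.symm (hd.trans he))
    by_contra h2
    have h3 : M.closed.out e = false := Bool.eq_false_iff.2 h2
    have h4 := h.label_lt_label_α hK (d := M.closed.α e) (by rw [hK.out_α, h3]; rfl)
    rw [hK.α_α, h1] at h4
    omega
  · refine fun (d : M.D) => ⟨hroot' d, fun hd (e : M.D) he => ?_⟩
    have h1 : h.label hK e = 3 * n + 1 := by
      rw [← h.label_α_root hK]
      exact h.label_eq_of_sameCycle hK (Perm.SameCycle.symm (hd.trans he))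
    by_contra h2
    have h3 : M.closed.out e = true := Bool.not_eq_false _ ▸ h2
    have h4 := h.leftLabel_le hK (h.time_lt hK e).le
    have h5 := h.time_lt hK e
    rw [RootedData.IsReading.label, if_pos h3] at h1
    omega
  · exact hsize

end PrographData

/-- A list of `N` wires that covers all `N` wires has no repetition, by counting half-edges. -/
theorem RootedData.injOn_of_surj {K : RootedData} (hK : K.IsCubic) {N : ℕ}
    (hN : Nat.card K.D = 2 * N) (c : ℕ → K.D) (hc : ∀ d, K.out d = true → ∃ i < N, c i = d) :
    ∀ i < N, ∀ j < N, c i = c j → i = j := by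
  have hs : Function.Surjective fun x : Fin N × Bool => if x.2 then c x.1 else K.α (c x.1) := by
    intro d
    cases hd : K.out d
    · obtain ⟨i, hi, e⟩ := hc (K.α d) (by rw [hK.out_α, hd]; rfl)
      exact ⟨(⟨i, hi⟩, false), by simp [e, hK.α_α]⟩
    · obtain ⟨i, hi, e⟩ := hc d hd
      exact ⟨(⟨i, hi⟩, true), by simp [e]⟩
  have hb := hs.bijective_of_nat_card_le (by rw [hN]; simp [mul_comm])
  intro i hi j hj e
  have := hb.1 (a₁ := (⟨i, hi⟩, true)) (a₂ := (⟨j, hj⟩, true)) (by simp [e])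
  simpa using this

theorem mul_swap_apply_left {D : Type*} [DecidableEq D] {g : Perm D} {a b : D} (hb : g b = b) :
    (g * swap a b) a = b := by
  rw [Perm.mul_apply, swap_apply_left, hb]

theorem mul_swap_apply_right {D : Type*} [DecidableEq D] {g : Perm D} {a b : D} (ha : g a = a) :
    (g * swap a b) b = a := by
  rw [Perm.mul_apply, swap_apply_right, ha]

theorem mul_swap_apply_of_ne {D : Type*} [DecidableEq D] {g : Perm D} {a b x : D} (ha : x ≠ a)
    (hb : x ≠ b) : (g * swap a b) x = g x := by
  rw [Perm.mul_apply, swap_apply_of_ne_of_ne ha hb]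

/-- Gluing two unconnected half-edges of opposite directions. -/
theorem mul_swap_involutive {D : Type*} [DecidableEq D] {g : Perm D} {a b : D}
    (hg : ∀ x, g (g x) = x) (ha : g a = a) (hb : g b = b) (x : D) :
    (g * swap a b) ((g * swap a b) x) = x := by
  by_cases h1 : x = a
  · rw [h1, mul_swap_apply_left hb, mul_swap_apply_right ha]
  by_cases h2 : x = b
  · rw [h2, mul_swap_apply_right ha, mul_swap_apply_left hb]
  have h3 : g x ≠ a := fun e => h1 (by rw [← hg x, e, ha])
  have h4 : g x ≠ b := fun e => h2 (by rw [← hg x, e, hb])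
  rw [mul_swap_apply_of_ne h1 h2, mul_swap_apply_of_ne h3 h4, hg]

/-! ## Operators glued together -/

/-- The directions of the half-edges of coproducts and products. -/
abbrev Half.out {n : ℕ} : Half n → Bool := fun d => match d with
  | (Sum.inl _, s) => s != 0
  | (Sum.inr _, s) => s == 0

/-- Coproducts and products glued along a permutation. -/
abbrev glued (n : ℕ) [NeZero n] (g : Perm (Half n)) : PrographData where
  D := Half n
  σ := (Equiv.refl _).prodCongr (Equiv.addRight 1)
  α := g
  out := Half.out
  inLeg := copIn 0
  outLeg := prodOut (Fin.rev 0)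

section Glued

variable {n : ℕ} [NeZero n] {g : Perm (Half n)}

theorem glued_isCoproduct (k : Fin n) : (glued n g).IsCoproduct (copIn k) :=
  ⟨Prod.ext rfl (by simp [copIn]), rfl, rfl, rfl, by simp [copIn]⟩

theorem glued_isProduct (k : Fin n) : (glued n g).IsProduct (prodOut k) :=
  ⟨Prod.ext rfl (by simp [prodOut]), rfl, rfl, rfl, by simp [prodOut]⟩

theorem glued_operators (d : Half n) : ∃ e, (glued n g).σ.SameCycle d e ∧
    ((glued n g).IsCoproduct e ∨ (glued n g).IsProduct e) := by
  have h : ∀ (x : Fin n ⊕ Fin n) (i : Fin 3), (glued n g).σ.SameCycle (x, i) (x, 0) := by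
    intro x i
    fin_cases i
    · exact Perm.SameCycle.refl _ _
    · exact ((sameCycle_apply (glued n g).σ (x, 0))).symm
    · exact sameCycle_apply (glued n g).σ (x, 2)
  obtain ⟨k | k, i⟩ := d
  · exact ⟨copIn k, h _ i, .inl (glued_isCoproduct k)⟩
  · exact ⟨prodOut k, h _ i, .inr (glued_isProduct k)⟩

theorem glued_card : Nat.card (glued n g).D = 6 * n := by
  simp
  omega

omit [NeZero n] in
theorem half_out_cases {d : Half n} (hd : d.out = true) :
    ∃ k, d = copLeft k ∨ d = copRight k ∨ d = prodOut k := by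
  obtain ⟨k | k, i⟩ := d
  · refine ⟨k, ?_⟩
    fin_cases i
    · simp [Half.out] at hd
    · exact .inr (.inl rfl)
    · exact .inl rfl
  · refine ⟨k, ?_⟩
    fin_cases i
    · exact .inr (.inr rfl)
    · simp [Half.out] at hd
    · simp [Half.out] at hd

end Glued

/-! ## Words of tableaux -/

theorem fin_three_cases : ∀ r : Fin 3, r = 0 ∨ r = 1 ∨ r = 2 := by decide

namespace Tableau

variable {n : ℕ} (T : Tableau n)

/-- The row of the entry `i + 1`. -/
def word (i : ℕ) : Fin 3 := if h : i < 3 * n then (T.entry.symm ⟨i, h⟩).1 else 0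

/-- The number of entries of row `r` among the `i` smallest ones. -/
def count (r : Fin 3) (i : ℕ) : ℕ := (Finset.univ.filter fun k => (T.entry (r, k) : ℕ) < i).card

variable {T}

theorem word_entry (r : Fin 3) (k : Fin n) : T.word (T.entry (r, k)) = r := by
  simp [word]

theorem count_zero (r : Fin 3) : T.count r 0 = 0 := by simp [count]

theorem count_last (r : Fin 3) : T.count r (3 * n) = n := by simp [count]

theorem count_succ_entry (r : Fin 3) (k : Fin n) :
    T.count r (T.entry (r, k) + 1) = T.count r (T.entry (r, k)) + 1 := by
  unfold count
  rw [← Finset.card_insert_of_notMem (a := k) (by simp)]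
  congr 1
  ext l
  simp only [Finset.mem_filter, Finset.mem_univ, true_and, Finset.mem_insert]
  rw [Nat.lt_succ_iff_lt_or_eq, or_comm, ← Fin.ext_iff, T.entry.injective.eq_iff]
  simp

theorem count_succ_entry_of_ne {r r' : Fin 3} (hr : r' ≠ r) (k : Fin n) :
    T.count r' (T.entry (r, k) + 1) = T.count r' (T.entry (r, k)) := by
  unfold count
  congr 1
  ext l
  simp only [Finset.mem_filter, Finset.mem_univ, true_and]
  rw [Nat.lt_succ_iff_lt_or_eq, ← Fin.ext_iff, T.entry.injective.eq_iff]
  simp [hr]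

/-- The ballot property, which comes from the increasing columns. -/
theorem count_antitone (i : ℕ) {r r' : Fin 3} (hr : r < r') : T.count r' i ≤ T.count r i := by
  refine Finset.card_le_card fun k => ?_
  simp only [Finset.mem_filter, Finset.mem_univ, true_and]
  exact lt_trans (T.col_lt k hr)

theorem exists_entry_eq {i : ℕ} (hi : i < 3 * n) : ∃ r k, i = (T.entry (r, k) : ℕ) :=
  ⟨(T.entry.symm ⟨i, hi⟩).1, (T.entry.symm ⟨i, hi⟩).2, by simp⟩

theorem entry_zero [NeZero n] : (T.entry (0, 0) : ℕ) = 0 := by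
  obtain ⟨r, k, h⟩ := T.exists_entry_eq (i := 0) (by have := NeZero.pos n; omega)
  have h1 : T.entry (0, 0) ≤ T.entry (0, k) := (T.row_lt 0).monotone (Fin.zero_le k)
  have h2 : T.entry (0, k) ≤ T.entry (r, k) := (T.col_lt k).monotone (Fin.zero_le r)
  have := Fin.le_def.1 (h1.trans h2)
  omega

theorem entry_last [NeZero n] : (T.entry (2, Fin.rev 0) : ℕ) + 1 = 3 * n := by
  obtain ⟨r, k, h⟩ := T.exists_entry_eq (i := 3 * n - 1) (by have := NeZero.pos n; omega)
  have h1 : T.entry (2, k) ≤ T.entry (2, Fin.rev 0) := (T.row_lt 2).monotone (by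
    rw [← Fin.rev_rev k]
    exact Fin.rev_le_rev.2 (Fin.zero_le _))
  have h2 : T.entry (r, k) ≤ T.entry (2, k) := (T.col_lt k).monotone (Fin.le_last r)
  have := Fin.le_def.1 (h2.trans h1)
  have := (T.entry (2, Fin.rev 0)).2
  omega

/-- The time at which an operator is created. -/
def opTime (T : Tableau n) : Fin n ⊕ Fin n → ℕ :=
  Sum.elim (fun k => T.entry (0, k)) fun k => T.entry (2, k)

theorem opTime_injective : T.opTime.Injective := by
  have key : ∀ {x y}, (T.entry x : ℕ) = T.entry y → x = y := fun h =>
    T.entry.injective (Fin.ext h)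
  rintro (k | k) (l | l) h
  · exact congrArg Sum.inl (Prod.ext_iff.1 (key h)).2
  · exact absurd (Prod.ext_iff.1 (key h)).1 (show (0 : Fin 3) ≠ 2 by decide)
  · exact absurd (Prod.ext_iff.1 (key h)).1 (show (2 : Fin 3) ≠ 0 by decide)
  · exact congrArg Sum.inr (Prod.ext_iff.1 (key h)).2

theorem opTime_lt (x : Fin n ⊕ Fin n) : T.opTime x < 3 * n := by
  cases x <;> exact Fin.is_lt _

/-! ## Assembling the prograph of a tableau -/

variable [NeZero n]

/-- The state of the assembling after reading `i` entries. -/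
def assembly (T : Tableau n) (i : ℕ) : Assembly n :=
  ((List.finRange (3 * n)).take i).foldl (Assembly.step T) ⟨[copIn 0], [], 1⟩

theorem assembly_succ (r : Fin 3) (k : Fin n) :
    T.assembly (T.entry (r, k) + 1) =
      Assembly.step T (T.assembly (T.entry (r, k))) (T.entry (r, k)) := by
  have h : (T.entry (r, k) : ℕ) < (List.finRange (3 * n)).length := by simp
  rw [assembly, List.take_succ_eq_append_getElem h, List.foldl_append]
  simp [assembly]

theorem prograph_eq : T.prograph = glued n (T.assembly (3 * n)).glue := by
  have h : (List.finRange (3 * n)).take (3 * n) = List.finRange (3 * n) :=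
    List.take_of_length_le (by simp)
  rw [assembly, h]
  rfl

theorem assembly_succ_row_zero {k : Fin n} {o : Half n} {P : List (Half n)}
    (h : (T.assembly (T.entry (0, k))).pending = o :: P) :
    T.assembly (T.entry (0, k) + 1) = ⟨copLeft k :: copRight k :: P,
      (T.assembly (T.entry (0, k))).waiting,
      (T.assembly (T.entry (0, k))).glue * swap o (copIn k)⟩ := by
  rw [assembly_succ]
  generalize T.assembly (T.entry (0, k)) = s at h ⊢
  obtain ⟨p, W, g⟩ := s
  simp only at h
  subst h
  simp [Assembly.step]

theorem assembly_succ_row_one {k : Fin n} {o : Half n} {P : List (Half n)}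
    (h : (T.assembly (T.entry (1, k))).pending = o :: P) :
    T.assembly (T.entry (1, k) + 1) = ⟨P, o :: (T.assembly (T.entry (1, k))).waiting,
      (T.assembly (T.entry (1, k))).glue⟩ := by
  rw [assembly_succ]
  generalize T.assembly (T.entry (1, k)) = s at h ⊢
  obtain ⟨p, W, g⟩ := s
  simp only at h
  subst h
  simp [Assembly.step]

theorem assembly_succ_row_two {k : Fin n} {o x : Half n} {P W : List (Half n)}
    (h : (T.assembly (T.entry (2, k))).pending = o :: P)
    (h' : (T.assembly (T.entry (2, k))).waiting = x :: W) :
    T.assembly (T.entry (2, k) + 1) = ⟨prodOut k :: P, W,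
      (T.assembly (T.entry (2, k))).glue * swap x (prodLeft k) * swap o (prodRight k)⟩ := by
  rw [assembly_succ]
  generalize T.assembly (T.entry (2, k)) = s at h h' ⊢
  obtain ⟨p, W, g⟩ := s
  simp only at h h'
  subst h h'
  simp [Assembly.step]

/-- The assembling never gets stuck. -/
theorem assembly_length {i : ℕ} (hi : i ≤ 3 * n) :
    (T.assembly i).pending.length + T.count 1 i = T.count 0 i + 1 ∧
      (T.assembly i).waiting.length + T.count 2 i = T.count 1 i := by
  induction i with
  | zero => simp [assembly, count_zero]
  | succ i ih =>
    obtain ⟨h1, h2⟩ := ih (by omega)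
    obtain ⟨r, k, rfl⟩ := T.exists_entry_eq (i := i) (by omega)
    have c1 := T.count_antitone (T.entry (r, k)) (show (0 : Fin 3) < 1 by decide)
    have c2 := T.count_antitone (T.entry (r, k) + 1) (show (1 : Fin 3) < 2 by decide)
    obtain ⟨o, P, hP⟩ := List.exists_cons_of_length_pos
      (l := (T.assembly (T.entry (r, k))).pending) (by omega)
    have hs := T.count_succ_entry r k
    have hn := fun r' (h : r' ≠ r) => T.count_succ_entry_of_ne h k
    rw [hP, List.length_cons] at h1
    obtain rfl | rfl | rfl := fin_three_cases r
    · rw [assembly_succ_row_zero hP, hs, hn 1 (by decide), hn 2 (by decide)]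
      simp only [List.length_cons]
      omega
    · rw [assembly_succ_row_one hP, hs, hn 0 (by decide), hn 2 (by decide)]
      simp only [List.length_cons]
      omega
    · rw [hn 1 (by decide)] at c2
      obtain ⟨x, W, hW⟩ := List.exists_cons_of_length_pos
        (l := (T.assembly (T.entry (2, k))).waiting) (by omega)
      rw [hW, List.length_cons] at h2
      rw [assembly_succ_row_two hP hW, hs, hn 0 (by decide), hn 1 (by decide)]
      simp only [List.length_cons]
      omega

theorem exists_pending_eq_cons {i : ℕ} (hi : i ≤ 3 * n) :
    ∃ o P, (T.assembly i).pending = o :: P := by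
  have h1 := (T.assembly_length hi).1
  have c1 := T.count_antitone i (show (0 : Fin 3) < 1 by decide)
  exact List.exists_cons_of_length_pos (by omega)

theorem exists_waiting_eq_cons (k : Fin n) :
    ∃ x W, (T.assembly (T.entry (2, k))).waiting = x :: W := by
  have h1 := (T.assembly_length (Fin.is_lt (T.entry (2, k))).le).2
  have c2 := T.count_antitone (T.entry (2, k) + 1) (show (1 : Fin 3) < 2 by decide)
  have hs := T.count_succ_entry 2 k
  have hn := T.count_succ_entry_of_ne (show (1 : Fin 3) ≠ 2 by decide) k
  exact List.exists_cons_of_length_pos (by omega)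

/-- The initial wire is represented by `copIn 0` itself, so the first gluing is the swap of a
half-edge with itself and leaves the input unconnected. -/
theorem assembly_one : T.assembly 1 = ⟨[copLeft 0, copRight 0], [], 1⟩ := by
  have h := assembly_succ_row_zero (T := T) (k := 0) (o := copIn 0) (P := []) (by
    rw [entry_zero]; rfl)
  rw [entry_zero] at h
  rw [h, swap_self]
  rfl

theorem assembly_last_pending : (T.assembly (3 * n)).pending = [prodOut (Fin.rev 0)] := by
  obtain ⟨o, P, hP⟩ := T.exists_pending_eq_cons (i := T.entry (2, Fin.rev 0)) (Fin.is_lt _).le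
  obtain ⟨x, W, hW⟩ := T.exists_waiting_eq_cons (Fin.rev 0)
  have h := assembly_succ_row_two hP hW
  rw [entry_last] at h
  have h1 := (T.assembly_length (le_refl (3 * n))).1
  rw [count_last, count_last, h] at h1
  simp only [List.length_cons] at h1
  rw [h, List.eq_nil_of_length_eq_zero (l := P) (by omega)]

theorem assembly_last_waiting : (T.assembly (3 * n)).waiting = [] := by
  have h1 := (T.assembly_length (le_refl (3 * n))).2
  rw [count_last, count_last] at h1
  exact List.eq_nil_of_length_eq_zero (by omega)

/-- The half-edges that are still unconnected after reading `i` entries. -/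
def IsOpen (T : Tableau n) (i : ℕ) (x : Half n) : Prop :=
  x ∈ (T.assembly i).pending ∨ x ∈ (T.assembly i).waiting ∨ i ≤ T.opTime x.1

/-- `g` matches all the half-edges outside `O` but `z` with half-edges of opposite direction. -/
structure Glues (g : Perm (Half n)) (O : Half n → Prop) (z : Half n) : Prop where
  apply_open : ∀ x, O x → g x = x
  apply_in : g z = z
  out : ∀ x, ¬ O x → x ≠ z → (g x).out = !x.out
  apply_apply : ∀ x, g (g x) = x

omit [NeZero n] in
theorem Glues.mul_swap {g : Perm (Half n)} {O : Half n → Prop} {z a b : Half n} (h : Glues g O z)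
    (ha : O a) (hb : O b) (hab : b.out = !a.out) (haz : a ≠ z) (hbz : b ≠ z) :
    Glues (g * swap a b) (fun x => O x ∧ x ≠ a ∧ x ≠ b) z ∧ (g * swap a b) a = b ∧
      ∀ x, ¬ O x → (g * swap a b) x = g x := by
  have ha' := h.apply_open a ha
  have hb' := h.apply_open b hb
  refine ⟨⟨fun x hx => ?_, ?_, fun x hx hz => ?_, mul_swap_involutive h.apply_apply ha' hb'⟩,
    mul_swap_apply_left hb', fun x hx => ?_⟩
  · rw [mul_swap_apply_of_ne hx.2.1 hx.2.2, h.apply_open x hx.1]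
  · rw [mul_swap_apply_of_ne haz.symm hbz.symm, h.apply_in]
  · by_cases h1 : x = a
    · rw [h1, mul_swap_apply_left hb', hab]
    by_cases h2 : x = b
    · rw [h2, mul_swap_apply_right ha', hab, Bool.not_not]
    rw [mul_swap_apply_of_ne h1 h2]
    exact h.out x (fun h3 => hx ⟨h3, h1, h2⟩) hz
  · exact mul_swap_apply_of_ne (fun e => hx (e ▸ ha)) (fun e => hx (e ▸ hb))

/-- The unconnected half-edges are disjoint from the connected ones. -/
structure Assembled (T : Tableau n) (i : ℕ) : Prop where
  nodup : ((T.assembly i).pending ++ (T.assembly i).waiting).Nodup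
  past : ∀ x, x ∈ (T.assembly i).pending ∨ x ∈ (T.assembly i).waiting →
    T.opTime x.1 < i ∧ x.out = true
  glues : Glues (T.assembly i).glue (T.IsOpen i) (copIn 0)

/-- The invariant starts at time 1: at time 0 the pending half-edge is the input `copIn 0`, not an
output of an operator already created. -/
theorem assembled_one : T.Assembled 1 := by
  refine ⟨?_, ?_, ?_⟩
  · rw [assembly_one]
    simp [copLeft, copRight]
  · rw [assembly_one]
    intro x hx
    have : T.opTime (Sum.inl 0) = 0 := T.entry_zero
    simp only [List.mem_cons, List.not_mem_nil, or_false] at hx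
    rcases hx with rfl | rfl
    · exact ⟨by rw [copLeft, this]; exact one_pos, rfl⟩
    · exact ⟨by rw [copRight, this]; exact one_pos, rfl⟩
  · have hopen : ∀ x : Half n, T.IsOpen 1 x ∨ x = copIn 0 := by
      rintro ⟨x, i⟩
      rcases Nat.eq_zero_or_pos (T.opTime x) with h | h
      · obtain rfl : x = Sum.inl 0 := T.opTime_injective (h.trans T.entry_zero.symm)
        simp only [IsOpen, assembly_one]
        fin_cases i <;> simp [copLeft, copRight, copIn]
      · exact .inl (.inr (.inr h))
    rw [assembly_one]
    exact ⟨fun _ _ => rfl, rfl, fun x h1 h2 => absurd (hopen x) (by tauto), fun _ => rfl⟩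

theorem Assembled.succ_row_zero {k : Fin n} (h : T.Assembled (T.entry (0, k)))
    (hpos : 0 < (T.entry (0, k) : ℕ)) {o : Half n} {P : List (Half n)}
    (hP : (T.assembly (T.entry (0, k))).pending = o :: P) :
    T.Assembled (T.entry (0, k) + 1) ∧ (T.assembly (T.entry (0, k) + 1)).glue o = copIn k ∧
      ¬ T.IsOpen (T.entry (0, k) + 1) o ∧ ∀ x, ¬ T.IsOpen (T.entry (0, k)) x →
        (T.assembly (T.entry (0, k) + 1)).glue x = (T.assembly (T.entry (0, k))).glue x ∧
          ¬ T.IsOpen (T.entry (0, k) + 1) x := by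
  have hA := assembly_succ_row_zero hP
  have hk : T.opTime (Sum.inl k) = T.entry (0, k) := rfl
  obtain ⟨hn, hp, hg⟩ := h
  simp only [hP] at hn hp
  generalize hi : (T.entry (0, k) : ℕ) = i at *
  obtain ⟨ho, ho'⟩ := hp o (.inl (by simp))
  rw [List.cons_append, List.nodup_cons] at hn
  -- The two outputs that become pending were open before, as parts of an operator not yet created;
  -- only the pair just glued ceases to be open.
  have hiff : T.IsOpen (i + 1) = fun x => T.IsOpen i x ∧ x ≠ o ∧ x ≠ copIn k := by
    funext x
    simp only [IsOpen, hA, hP, List.mem_cons]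
    apply propext
    constructor
    · rintro ((rfl | rfl | hx) | hx | hx)
      · refine ⟨.inr (.inr hk.ge), ?_, by simp [copLeft, copIn]⟩
        rintro rfl
        simp only [copLeft] at ho; omega
      · refine ⟨.inr (.inr hk.ge), ?_, by simp [copRight, copIn]⟩
        rintro rfl
        simp only [copRight] at ho; omega
      · refine ⟨.inl (.inr hx), ?_, ?_⟩
        · rintro rfl
          exact hn.1 (List.mem_append_left _ hx)
        · rintro rfl
          have := (hp _ (.inl (List.mem_cons_of_mem _ hx))).1
          simp only [copIn] at this; omega
      · refine ⟨.inr (.inl hx), ?_, ?_⟩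
        · rintro rfl
          exact hn.1 (List.mem_append_right _ hx)
        · rintro rfl
          have := (hp _ (.inr hx)).1
          simp only [copIn] at this; omega
      · refine ⟨.inr (.inr (by omega)), ?_, ?_⟩
        · rintro rfl; omega
        · rintro rfl
          simp only [copIn] at hx; omega
    · rintro ⟨(rfl | hx) | hx | hx, h1, h2⟩
      · exact absurd rfl h1
      · exact .inl (.inr (.inr hx))
      · exact .inr (.inl hx)
      · rcases hx.lt_or_eq with hx | hx
        · exact .inr (.inr hx)
        · obtain ⟨x, j⟩ := x
          obtain rfl : x = Sum.inl k := T.opTime_injective (hx.symm.trans hk.symm)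
          fin_cases j
          · exact absurd rfl h2
          · exact .inl (.inr (.inl rfl))
          · exact .inl (.inl rfl)
  have hopen : T.IsOpen i o := .inl (by rw [hP]; simp)
  have hopen' : T.IsOpen i (copIn k) := .inr (.inr hk.ge)
  have hne : o ≠ copIn 0 := by rintro rfl; cases ho'
  have hne' : copIn k ≠ copIn 0 := by
    intro e
    obtain rfl : k = 0 := by simpa [copIn] using e
    rw [T.entry_zero] at hi
    omega
  obtain ⟨g1, g2, g3⟩ := hg.mul_swap hopen hopen' (by rw [ho']; rfl) hne hne'
  refine ⟨⟨?_, ?_, ?_⟩, ?_, ?_, fun x hx => ⟨?_, ?_⟩⟩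
  · rw [hA, List.cons_append, List.cons_append, List.nodup_cons, List.nodup_cons]
    have hnot : ∀ j, (Sum.inl k, j) ∉ P ++ (T.assembly i).waiting := by
      intro j hj
      rcases List.mem_append.1 hj with hj | hj
      · have := (hp _ (.inl (List.mem_cons_of_mem _ hj))).1
        simp only at this; omega
      · have := (hp _ (.inr hj)).1
        simp only at this; omega
    refine ⟨?_, hnot _, hn.2⟩
    rw [List.mem_cons]
    rintro (e | e)
    · simp [copLeft, copRight] at e
    · exact hnot _ e
  · rw [hA]
    simp only [List.mem_cons]
    rintro x ((rfl | rfl | hx) | hx)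
    · exact ⟨by simp only [copLeft]; omega, rfl⟩
    · exact ⟨by simp only [copRight]; omega, rfl⟩
    · have := hp x (.inl (List.mem_cons_of_mem _ hx))
      exact ⟨by omega, this.2⟩
    · have := hp x (.inr hx)
      exact ⟨by omega, this.2⟩
  · rw [hA, hiff]
    exact g1
  · rw [hA]
    exact g2
  · rw [hiff]
    simp
  · rw [hA]
    exact g3 x hx
  · rw [hiff]
    exact fun e => hx e.1

theorem Assembled.succ_row_one {k : Fin n} (h : T.Assembled (T.entry (1, k)))
    {o : Half n} {P : List (Half n)} (hP : (T.assembly (T.entry (1, k))).pending = o :: P) :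
    T.Assembled (T.entry (1, k) + 1) ∧ ∀ x, ¬ T.IsOpen (T.entry (1, k)) x →
        (T.assembly (T.entry (1, k) + 1)).glue x = (T.assembly (T.entry (1, k))).glue x ∧
          ¬ T.IsOpen (T.entry (1, k) + 1) x := by
  have hA := assembly_succ_row_one hP
  -- An entry of row 1 creates no operator, so the wire only moves between lists and the same
  -- half-edges stay open.
  have hk : ∀ x, T.opTime x ≠ T.entry (1, k) := by
    have key : ∀ {x y}, (T.entry x : ℕ) = T.entry y → x = y := fun h =>
      T.entry.injective (Fin.ext h)
    rintro (x | x) e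
    · exact absurd (Prod.ext_iff.1 (key e)).1 (show (0 : Fin 3) ≠ 1 by decide)
    · exact absurd (Prod.ext_iff.1 (key e)).1 (show (2 : Fin 3) ≠ 1 by decide)
  obtain ⟨hn, hp, hg⟩ := h
  simp only [hP] at hn hp
  generalize hi : (T.entry (1, k) : ℕ) = i at *
  have hiff : T.IsOpen (i + 1) = T.IsOpen i := by
    funext x
    simp only [IsOpen, hA, hP, List.mem_cons]
    have : i + 1 ≤ T.opTime x.1 ↔ i ≤ T.opTime x.1 := by
      have := hk x.1
      omega
    rw [this]
    apply propext
    tauto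
  refine ⟨⟨?_, ?_, ?_⟩, fun x hx => ⟨?_, ?_⟩⟩
  · rw [hA]
    exact List.perm_middle.nodup_iff.2 hn
  · rw [hA]
    intro x hx
    simp only [List.mem_cons] at hx hp
    have := hp x (by tauto)
    exact ⟨by omega, this.2⟩
  · rw [hA, hiff]
    exact hg
  · rw [hA]
  · rw [hiff]
    exact hx

theorem Assembled.succ_row_two {k : Fin n} (h : T.Assembled (T.entry (2, k)))
    {o y : Half n} {P W : List (Half n)}
    (hP : (T.assembly (T.entry (2, k))).pending = o :: P)
    (hW : (T.assembly (T.entry (2, k))).waiting = y :: W) :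
    T.Assembled (T.entry (2, k) + 1) ∧ (T.assembly (T.entry (2, k) + 1)).glue o = prodRight k ∧
      (T.assembly (T.entry (2, k) + 1)).glue y = prodLeft k ∧
      ¬ T.IsOpen (T.entry (2, k) + 1) o ∧ ¬ T.IsOpen (T.entry (2, k) + 1) y ∧
      ∀ x, ¬ T.IsOpen (T.entry (2, k)) x →
        (T.assembly (T.entry (2, k) + 1)).glue x = (T.assembly (T.entry (2, k))).glue x ∧
          ¬ T.IsOpen (T.entry (2, k) + 1) x := by
  have hA := assembly_succ_row_two hP hW
  have hk : T.opTime (Sum.inr k) = T.entry (2, k) := rfl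
  obtain ⟨hn, hp, hg⟩ := h
  simp only [hP, hW] at hn hp
  generalize hi : (T.entry (2, k) : ℕ) = i at *
  obtain ⟨ho, ho'⟩ := hp o (.inl (by simp))
  obtain ⟨hy, hy'⟩ := hp y (.inr (by simp))
  have hn' := List.perm_middle.nodup_iff.1 hn
  rw [List.cons_append, List.nodup_cons] at hn
  rw [List.cons_append, List.nodup_cons] at hn'
  have hoy : o ≠ y := fun e => hn.1 (by simp [e])
  have hpast : ∀ x, x ∈ P ∨ x ∈ W → x ≠ o ∧ x ≠ y ∧ T.opTime x.1 < i ∧ x.out = true := by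
    rintro x (hx | hx)
    · refine ⟨?_, ?_, hp x (.inl (List.mem_cons_of_mem _ hx))⟩
      · rintro rfl; exact hn.1 (List.mem_append_left _ hx)
      · rintro rfl; exact hn'.1 (by simp [hx])
    · refine ⟨?_, ?_, hp x (.inr (List.mem_cons_of_mem _ hx))⟩
      · rintro rfl; exact hn.1 (List.mem_append_right _ (List.mem_cons_of_mem _ hx))
      · rintro rfl; exact hn'.1 (by simp [hx])
  have hnot : ∀ j (x : Half n), T.opTime x.1 < i → x ≠ (Sum.inr k, j) := by
    rintro j _ hx rfl
    simp only at hx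
    omega
  -- The nesting matches the two successive applications of `Glues.mul_swap`, first for the left
  -- input and then for the right one.
  have hiff : T.IsOpen (i + 1) = fun x => (T.IsOpen i x ∧ x ≠ y ∧ x ≠ prodLeft k) ∧
      x ≠ o ∧ x ≠ prodRight k := by
    funext x
    simp only [IsOpen, hA, hP, hW, List.mem_cons]
    apply propext
    constructor
    · rintro ((rfl | hx) | hx | hx)
      · exact ⟨⟨.inr (.inr hk.ge), (hnot _ y hy).symm, by simp [prodOut, prodLeft]⟩,
          (hnot _ o ho).symm, by simp [prodOut, prodRight]⟩
      · obtain ⟨h1, h2, h3, -⟩ := hpast x (.inl hx)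
        exact ⟨⟨.inl (.inr hx), h2, hnot _ x h3⟩, h1, hnot _ x h3⟩
      · obtain ⟨h1, h2, h3, -⟩ := hpast x (.inr hx)
        exact ⟨⟨.inr (.inl (.inr hx)), h2, hnot _ x h3⟩, h1, hnot _ x h3⟩
      · refine ⟨⟨.inr (.inr (by omega)), ?_, ?_⟩, ?_, ?_⟩
        · rintro rfl; omega
        · rintro rfl
          simp only [prodLeft] at hx; omega
        · rintro rfl; omega
        · rintro rfl
          simp only [prodRight] at hx; omega
    · rintro ⟨⟨(rfl | hx) | (rfl | hx) | hx, h1, h2⟩, h3, h4⟩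
      · exact absurd rfl h3
      · exact .inl (.inr hx)
      · exact absurd rfl h1
      · exact .inr (.inl hx)
      · rcases hx.lt_or_eq with hx | hx
        · exact .inr (.inr hx)
        · obtain ⟨x, j⟩ := x
          obtain rfl : x = Sum.inr k := T.opTime_injective (hx.symm.trans hk.symm)
          fin_cases j
          · exact .inl (.inl rfl)
          · exact absurd rfl h2
          · exact absurd rfl h4
  have hopen : T.IsOpen i o := .inl (by rw [hP]; simp)
  have hopen' : T.IsOpen i y := .inr (.inl (by rw [hW]; simp))
  have hne : o ≠ copIn 0 := by rintro rfl; cases ho'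
  have hne' : y ≠ copIn 0 := by rintro rfl; cases hy'
  obtain ⟨g1, g2, g3⟩ := hg.mul_swap hopen' (b := prodLeft k) (.inr (.inr hk.ge))
    (by rw [hy']; rfl) hne' (by simp [prodLeft, copIn])
  obtain ⟨f1, f2, f3⟩ := g1.mul_swap (a := o) (b := prodRight k) ⟨hopen, hoy, hnot _ o ho⟩
    ⟨.inr (.inr hk.ge), (hnot _ y hy).symm, by simp [prodRight, prodLeft]⟩
    (by rw [ho']; rfl) hne (by simp [prodRight, copIn])
  refine ⟨⟨?_, ?_, ?_⟩, ?_, ?_, ?_, ?_, fun x hx => ⟨?_, ?_⟩⟩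
  · rw [hA, List.cons_append, List.nodup_cons]
    refine ⟨fun e => ?_, ((List.sublist_append_right [y] W).append_left P |>.nodup hn.2)⟩
    exact hnot _ _ (hpast _ (List.mem_append.1 e)).2.2.1 rfl
  · rw [hA]
    simp only [List.mem_cons]
    rintro x ((rfl | hx) | hx)
    · exact ⟨by simp only [prodOut]; omega, rfl⟩
    · have := hpast x (.inl hx)
      exact ⟨by omega, this.2.2.2⟩
    · have := hpast x (.inr hx)
      exact ⟨by omega, this.2.2.2⟩
  · rw [hA, hiff]
    exact f1
  · rw [hA]
    exact f2
  · rw [hA]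
    exact (f3 y (by simp)).trans g2
  · rw [hiff]
    simp
  · rw [hiff]
    simp
  · rw [hA]
    exact (f3 x fun e => hx e.1).trans (g3 x hx)
  · rw [hiff]
    exact fun e => hx e.1.1

end Tableau

namespace Tableau

variable {n : ℕ} [NeZero n] {T : Tableau n}

/-! ## The reading of the prograph of a tableau -/

theorem Assembled.succ {i : ℕ} (h : T.Assembled i) (h0 : 0 < i) (hi : i < 3 * n) :
    T.Assembled (i + 1) ∧ ∀ x, ¬ T.IsOpen i x →
      (T.assembly (i + 1)).glue x = (T.assembly i).glue x ∧ ¬ T.IsOpen (i + 1) x := by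
  obtain ⟨r, k, rfl⟩ := T.exists_entry_eq hi
  obtain ⟨o, P, hP⟩ := T.exists_pending_eq_cons hi.le
  obtain rfl | rfl | rfl := fin_three_cases r
  · obtain ⟨h1, -, -, h2⟩ := h.succ_row_zero h0 hP
    exact ⟨h1, h2⟩
  · exact h.succ_row_one hP
  · obtain ⟨x, W, hW⟩ := T.exists_waiting_eq_cons k
    obtain ⟨h1, -, -, -, -, h2⟩ := h.succ_row_two hP hW
    exact ⟨h1, h2⟩

theorem assembled {i : ℕ} (h0 : 0 < i) (hi : i ≤ 3 * n) : T.Assembled i := by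
  induction i, h0 using Nat.le_induction with
  | base => exact assembled_one
  | succ i h0 ih => exact ((ih (by omega)).succ h0 hi).1

/-- The gluing of the prograph of a tableau. -/
def gluing (T : Tableau n) : Perm (Half n) := (T.assembly (3 * n)).glue

/-- Later swaps only involve open half-edges, so a half-edge once connected keeps its partner. -/
theorem gluing_apply {i : ℕ} (h0 : 0 < i) (hi : i ≤ 3 * n) {x : Half n} (hx : ¬ T.IsOpen i x) :
    T.gluing x = (T.assembly i).glue x := by
  have key : ∀ j, i ≤ j → j ≤ 3 * n → (T.assembly j).glue x = (T.assembly i).glue x ∧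
      ¬ T.IsOpen j x := by
    intro j hj
    induction j, hj using Nat.le_induction with
    | base => exact fun _ => ⟨rfl, hx⟩
    | succ j hj ih =>
      intro hjn
      obtain ⟨h1, h2⟩ := ih (by omega)
      obtain ⟨h3, h4⟩ := ((assembled (by omega) (by omega)).succ (by omega) hjn).2 x h2
      exact ⟨h3.trans h1, h4⟩
  exact (key _ hi le_rfl).1

theorem isOpen_last {x : Half n} : T.IsOpen (3 * n) x ↔ x = prodOut (Fin.rev 0) := by
  have := T.opTime_lt x.1
  simp only [IsOpen, assembly_last_pending, assembly_last_waiting, List.mem_singleton,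
    List.not_mem_nil, false_or]
  constructor
  · rintro (h | h)
    · exact h
    · omega
  · exact .inl

theorem hasLegs : (glued n T.gluing).HasLegs := by
  have h := (T.assembled (NeZero.pos (3 * n)) le_rfl).glues
  exact ⟨h.apply_in, h.apply_open _ (isOpen_last.2 rfl)⟩

theorem isCubic : (glued n T.gluing).closed.IsCubic where
  α_α := mul_swap_involutive (T.assembled (NeZero.pos (3 * n)) le_rfl).glues.apply_apply
    hasLegs.inLeg hasLegs.outLeg
  out_α (d : Half n) := by
    change ((glued n T.gluing).closed.α d : Half n).out = !d.out
    by_cases h1 : d = copIn 0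
    · subst h1
      exact congrArg Half.out hasLegs.closed_α_inLeg
    by_cases h2 : d = prodOut (Fin.rev 0)
    · subst h2
      exact congrArg Half.out hasLegs.closed_α_outLeg
    rw [PrographData.closed_α_of_ne h1 h2]
    exact (T.assembled (NeZero.pos (3 * n)) le_rfl).glues.out d (mt isOpen_last.1 h2) h1
  operators := glued_operators
  root_product := glued_isProduct _
  root_coproduct := by
    rw [hasLegs.closed_α_outLeg]
    exact glued_isCoproduct 0

/-- The cut of the prograph before the entry `i + 1` is read. -/
def scan (T : Tableau n) (i : ℕ) : RootedData.Scan (glued n T.gluing).closed :=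
  if i = 0 then ⟨prodOut (Fin.rev 0), [], []⟩ else
    ⟨(T.assembly i).pending.headD (copIn 0), (T.assembly i).waiting, (T.assembly i).pending.tail⟩

theorem scan_eq {i : ℕ} (h0 : 0 < i) {o : Half n} {P : List (Half n)}
    (hP : (T.assembly i).pending = o :: P) : T.scan i = ⟨o, (T.assembly i).waiting, P⟩ := by
  rw [scan, if_neg h0.ne', hP]
  rfl

/-- The bound excludes the output leg, whose product is created by the last entry `3n - 1`. -/
theorem closed_α_apply {x y : Half n} (hx : x.out = true) (hlt : T.opTime x.1 + 1 < 3 * n)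
    (h : T.gluing x = y) : (glued n T.gluing).closed.α x = y := by
  rw [PrographData.closed_α_of_ne, h]
  · rintro rfl
    cases hx
  · rintro rfl
    change (T.entry (2, Fin.rev 0) : ℕ) + 1 < 3 * n at hlt
    rw [T.entry_last] at hlt
    omega

/-- A step with letter 1 must already know that its wire ends at a left input, whereas the
assembling decides this later. Backward induction from the empty final list supplies it. -/
theorem closed_α_waiting {i : ℕ} (h0 : 0 < i) (hi : i ≤ 3 * n) {x : Half n}
    (hx : x ∈ (T.assembly i).waiting) : ∃ k, (glued n T.gluing).closed.α x = prodLeft k := by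
  revert h0
  induction hi using Nat.decreasingInduction with
  | self => simp [assembly_last_waiting] at hx
  | of_succ i hi ih =>
    intro h0
    obtain ⟨r, k, rfl⟩ := T.exists_entry_eq hi
    obtain ⟨o, P, hP⟩ := T.exists_pending_eq_cons hi.le
    obtain rfl | rfl | rfl := fin_three_cases r
    · refine ih ?_ (by omega)
      rw [assembly_succ_row_zero hP]
      exact hx
    · refine ih ?_ (by omega)
      rw [assembly_succ_row_one hP]
      exact List.mem_cons_of_mem _ hx
    · obtain ⟨y, W, hW⟩ := T.exists_waiting_eq_cons k
      rw [hW, List.mem_cons] at hx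
      rcases hx with rfl | hx
      · obtain ⟨-, -, h2, -, h4, -⟩ := (assembled h0 hi.le).succ_row_two hP hW
        obtain ⟨h5, h6⟩ := (assembled h0 hi.le).past x (.inr (by rw [hW]; simp))
        exact ⟨k, closed_α_apply h6 (by omega) ((gluing_apply (by omega) hi h4).trans h2)⟩
      · refine ih ?_ (by omega)
        rw [assembly_succ_row_two hP hW]
        exact hx

theorem step_scan {i : ℕ} (hi : i < 3 * n) :
    (glued n T.gluing).closed.Step (T.word i) (T.scan i) (T.scan (i + 1)) := by
  -- Time 0 is separate: the first cut holds the output leg, which the closing edge joins to `copIn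
  -- 0`, while the assembling starts with `copIn 0`.
  rcases Nat.eq_zero_or_pos i with rfl | h0
  · have h1 : T.word 0 = 0 := by
      have := T.word_entry 0 0
      rwa [entry_zero] at this
    rw [h1, zero_add, T.scan_eq one_pos (o := copLeft 0) (P := [copRight 0])
      (by rw [assembly_one]), assembly_one]
    have h2 : (glued n T.gluing).closed.α (T.scan 0).cur = copIn 0 := hasLegs.closed_α_outLeg
    refine .inl ⟨rfl, ?_, ?_, rfl, ?_⟩
    · rw [h2]; exact glued_isCoproduct 0
    · rw [h2]; rfl
    · rw [h2]; rfl
  obtain ⟨r, k, rfl⟩ := T.exists_entry_eq hi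
  obtain ⟨o, P, hP⟩ := T.exists_pending_eq_cons hi.le
  have hA := T.assembled h0 hi.le
  obtain ⟨ho, ho'⟩ := hA.past o (.inl (by rw [hP]; simp))
  rw [word_entry, scan_eq h0 hP]
  obtain rfl | rfl | rfl := fin_three_cases r
  · obtain ⟨-, h1, h2, -⟩ := hA.succ_row_zero h0 hP
    have h3 := closed_α_apply ho' (by omega) ((gluing_apply (by omega) hi h2).trans h1)
    have h4 := assembly_succ_row_zero hP
    rw [scan_eq (by omega) (o := copLeft k) (P := copRight k :: P) (by rw [h4]), h4]
    refine .inl ⟨rfl, ?_, ?_, rfl, ?_⟩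
    · rw [h3]; exact glued_isCoproduct k
    · rw [h3]; rfl
    · rw [h3]; rfl
  · have h4 := assembly_succ_row_one hP
    obtain ⟨o', P', hP'⟩ := T.exists_pending_eq_cons hi
    have h5 : P = o' :: P' := by
      rw [h4] at hP'
      exact hP'
    rw [scan_eq (by omega) hP', h4]
    obtain ⟨l, hl⟩ := T.closed_α_waiting (x := o) (Nat.succ_pos _) hi (by rw [h4]; simp)
    exact .inr (.inl ⟨rfl, ⟨prodOut l, glued_isProduct l, hl⟩, rfl, h5⟩)
  · obtain ⟨y, W, hW⟩ := T.exists_waiting_eq_cons k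
    obtain ⟨hy, hy'⟩ := hA.past y (.inr (by rw [hW]; simp))
    obtain ⟨-, h1, h2, h3, h4, -⟩ := hA.succ_row_two hP hW
    have h5 := closed_α_apply ho' (by omega) ((gluing_apply (by omega) hi h3).trans h1)
    have h6 := closed_α_apply hy' (by omega) ((gluing_apply (by omega) hi h4).trans h2)
    have h7 := assembly_succ_row_two hP hW
    rw [scan_eq (by omega) (o := prodOut k) (P := P) (by rw [h7]), h7]
    exact .inr (.inr ⟨rfl, glued_isProduct k, h5, ⟨y, h6, hW⟩, rfl⟩)

/-- Left outputs and product outputs become current as soon as their operator is created; right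
outputs become current later because the right list ends empty. Counting then excludes repetitions.
-/
theorem isReading : (glued n T.gluing).closed.IsReading (3 * n) T.word T.scan := by
  have hpos : 0 < 3 * n := NeZero.pos (3 * n)
  have h0 : T.scan 0 = ⟨prodOut (Fin.rev 0), [], []⟩ := rfl
  have hN : T.scan (3 * n) = ⟨prodOut (Fin.rev 0), [], []⟩ := by
    rw [scan_eq hpos assembly_last_pending, assembly_last_waiting]
  have step : ∀ i < 3 * n, (glued n T.gluing).closed.Step (T.word i) (T.scan i) (T.scan (i + 1)) :=
    fun i hi => step_scan hi
  have hle : ∀ i ≤ 3 * n, ∃ j < 3 * n, (T.scan j).cur = (T.scan i).cur := fun i hi => by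
    rcases hi.lt_or_eq with h | rfl
    · exact ⟨i, h, rfl⟩
    · exact ⟨0, hpos, by rw [hN, h0]⟩
  have surj : ∀ d, (glued n T.gluing).closed.out d = true → ∃ i < 3 * n, (T.scan i).cur = d := by
    intro d hd
    suffices h : ∃ i ≤ 3 * n, (T.scan i).cur = d by
      obtain ⟨i, hi, rfl⟩ := h
      exact hle i hi
    obtain ⟨k, rfl | rfl | rfl⟩ := half_out_cases hd
    · obtain ⟨o, P, hP⟩ := T.exists_pending_eq_cons (i := T.entry (0, k)) (Fin.is_lt _).le
      refine ⟨T.entry (0, k) + 1, Fin.is_lt _, ?_⟩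
      rw [scan_eq (Nat.succ_pos _) (o := copLeft k) (by rw [assembly_succ_row_zero hP])]
    · obtain ⟨o, P, hP⟩ := T.exists_pending_eq_cons (i := T.entry (0, k)) (Fin.is_lt _).le
      obtain ⟨j, -, hj, h1, -⟩ := RootedData.mem_right_future step (by rw [hN])
        (i := T.entry (0, k) + 1) (Fin.is_lt _) (r := copRight k) (by
          rw [scan_eq (Nat.succ_pos _) (o := copLeft k) (P := copRight k :: P)
            (by rw [assembly_succ_row_zero hP])]
          simp)
      exact ⟨j + 1, hj, h1⟩
    · obtain ⟨o, P, hP⟩ := T.exists_pending_eq_cons (i := T.entry (2, k)) (Fin.is_lt _).le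
      obtain ⟨x, W, hW⟩ := T.exists_waiting_eq_cons k
      refine ⟨T.entry (2, k) + 1, Fin.is_lt _, ?_⟩
      rw [scan_eq (Nat.succ_pos _) (o := prodOut k) (by rw [assembly_succ_row_two hP hW])]
  refine ⟨h0, hN, step, surj, RootedData.injOn_of_surj isCubic ?_ _ surj⟩
  have : Nat.card (glued n T.gluing).closed.D = 6 * n := glued_card (g := T.gluing)
  omega

theorem isPCPrograph : T.prograph.IsPCPrograph n := by
  rw [prograph_eq]
  exact PrographData.isPCPrograph_of_reading hasLegs isCubic isReading glued_card

/-! ## Tableaux and words -/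

omit [NeZero n] in
theorem count_entry (r : Fin 3) (k : Fin n) : T.count r (T.entry (r, k)) = k := by
  have : (Finset.univ.filter fun l => (T.entry (r, l) : ℕ) < T.entry (r, k)) = Finset.Iio k := by
    ext l
    simp only [Finset.mem_filter, Finset.mem_univ, true_and, Finset.mem_Iio]
    exact (T.row_lt r).lt_iff_lt
  rw [count, this, Fin.card_Iio]

omit [NeZero n] in
-- An entry is recovered from the word: its row is the letter, and its column is the number of
-- earlier occurrences of that letter.
theorem eq_of_word_eq {T' : Tableau n} (h : ∀ i < 3 * n, T.word i = T'.word i) : T = T' := by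
  have hcount : ∀ i ≤ 3 * n, ∀ r, T.count r i = T'.count r i := by
    intro i
    induction i with
    | zero => intro _ r; rw [count_zero, count_zero]
    | succ i ih =>
      intro hi r
      have hw := h i hi
      have hc := ih (by omega) r
      obtain ⟨s, k, e⟩ := T.exists_entry_eq hi
      obtain ⟨s', k', e'⟩ := T'.exists_entry_eq hi
      have e1 := T.word_entry s k
      have e2 := T'.word_entry s' k'
      rw [← e] at e1
      rw [← e'] at e2
      obtain rfl : s = s' := by rw [← e1, ← e2, hw]
      by_cases hr : r = s
      · subst hr
        have h1 := T.count_succ_entry r k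
        have h2 := T'.count_succ_entry r k'
        rw [← e] at h1
        rw [← e'] at h2
        omega
      · have h1 := T.count_succ_entry_of_ne hr k
        have h2 := T'.count_succ_entry_of_ne hr k'
        rw [← e] at h1
        rw [← e'] at h2
        omega
  have hentry : T.entry = T'.entry := by
    ext ⟨r, k⟩
    have hi := (T.entry (r, k)).2
    obtain ⟨s, l, e⟩ := T'.exists_entry_eq hi
    have e1 := T.word_entry r k
    have e2 := T'.word_entry s l
    rw [← e, ← h _ hi, e1] at e2
    subst e2
    have h1 := T.count_entry r k
    have h2 := T'.count_entry r l
    rw [← e, ← hcount _ hi.le, h1] at h2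
    rw [e, Fin.ext h2]
  cases T
  cases T'
  simp only at hentry
  subst hentry
  rfl

omit [NeZero n] in
theorem word_schutzenberger {i : ℕ} (hi : i < 3 * n) :
    T.schutzenberger.word i = (T.word (3 * n - 1 - i)).rev := by
  obtain ⟨r, k, rfl⟩ := T.schutzenberger.exists_entry_eq hi
  rw [word_entry]
  have h : 3 * n - 1 - (T.schutzenberger.entry (r, k) : ℕ) = T.entry (r.rev, k.rev) := by
    have h1 : T.schutzenberger.entry (r, k) = (T.entry (r.rev, k.rev)).rev := rfl
    have h2 := Fin.is_lt (T.entry (r.rev, k.rev))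
    rw [h1, Fin.val_rev]
    omega
  rw [h, word_entry, Fin.rev_rev]

end Tableau

/-- A word with `n` letters of each type and the ballot property comes from a tableau. -/
theorem exists_tableau_word {n : ℕ} (w : ℕ → Fin 3)
    (hcard : ∀ r, Nat.count (fun i => w i = r) (3 * n) = n)
    (h1 : ∀ i ≤ 3 * n, Nat.count (fun i => w i = 1) i ≤ Nat.count (fun i => w i = 0) i)
    (h2 : ∀ i ≤ 3 * n, Nat.count (fun i => w i = 2) i ≤ Nat.count (fun i => w i = 1) i) :
    ∃ T : Tableau n, ∀ i < 3 * n, T.word i = w i := by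
  -- Row `r` will list the positions of the letter `r` in increasing order; the bound makes this set
  -- finite.
  let p : Fin 3 → ℕ → Prop := fun r i => i < 3 * n ∧ w i = r
  have hcount : ∀ r, ∀ i ≤ 3 * n, Nat.count (p r) i = Nat.count (fun i => w i = r) i := by
    intro r i hi
    rw [Nat.count_eq_card_filter_range, Nat.count_eq_card_filter_range]
    congr 1
    ext j
    simp only [Finset.mem_filter, Finset.mem_range, p]
    constructor
    · exact fun h => ⟨h.1, h.2.2⟩
    · exact fun h => ⟨h.1, by omega, h.2⟩
  have hlt : ∀ r (k : Fin n), (k : ℕ) < Nat.count (p r) (3 * n) := fun r k => by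
    rw [hcount r _ le_rfl, hcard]
    exact k.2
  have hfin : ∀ r, {i | p r i}.Finite := fun r =>
    (Set.finite_lt_nat (3 * n)).subset fun i hi => hi.1
  have hfcard : ∀ r (k : Fin n), (k : ℕ) < (hfin r).toFinset.card := by
    intro r k
    refine (hlt r k).trans_le ?_
    rw [Nat.count_eq_card_filter_range]
    refine Finset.card_le_card fun i hi => ?_
    exact (hfin r).mem_toFinset.2 (Finset.mem_filter.1 hi).2
  have hmem : ∀ r (k : Fin n), p r (Nat.nth (p r) k) := fun r k =>
    Nat.nth_mem_of_lt_card (hfin r) (hfcard r k)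
  have hmono : ∀ r (k l : Fin n), k < l → Nat.nth (p r) k < Nat.nth (p r) l := fun r k l hkl =>
    Nat.nth_lt_nth_of_lt_card (hfin r) hkl (hfcard r l)
  let e : Fin 3 × Fin n → Fin (3 * n) := fun x => ⟨Nat.nth (p x.1) x.2, (hmem x.1 x.2).1⟩
  have hinj : e.Injective := by
    rintro ⟨r, k⟩ ⟨s, l⟩ h
    have h : Nat.nth (p r) k = Nat.nth (p s) l := Fin.ext_iff.1 h
    obtain rfl : r = s := by
      rw [← (hmem r k).2, ← (hmem s l).2, h]
    rcases lt_trichotomy k l with hkl | rfl | hkl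
    · exact absurd h (hmono r k l hkl).ne
    · rfl
    · exact absurd h (hmono r l k hkl).ne'
  have hbij : e.Bijective := by
    rw [Fintype.bijective_iff_injective_and_card]
    exact ⟨hinj, by simp⟩
  -- Just after the occurrence number `k` (from 0) of `s`, the ballot property gives at least `k +
  -- 1` letters `r`, so their occurrence number `k` came earlier.
  have hcol : ∀ r s, r ≠ s → (∀ i ≤ 3 * n, Nat.count (p s) i ≤ Nat.count (p r) i) →
      ∀ k : Fin n, Nat.nth (p r) k < Nat.nth (p s) k := by
    intro r s hrs hle k
    have h3 := hle (Nat.nth (p s) k + 1) (hmem s k).1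
    rw [Nat.count_succ, Nat.count_nth_of_lt_card_finite (hfin s) (hfcard s k),
      if_pos (hmem s k)] at h3
    have h4 : Nat.nth (p r) k < Nat.nth (p s) k + 1 := Nat.nth_lt_of_lt_count (by omega)
    refine lt_of_le_of_ne (by omega) fun h5 => hrs ?_
    rw [← (hmem r k).2, ← (hmem s k).2, h5]
  have c1 := hcol 0 1 (by decide) fun i hi => by
    rw [hcount _ i hi, hcount _ i hi]; exact h1 i hi
  have c2 := hcol 1 2 (by decide) fun i hi => by
    rw [hcount _ i hi, hcount _ i hi]; exact h2 i hi
  let T : Tableau n := ⟨Equiv.ofBijective e hbij, fun r k l hkl => hmono r k l hkl, fun k => by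
    rw [Fin.strictMono_iff_lt_succ]
    intro r
    fin_cases r
    · exact c1 k
    · exact c2 k⟩
  refine ⟨T, fun i hi => ?_⟩
  obtain ⟨r, k, rfl⟩ := T.exists_entry_eq hi
  rw [T.word_entry]
  exact (hmem r k).2.symm

namespace RootedData

/-- Nonnegative list lengths give the ballot inequalities; the empty final lists give equally many
letters of each kind. -/
theorem IsReading.length {K : RootedData} {N : ℕ} {w : ℕ → Fin 3} {s : ℕ → Scan K}
    (h : K.IsReading N w s) {i : ℕ} (hi : i ≤ N) :
    (s i).right.length + Nat.count (fun i => w i = 1) i = Nat.count (fun i => w i = 0) i ∧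
      (s i).left.length + Nat.count (fun i => w i = 2) i = Nat.count (fun i => w i = 1) i ∧
      Nat.count (fun i => w i = 0) i + Nat.count (fun i => w i = 1) i +
        Nat.count (fun i => w i = 2) i = i := by
  induction i with
  | zero => simp [h.left_zero, h.right_zero]
  | succ i ih =>
    obtain ⟨h1, h2, h3⟩ := ih (by omega)
    simp only [Nat.count_succ]
    rcases h.step i hi with ⟨e, -, -, h4, h5⟩ | ⟨e, -, h4, h5⟩ | ⟨e, -, -, ⟨x, -, h4⟩, h5⟩
    · rw [h4, h5, e, List.length_cons]
      simp only [if_true, show ((0 : Fin 3) = 1) = False by decide,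
        show ((0 : Fin 3) = 2) = False by decide, if_false]
      omega
    · rw [h5, List.length_cons] at h1
      rw [h4, e, List.length_cons]
      simp only [if_true, show ((1 : Fin 3) = 0) = False by decide,
        show ((1 : Fin 3) = 2) = False by decide, if_false]
      omega
    · rw [h4, List.length_cons] at h2
      rw [h5, e]
      simp only [if_true, show ((2 : Fin 3) = 0) = False by decide,
        show ((2 : Fin 3) = 1) = False by decide, if_false]
      omega

theorem IsReading.exists_tableau {K : RootedData} {n : ℕ} {w : ℕ → Fin 3} {s : ℕ → Scan K}
    (h : K.IsReading (3 * n) w s) : ∃ T : Tableau n, ∀ i < 3 * n, T.word i = w i := by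
  obtain ⟨e1, e2, e3⟩ := h.length le_rfl
  rw [h.right_last, List.length_nil] at e1
  rw [h.left_last, List.length_nil] at e2
  refine exists_tableau_word w (fun r => ?_) (fun i hi => ?_) fun i hi => ?_
  · obtain rfl | rfl | rfl := fin_three_cases r <;> omega
  · have := (h.length hi).1; omega
  · have := (h.length hi).2.1; omega

end RootedData

/-! ## Isomorphisms, closure and duality -/

namespace RootedData

/-- The dual map, with the dual root edge. -/
def dual (K : RootedData) : RootedData := ⟨K.toOMap.dual, K.root⟩

variable {K K' : RootedData}

theorem Iso.dual (h : K.Iso K') : K.dual.Iso K'.dual := by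
  obtain ⟨f, h1, h2, h3, h4⟩ := h
  refine ⟨f, fun (d : K.D) => ?_, h2, h3, h4⟩
  change f (K.σ⁻¹ (K.α d)) = K'.σ⁻¹ (K'.α (f d))
  rw [Perm.eq_inv_iff_eq, ← h1, ← h2]
  exact congrArg f (K.σ.apply_symm_apply _)

/-- Duality keeps `α`, and `σ` is recovered from `α` and `φ`. -/
theorem Iso.of_dual (hK : K.IsCubic) (h : K.dual.Iso K'.dual) : K.Iso K' := by
  obtain ⟨f, h1, h2, h3, h4⟩ := h
  change K.D ≃ K'.D at f
  refine ⟨f, fun (d : K.D) => ?_, h2, h3, h4⟩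
  have h5 : f (K.σ⁻¹ (K.α (K.α (K.σ d)))) = K'.σ⁻¹ (K'.α (f (K.α (K.σ d)))) :=
    h1 (K.α (K.σ d))
  have h6 : K'.α (f (K.α (K.σ d))) = f (K.α (K.α (K.σ d))) := (h2 (K.α (K.σ d))).symm
  rw [h6, hK.α_α, Perm.eq_inv_iff_eq, show K.σ⁻¹ (K.σ d) = d from K.σ.symm_apply_apply d] at h5
  exact h5.symm

end RootedData

namespace PrographData

variable {M M' : PrographData}

theorem Iso.closed (h : M.Iso M') : M.closed.Iso M'.closed := by
  obtain ⟨f, h1, h2, h3, h4, h5⟩ := h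
  refine ⟨f, h1, fun d => ?_, h3, h5⟩
  change f (M.α (swap M.inLeg M.outLeg d)) = M'.α (swap M'.inLeg M'.outLeg (f d))
  rw [h2, ← h4, ← h5, f.injective.swap_apply]

theorem Iso.of_closed (hM : M.HasLegs) (hM' : M'.HasLegs) (h : M.closed.Iso M'.closed) :
    M.Iso M' := by
  obtain ⟨f, h1, h2, h3, h4⟩ := h
  have h4 : f M.outLeg = M'.outLeg := h4
  have h5 : f M.inLeg = M'.inLeg := by
    rw [← hM.closed_α_outLeg, ← hM'.closed_α_outLeg, ← h4]
    exact h2 M.outLeg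
  refine ⟨f, h1, fun d => ?_, h3, h5, h4⟩
  by_cases e1 : d = M.inLeg
  · rw [e1, hM.inLeg, h5, hM'.inLeg]
  by_cases e2 : d = M.outLeg
  · rw [e2, hM.outLeg, h4, hM'.outLeg]
  rw [← closed_α_of_ne e1 e2, ← closed_α_of_ne (fun e => e1 (f.injective (e.trans h5.symm)))
    (fun e => e2 (f.injective (e.trans h4.symm)))]
  exact h2 d

end PrographData

/-! ## The prograph dual to a triangulation -/

namespace RootedData

/-- The prograph whose dual is `R`. -/
abbrev predual (R : RootedData) : PrographData where
  D := R.D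
  σ := R.α * R.σ⁻¹
  α := R.α * swap (R.α R.root) R.root
  out := R.out
  inLeg := R.α R.root
  outLeg := R.root

variable {R : RootedData}

/-- The predual cuts the root edge by a swap, and closing applies the same swap again. -/
theorem predual_closed_α : R.predual.closed.α = R.α := by
  change R.α * swap _ _ * swap _ _ = R.α
  rw [mul_assoc, swap_mul_self, mul_one]

theorem predual_closed_φ : R.predual.closed.φ = R.σ := by
  change (R.α * R.σ⁻¹)⁻¹ * R.predual.closed.α = R.σ
  rw [predual_closed_α]
  simp

theorem predual_dual_iso : R.predual.dual.Iso R :=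
  ⟨Equiv.refl _, fun d => congrArg (fun f : Perm R.D => f d) predual_closed_φ,
    fun d => congrArg (fun f : Perm R.D => f d) predual_closed_α, fun _ => rfl, rfl⟩

namespace IsBipolarTriangulation

variable {n : ℕ} (hR : R.IsBipolarTriangulation n)
include hR

theorem predual_hasLegs : R.predual.HasLegs where
  inLeg := by
    change R.α (swap _ _ _) = _
    rw [swap_apply_left]
  outLeg := by
    change R.α (swap _ _ _) = _
    rw [swap_apply_right, hR.wellFormed.1]

theorem predual_σ_σ_σ (d : R.D) :
    R.predual.closed.σ (R.predual.closed.σ (R.predual.closed.σ d)) = d := by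
  have h : ∀ x, R.predual.closed.σ x = R.α (R.φ (R.α x)) := fun x => by
    change R.α (R.σ⁻¹ x) = R.α (R.σ⁻¹ (R.α (R.α x)))
    rw [hR.wellFormed.1]
  rw [h, h, h, hR.wellFormed.1, hR.wellFormed.1, (hR.triangles _).2, hR.wellFormed.1]

theorem predual_σ_ne (d : R.D) : R.predual.closed.σ d ≠ d := by
  intro h
  have h1 : R.α (R.σ⁻¹ d) = d := h
  apply (hR.triangles (R.α d)).1
  change R.σ⁻¹ (R.α (R.α d)) = R.α d
  rw [hR.wellFormed.1]
  rw [← hR.wellFormed.1 (R.σ⁻¹ d), h1]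

/-- So the edge of the next half-edge around a predual vertex ends at the vertex of `d` in `R`: the
three half-edges there are the sides of a triangle. -/
theorem sameCycle_predual (d : R.D) : R.σ.SameCycle d (R.α (R.predual.closed.σ d)) := by
  change R.σ.SameCycle d (R.α (R.α (R.σ⁻¹ d)))
  rw [hR.wellFormed.1]
  exact ⟨-1, by simp⟩

theorem out_α (d : R.D) : R.out (R.α d) = !R.out d := hR.wellFormed.2 d (hR.no_dangling d)

theorem arc_of_out {d : R.D} (h : R.out (R.predual.closed.σ d) = true) :
    R.Arc (R.predual.closed.σ d) d :=
  ⟨_, h, hR.no_dangling _, Perm.SameCycle.refl _ _, (hR.sameCycle_predual d).symm⟩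

theorem arc_of_in {d : R.D} (h : R.out (R.predual.closed.σ d) = false) :
    R.Arc d (R.predual.closed.σ d) :=
  ⟨R.α (R.predual.closed.σ d), by rw [hR.out_α, h]; rfl, hR.no_dangling _,
    hR.sameCycle_predual d, by rw [hR.wellFormed.1]⟩

/-- Three equal directions would make the triangle a directed cycle. In the six other cases the
half-edge whose direction differs from the two others is the distinguished one of a product or a
coproduct. -/
theorem predual_operators (d : R.D) : ∃ e, R.predual.closed.σ.SameCycle d e ∧
    (R.predual.closed.IsCoproduct e ∨ R.predual.closed.IsProduct e) := by
  set τ := R.predual.closed.σ with hτ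
  have h3 : ∀ x, τ (τ (τ x)) = x := hR.predual_σ_σ_σ
  have hne : ∀ x, τ (τ x) ≠ τ x := fun x => hR.predual_σ_ne _
  have c0 : τ.SameCycle d d := Perm.SameCycle.refl _ _
  have c1 : τ.SameCycle d (τ d) := sameCycle_apply τ d
  have c2 : τ.SameCycle d (τ (τ d)) := c1.trans (sameCycle_apply τ _)
  have cop : ∀ x, R.out x = false → R.out (τ x) = true → R.out (τ (τ x)) = true →
      R.predual.closed.IsCoproduct x := fun x h4 h5 h6 => ⟨h3 x, h4, h5, h6, hne x⟩
  have prod : ∀ x, R.out x = true → R.out (τ x) = false → R.out (τ (τ x)) = false →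
      R.predual.closed.IsProduct x := fun x h4 h5 h6 => ⟨h3 x, h4, h5, h6, hne x⟩
  cases e0 : R.out d <;> cases e1 : R.out (τ d) <;> cases e2 : R.out (τ (τ d))
  · have a1 := hR.arc_of_in e1
    have a2 := hR.arc_of_in e2
    have a3 := hR.arc_of_in (d := τ (τ d)) ((congrArg R.out (h3 d)).trans e0)
    rw [← hτ, h3] at a3
    exact absurd ((Relation.TransGen.single a1).tail a2 |>.tail a3) (hR.acyclic d)
  · exact ⟨_, c2, .inr (prod _ e2 (by rw [h3, e0]) (by rw [h3, e1]))⟩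
  · exact ⟨_, c1, .inr (prod _ e1 e2 (by rw [h3, e0]))⟩
  · exact ⟨_, c0, .inl (cop _ e0 e1 e2)⟩
  · exact ⟨_, c0, .inr (prod _ e0 e1 e2)⟩
  · exact ⟨_, c1, .inl (cop _ e1 e2 (by rw [h3, e0]))⟩
  · exact ⟨_, c2, .inl (cop _ e2 (by rw [h3, e0]) (by rw [h3, e1]))⟩
  · have a1 := hR.arc_of_out e1
    have a2 := hR.arc_of_out e2
    have a3 := hR.arc_of_out (d := τ (τ d)) ((congrArg R.out (h3 d)).trans e0)
    rw [← hτ, h3] at a3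
    exact absurd ((Relation.TransGen.single a3).tail a2 |>.tail a1) (hR.acyclic d)

theorem predual_isCubic : R.predual.closed.IsCubic where
  α_α := by rw [predual_closed_α]; exact hR.wellFormed.1
  out_α := by rw [predual_closed_α]; exact hR.out_α
  operators := hR.predual_operators
  root_product := by
    have hsrc := (hR.source R.root).2 (Perm.SameCycle.refl _ _)
    have hsnk := (hR.sink (R.α R.root)).2 (Perm.SameCycle.refl _ _)
    have h3 := hR.predual_σ_σ_σ R.root
    have h1 := hsrc _ (hR.sameCycle_predual R.root)
    have h2 := hR.sameCycle_predual (R.predual.closed.σ (R.predual.closed.σ R.root))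
    rw [h3] at h2
    -- In the triangle at the root edge, one other side leaves the source and the other enters the
    -- sink; this fixes all directions.
    refine ⟨h3, hsrc _ (Perm.SameCycle.refl _ _), ?_, hsnk _ h2.symm, hR.predual_σ_ne _⟩
    rw [hR.out_α] at h1
    simpa using h1
  root_coproduct := by
    rw [predual_closed_α]
    have hsrc := (hR.source R.root).2 (Perm.SameCycle.refl _ _)
    have hsnk := (hR.sink (R.α R.root)).2 (Perm.SameCycle.refl _ _)
    have h3 := hR.predual_σ_σ_σ (R.α R.root)
    have h1 := hsnk _ (hR.sameCycle_predual (R.α R.root))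
    have h2 := hR.sameCycle_predual (R.predual.closed.σ (R.predual.closed.σ (R.α R.root)))
    rw [h3, hR.wellFormed.1] at h2
    refine ⟨h3, hsnk _ (Perm.SameCycle.refl _ _), ?_, hsrc _ h2.symm, hR.predual_σ_ne _⟩
    rw [hR.out_α] at h1
    simpa using h1

theorem predual_bothDirections : R.predual.closed.BothDirections := by
  intro d h1 h2
  rw [predual_closed_φ, predual_closed_α] at *
  have h3 : ¬ R.IsSource d := fun h => h1 ((hR.source d).1 h).symm
  have h4 : ¬ R.IsSink d := fun h => h2 ((hR.sink d).1 h).symm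
  simp only [OMap.IsSource, OMap.IsSink, not_forall, exists_prop, Bool.not_eq_true,
    Bool.not_eq_false] at h3 h4
  exact ⟨h4, h3⟩

theorem predual_connected : R.predual.closed.Connected := by
  have hα : ∀ x : R.D, Relation.EqvGen (fun a b => b = R.predual.closed.σ a ∨
      b = R.predual.closed.α a) x (R.α x) := fun x => .rel _ _ (.inr (by rw [predual_closed_α]))
  have hσ : ∀ x : R.D, Relation.EqvGen (fun a b => b = R.predual.closed.σ a ∨
      b = R.predual.closed.α a) (R.σ x) (R.α x) := fun x => .rel _ _ (.inl (by
    change _ = R.α (R.σ⁻¹ (R.σ x))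
    simp))
  intro x y
  have h := hR.connected x y
  induction h with
  | rel x y h =>
    rcases h with rfl | rfl
    · exact (hα x).trans _ _ _ (hσ x).symm
    · exact hα x
  | refl x => exact .refl x
  | symm x y _ ih => exact .symm _ _ ih
  | trans x y z _ _ ih1 ih2 => exact .trans _ _ _ ih1 ih2

theorem card_eq : Nat.card R.predual.D = 6 * n := by
  have h := card_eq_three_mul R.φ (fun d => (hR.triangles d).2) fun d => (hR.triangles d).1
  change Nat.card R.D = 3 * R.numFaces at h
  rw [hR.size] at h
  change Nat.card R.D = _
  omega

/-- Acyclicity and connectedness of the opened prograph are not read off from `R` directly: the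
Euler count gives a reading, and the reading gives them. -/
theorem predual_isPCPrograph : R.predual.IsPCPrograph n := by
  have hK := hR.predual_isCubic
  have hV := hK.numVertices_eq n hR.card_eq
  have hF : R.predual.closed.numFaces = n + 2 := by
    have h1 := hR.spherical
    have h2 := hR.size
    have h3 := hK.numEdges_eq n hR.card_eq
    have h4 : R.predual.closed.numEdges = R.numEdges := by
      unfold OMap.numEdges
      rw [predual_closed_α]
    have h5 : R.predual.closed.numFaces = R.numVertices := by
      unfold OMap.numFaces OMap.numVertices
      rw [predual_closed_φ]
    unfold OMap.Spherical at h1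
    omega
  obtain ⟨N, w, s, h⟩ := hK.exists_reading
    (hK.faceCorners hR.predual_bothDirections hV hF) hR.predual_connected
  exact PrographData.isPCPrograph_of_reading hR.predual_hasLegs hK h hR.card_eq

end IsBipolarTriangulation
end RootedData

/-! ## The bijections -/

section Bijections

variable {n : ℕ}

theorem Tableau.bijOn_toPrograph [NeZero n] :
    Set.BijOn (fun T : Tableau n => T.toPrograph) Set.univ (pcPrographs n) := by
  refine ⟨fun T _ => ⟨_, T.isPCPrograph, rfl⟩, fun T _ T' _ h => ?_, ?_⟩
  · have h1 : T.prograph.Iso T'.prograph := Quotient.exact h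
    rw [prograph_eq, prograph_eq] at h1
    exact eq_of_word_eq (T.isReading.word_eq_of_iso T'.isReading h1.closed)
  · rintro _ ⟨M, hM, rfl⟩
    obtain ⟨w, s, h⟩ := hM.exists_reading
    obtain ⟨T, hT⟩ := h.exists_tableau
    refine ⟨T, trivial, Quotient.sound ?_⟩
    change T.prograph.Iso M
    rw [prograph_eq]
    exact .of_closed hasLegs hM.hasLegs (T.isReading.iso isCubic h hM.isCubic hT)

theorem bijOn_dual :
    Set.BijOn PrographClass.dual (pcPrographs n) (bipolarTriangulations n) := by
  refine ⟨?_, ?_, ?_⟩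
  · rintro _ ⟨M, hM, rfl⟩
    exact ⟨M.dual, hM.dual_isBipolarTriangulation, rfl⟩
  · rintro _ ⟨M, hM, rfl⟩ _ ⟨M', hM', rfl⟩ h
    have h1 : M.closed.dual.Iso M'.closed.dual := Quotient.exact h
    exact Quotient.sound (.of_closed hM.hasLegs hM'.hasLegs (.of_dual hM.isCubic h1))
  · rintro _ ⟨R, hR, rfl⟩
    exact ⟨_, ⟨R.predual, hR.predual_isPCPrograph, rfl⟩,
      Quotient.sound RootedData.predual_dual_iso⟩

/-- The closed prograph of the involuted tableau and the rotated closed prograph have readings with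
the same word, so they are isomorphic; duality transports this. -/
theorem Tableau.toTriangulation_schutzenberger [NeZero n] (T : Tableau n) :
    T.schutzenberger.toTriangulation = T.toTriangulation.rotate := by
  have h1 : (glued n T.schutzenberger.gluing).closed.Iso (glued n T.gluing).closed.rotate :=
    T.schutzenberger.isReading.iso isCubic (T.isReading.rotate isCubic) isCubic.rotate
      fun i hi => word_schutzenberger hi
  change Quotient.mk _ T.schutzenberger.prograph.dual = Quotient.mk _ T.prograph.dual.rotate
  rw [prograph_eq, prograph_eq]
  exact Quotient.sound h1.dual

end Bijections

end PC

theorem theorem1 (n : ℕ) [NeZero n] :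
    Set.BijOn (fun T : PC.Tableau n => T.toPrograph) Set.univ (PC.pcPrographs n) ∧
    Set.BijOn PC.PrographClass.dual (PC.pcPrographs n) (PC.bipolarTriangulations n) ∧
    Set.BijOn (fun T : PC.Tableau n => T.toTriangulation) Set.univ (PC.bipolarTriangulations n) ∧
    ∀ T : PC.Tableau n, T.schutzenberger.toTriangulation = T.toTriangulation.rotate :=
  ⟨PC.Tableau.bijOn_toPrograph, PC.bijOn_dual, PC.bijOn_dual.comp PC.Tableau.bijOn_toPrograph,
    PC.Tableau.toTriangulation_schutzenberger⟩
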